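/- Complex manifolds are Hausdorff and of pure finite dimension. Let $a(z)=-1/\bar z$ be the antipodal map of $\mathbb{CP}^1$. A smooth space with a real structure over $\mathbb{CP}^1$ is a complex manifold $Z$ with a surjective holomorphic submersion $Z\to\mathbb{CP}^1$ and an antiholomorphic involution of $Z$ covering $a$. A twistor group is a group object $\pi:\mathcal G\to\mathbb{CP}^1$, with real structure $\tau$, in the category of such spaces (morphisms are the holomorphic maps over $\mathbb{CP}^1$ commuting with the real structures). An action of $\mathcal G$ on such a space $P$ is a morphism $\mathcal G\times_{\mathbb{CP}^1}P\to P$ which is a group action on every fibre. The action is free if every fibre action is free, and regular if the quotient ringed space $P/\mathcal G$ is a smooth space over $\mathbb{CP}^1$ and $P\to P/\mathcal G$ is a submersion. Let $\mathcal G$ be a second countable twistor group and let $p:T\to\mathbb{CP}^1$ be a smooth space with a real structure $\sigma$. A principal $\mathcal G$-bundle over $T$ is a smooth space $P$ with a real structure over $\mathbb{CP}^1$ carrying a free regular action of $\mathcal G$, with $P/\mathcal G=T$ (as spaces with a real structure over $\mathbb{CP}^1$). Isomorphisms of principal bundles are the $\mathcal G$-equivariant biholomorphic maps over $T$ that commute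 with the real structures. Let $\mathcal O(p^*\mathcal G)$ be the sheaf of groups on $T$ whose sections over $U$ are the holomorphic maps $s:U\to\mathcal G$ with $\pi\circ s=p|_U$. Consider open coverings $\{U_i\}_{i\in I}$ of $T$ with an involution $i\mapsto\bar\imath$ of $I$ such that $U_{\bar\imath}=\sigma(U_i)$; refinements are required to respect the involutions of the index sets. A real cocycle on $\{U_i\}$ is a family of sections $\varphi_{ij}$ of $\mathcal O(p^*\mathcal G)$ over $U_i\cap U_j$ with $\varphi_{ij}\varphi_{jk}=\varphi_{ik}$ and $\varphi_{\bar\imath\bar\jmath}\circ\sigma=\tau\circ\varphi_{ij}$. Two real cocycles on the same covering are cohomologous if $\varphi'_{ij}=f_i\varphi_{ij}f_j^{-1}$ for sections $f_i$ over $U_i$ with $f_{\bar\imath}\circ\sigma=\tau\circ f_i$. Let $H^1_{\mathbb R}(T,\mathcal O(p^*\mathcal G))$ be the set of real cocycles on all such coverings, two of them being identified if they become cohomologous on a common refinement. Then the set of isomorphism classes of principal $\mathcal G$-bundles over $T$ is in bijection with $H^1_{\mathbb R}(T,\mathcal O(p^*\mathcal G))$. More precisely, there is a bijection under which, for every principal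 $\mathcal G$-bundle $\pi_P:P\to T$ with real structure $\tau_P$ and every real cocycle $(\varphi_{ij})$ on a covering $\{U_i\}$ as above, the class of $P$ corresponds to the class of $(\varphi_{ij})$ if and only if there are holomorphic sections $s_i:U_i\to P$ of $\pi_P$ with $s_{\bar\imath}\circ\sigma=\tau_P\circ s_i$ and $s_i=\varphi_{ij}\cdot s_j$ on $U_i\cap U_j$. -/

import Mathlib

open scoped Manifold ContDiff Topology

universe u v w

/-! ### The Riemann sphere -/

/-- The complex projective line `ℂP¹ = ℂ ∪ {∞}`. -/
abbrev CP1 : Type := OnePoint ℂ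

namespace CP1

open OnePoint Filter

/-- The involution `z ↦ 1 / z` of `ℂP¹`, exchanging `0` and `∞`. -/
noncomputable def inversion (x : CP1) : CP1 :=
  x.elim ((0 : ℂ) : CP1) fun z => if z = 0 then infty else ((z⁻¹ : ℂ) : CP1)

@[simp] theorem inversion_infty : inversion infty = ((0 : ℂ) : CP1) := rfl

theorem inversion_coe (z : ℂ) :
    inversion (z : CP1) = if z = 0 then infty else ((z⁻¹ : ℂ) : CP1) := rfl

@[simp] theorem inversion_zero : inversion ((0 : ℂ) : CP1) = infty := by
  simp [inversion_coe]

theorem inversion_coe_of_ne {z : ℂ} (hz : z ≠ 0) :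
    inversion (z : CP1) = ((z⁻¹ : ℂ) : CP1) := by
  simp [inversion_coe, hz]

theorem inversion_inversion (x : CP1) : inversion (inversion x) = x := by
  induction x using OnePoint.rec with
  | infty => simp
  | coe z =>
    by_cases hz : z = 0
    · simp [hz]
    · rw [inversion_coe_of_ne hz, inversion_coe_of_ne (inv_ne_zero hz), inv_inv]

theorem continuous_inversion : Continuous inversion := by
  rw [OnePoint.continuous_iff]
  have hcc : coclosedCompact ℂ = Bornology.cobounded ℂ := by
    rw [coclosedCompact_eq_cocompact, Metric.cobounded_eq_cocompact]
  constructor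
  · rw [hcc, inversion_infty]
    have h1 : Tendsto (fun z : ℂ => ((z⁻¹ : ℂ) : CP1)) (Bornology.cobounded ℂ)
        (𝓝 ((0 : ℂ) : CP1)) :=
      (OnePoint.continuous_coe.tendsto (0 : ℂ)).comp tendsto_inv₀_cobounded
    refine h1.congr' ?_
    have h0 : ∀ᶠ z : ℂ in Bornology.cobounded ℂ, z ≠ 0 :=
      Metric.cobounded_eq_cocompact (α := ℂ) ▸ (isCompact_singleton (x := (0 : ℂ))).compl_mem_cocompact
    filter_upwards [h0] with z hz
    rw [inversion_coe_of_ne hz]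
  · rw [continuous_iff_continuousAt]
    intro z
    by_cases hz : z = 0
    · subst hz
      rw [continuousAt_iff_punctured_nhds, inversion_zero]
      have h1 : Tendsto (fun z : ℂ => ((z⁻¹ : ℂ) : CP1)) (𝓝[≠] 0) (𝓝 (infty : CP1)) := by
        refine (OnePoint.tendsto_coe_infty (X := ℂ)).comp ?_
        rw [hcc]
        exact tendsto_inv₀_nhdsNE_zero
      refine h1.congr' ?_
      filter_upwards [self_mem_nhdsWithin] with w hw
      rw [inversion_coe_of_ne hw]
    · have h1 : ContinuousAt (fun z : ℂ => ((z⁻¹ : ℂ) : CP1)) z :=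
        OnePoint.continuous_coe.continuousAt.comp (continuousAt_inv₀ hz)
      refine h1.congr ?_
      filter_upwards [isOpen_ne.mem_nhds hz] with w hw
      rw [inversion_coe_of_ne hw]

/-- `z ↦ 1 / z` as a self-homeomorphism of `ℂP¹`. -/
noncomputable def inversionHomeo : CP1 ≃ₜ CP1 where
  toFun := inversion
  invFun := inversion
  left_inv := inversion_inversion
  right_inv := inversion_inversion
  continuous_toFun := continuous_inversion
  continuous_invFun := continuous_inversion

/-- The affine coordinate `z` on `ℂP¹ ∖ {∞}`. -/
noncomputable def chartZ : OpenPartialHomeomorph CP1 ℂ where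
  toFun x := x.elim 0 id
  invFun z := (z : CP1)
  source := {infty}ᶜ
  target := Set.univ
  map_source' _ _ := Set.mem_univ _
  map_target' z _ := by simp
  left_inv' x hx := by
    induction x using OnePoint.rec with
    | infty => simp at hx
    | coe z => simp
  right_inv' z _ := by simp
  open_source := isOpen_compl_singleton
  open_target := isOpen_univ
  continuousOn_toFun x hx := by
    induction x using OnePoint.rec with
    | infty => simp at hx
    | coe z =>
      exact ContinuousAt.continuousWithinAt
        (OnePoint.continuousAt_coe.2 (show ContinuousAt (fun w : ℂ => w) z from continuousAt_id))
  continuousOn_invFun := OnePoint.continuous_coe.continuousOn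

@[simp] theorem chartZ_coe (z : ℂ) : chartZ (z : CP1) = z := rfl

@[simp] theorem chartZ_symm_apply (z : ℂ) : chartZ.symm z = (z : CP1) := rfl

@[simp] theorem chartZ_source : chartZ.source = {infty}ᶜ := rfl

@[simp] theorem chartZ_target : chartZ.target = Set.univ := rfl

/-- The affine coordinate `1 / z` on `ℂP¹ ∖ {0}`. -/
noncomputable def chartW : OpenPartialHomeomorph CP1 ℂ :=
  inversionHomeo.toOpenPartialHomeomorph.trans chartZ

noncomputable instance : ChartedSpace ℂ CP1 where
  atlas := {chartZ, chartW}
  chartAt x := x.elim chartW fun _ => chartZ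
  mem_chart_source x := by
    induction x using OnePoint.rec with
    | infty => simp [chartW, inversionHomeo]
    | coe z => simp
  chart_mem_atlas x := by
    induction x using OnePoint.rec with
    | infty => simp
    | coe z => simp

/-- `ℂP¹` is a complex manifold of dimension one. -/
instance : IsManifold 𝓘(ℂ, ℂ) ω CP1 := by
  apply isManifold_of_contDiffOn
  have key : ∀ s : Set ℂ, (∀ z ∈ s, z ≠ 0) → ∀ f : ℂ → ℂ, (∀ z ∈ s, f z = z⁻¹) →
      ContDiffOn ℂ ω f s := by
    intro s hs f hf
    have : ContDiffOn ℂ ω (fun z : ℂ => z⁻¹) s :=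
      fun z hz => (contDiffAt_inv ℂ (hs z hz)).contDiffWithinAt
    exact this.congr hf
  have keyid : ∀ s : Set ℂ, ∀ f : ℂ → ℂ, (∀ z ∈ s, f z = z) → ContDiffOn ℂ ω f s :=
    fun s f hf => contDiffOn_id.congr hf
  rintro e e' (rfl | rfl) (rfl | rfl)
  · exact keyid _ _ fun z _ => by simp
  · refine key _ ?_ _ ?_
    · rintro z hz rfl
      simp [chartW, inversionHomeo] at hz
    · intro z hz
      have h0 : z ≠ 0 := by
        rintro rfl
        simp [chartW, inversionHomeo] at hz
      simp [chartW, inversionHomeo, inversion_coe_of_ne h0]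
  · refine key _ ?_ _ ?_
    · rintro z hz rfl
      simp [chartW, inversionHomeo] at hz
    · intro z hz
      have h0 : z ≠ 0 := by
        rintro rfl
        simp [chartW, inversionHomeo] at hz
      simp [chartW, inversionHomeo, inversion_coe_of_ne h0]
  · exact keyid _ _ fun z _ => by simp [chartW, inversionHomeo, inversion_inversion]

/-- The antipodal map `z ↦ -1 / conj z` of `ℂP¹`. -/
noncomputable def antipode (x : CP1) : CP1 :=
  x.elim ((0 : ℂ) : CP1) fun z => if z = 0 then infty else ((-(star z)⁻¹ : ℂ) : CP1)

end CP1

/-! ### Spaces with a real structure over the Riemann sphere -/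

section Spaces

variable {E : Type*} [NormedAddCommGroup E] [NormedSpace ℂ E]
  {F : Type*} [NormedAddCommGroup F] [NormedSpace ℂ F]

/-- A map of complex manifolds is antiholomorphic if it is continuous and the pull-back of every
local holomorphic function is the complex conjugate of a holomorphic function. -/
def AntiHolomorphic {M : Type*} [TopologicalSpace M] [ChartedSpace E M]
    {N : Type*} [TopologicalSpace N] [ChartedSpace F N] (f : M → N) : Prop :=
  Continuous f ∧ ∀ (V : Set N) (g : N → ℂ), IsOpen V → ContMDiffOn 𝓘(ℂ, F) 𝓘(ℂ, ℂ) ω g V →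
    ContMDiffOn 𝓘(ℂ, E) 𝓘(ℂ, ℂ) ω (fun x => star (g (f x))) (f ⁻¹' V)

/-- The structure, on a complex manifold `Z`, of a smooth space over `ℂP¹` with a real structure:
a surjective holomorphic submersion `proj : Z → ℂP¹` and an antiholomorphic involution `real` of
`Z` covering the antipodal map. (A submersion of class `ω` is in particular holomorphic.) -/
structure RealSpace (E : Type*) [NormedAddCommGroup E] [NormedSpace ℂ E]
    (Z : Type*) [TopologicalSpace Z] [ChartedSpace E Z] where
  proj : Z → CP1
  proj_surjective : Function.Surjective proj
  proj_submersion : Manifold.IsSubmersion 𝓘(ℂ, E) 𝓘(ℂ, ℂ) ω proj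
  real : Z → Z
  real_antiholomorphic : AntiHolomorphic (E := E) (F := E) real
  real_real : ∀ z, real (real z) = z
  proj_real : ∀ z, proj (real z) = CP1.antipode (proj z)

/-- A twistor group: a group object in the category of smooth spaces with a real structure over
`ℂP¹`. The multiplication is a morphism on the fibre product `G ×_{ℂP¹} G`; it is recorded as a
function on `G × G` of which only the values on `{(g, h) | proj g = proj h}` are meaningful.
Holomorphy on the fibre product, which is a closed complex submanifold of `G × G`, is `ContMDiffOn`
at order `ω`, that is, near each of its points the map is the restriction of a holomorphic map of
the ambient manifold. -/
structure TwistorGroup (E : Type*) [NormedAddCommGroup E] [NormedSpace ℂ E]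
    (G : Type*) [TopologicalSpace G] [ChartedSpace E G] extends RealSpace E G where
  mul : G → G → G
  inv : G → G
  one : CP1 → G
  mul_holomorphic : ContMDiffOn (𝓘(ℂ, E).prod 𝓘(ℂ, E)) 𝓘(ℂ, E) ω
    (fun q : G × G => mul q.1 q.2) {q | proj q.1 = proj q.2}
  inv_holomorphic : ContMDiff 𝓘(ℂ, E) 𝓘(ℂ, E) ω inv
  one_holomorphic : ContMDiff 𝓘(ℂ, ℂ) 𝓘(ℂ, E) ω one
  proj_mul : ∀ g h, proj g = proj h → proj (mul g h) = proj g
  proj_inv : ∀ g, proj (inv g) = proj g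
  proj_one : ∀ x, proj (one x) = x
  mul_assoc : ∀ g h k, proj g = proj h → proj h = proj k → mul (mul g h) k = mul g (mul h k)
  one_mul : ∀ g, mul (one (proj g)) g = g
  mul_one : ∀ g, mul g (one (proj g)) = g
  inv_mul : ∀ g, mul (inv g) g = one (proj g)
  mul_inv : ∀ g, mul g (inv g) = one (proj g)
  real_mul : ∀ g h, proj g = proj h → real (mul g h) = mul (real g) (real h)
  real_inv : ∀ g, real (inv g) = inv (real g)
  real_one : ∀ x, real (one x) = one (CP1.antipode x)

variable {G : Type*} [TopologicalSpace G] [ChartedSpace E G]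
  {Z : Type*} [TopologicalSpace Z] [ChartedSpace F Z]

/-- An action of a twistor group on a smooth space with a real structure over `ℂP¹`: a holomorphic
map `G ×_{ℂP¹} Z → Z` over `ℂP¹`, which is a group action on each fibre and which respects the
real structures. Only the values on `{(g, z) | proj g = proj z}` are meaningful. -/
structure TwistorAction (𝒢 : TwistorGroup E G) (𝒵 : RealSpace F Z) where
  act : G → Z → Z
  act_holomorphic : ContMDiffOn (𝓘(ℂ, E).prod 𝓘(ℂ, F)) 𝓘(ℂ, F) ω
    (fun q : G × Z => act q.1 q.2) {q | 𝒢.proj q.1 = 𝒵.proj q.2}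
  proj_act : ∀ g z, 𝒢.proj g = 𝒵.proj z → 𝒵.proj (act g z) = 𝒵.proj z
  one_act : ∀ z, act (𝒢.one (𝒵.proj z)) z = z
  mul_act : ∀ g h z, 𝒢.proj g = 𝒵.proj z → 𝒢.proj h = 𝒵.proj z →
    act (𝒢.mul g h) z = act g (act h z)
  real_act : ∀ g z, 𝒢.proj g = 𝒵.proj z → 𝒵.real (act g z) = act (𝒢.real g) (𝒵.real z)

namespace TwistorAction

variable {𝒢 : TwistorGroup E G} {𝒵 : RealSpace F Z}

/-- The action is free on each fibre. -/
def IsFree (a : TwistorAction 𝒢 𝒵) : Prop :=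
  ∀ g z, 𝒢.proj g = 𝒵.proj z → a.act g z = z → g = 𝒢.one (𝒵.proj z)

/-- Two points are in the same orbit of the fibre of `𝒢` over their common projection. -/
def SameOrbit (a : TwistorAction 𝒢 𝒵) (z z' : Z) : Prop :=
  ∃ g, 𝒢.proj g = 𝒵.proj z ∧ a.act g z = z'

/-- The action is regular with quotient `Z / 𝒢 = T`, by the projection `π : Z → T`: as a ringed
space, `T` is the quotient of `Z` by the orbit relation (same points, quotient topology, and the
holomorphic functions are those that are holomorphic on `Z`), the projection to `ℂP¹` and the real
structure of the smooth space `T` are induced by those of `Z`, and `π` is a submersion. -/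
structure IsRegularQuotient {F' : Type*} [NormedAddCommGroup F'] [NormedSpace ℂ F']
    {T : Type*} [TopologicalSpace T] [ChartedSpace F' T]
    (a : TwistorAction 𝒢 𝒵) (𝒯 : RealSpace F' T) (π : Z → T) : Prop where
  eq_iff : ∀ z z', π z = π z' ↔ a.SameOrbit z z'
  isQuotientMap : Topology.IsQuotientMap π
  holomorphic_iff : ∀ (V : Set T) (f : T → ℂ), IsOpen V →
    (ContMDiffOn 𝓘(ℂ, F') 𝓘(ℂ, ℂ) ω f V ↔
      ContMDiffOn 𝓘(ℂ, F) 𝓘(ℂ, ℂ) ω (f ∘ π) (π ⁻¹' V))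
  submersion : Manifold.IsSubmersion 𝓘(ℂ, F) 𝓘(ℂ, F') ω π
  proj_eq : ∀ z, 𝒯.proj (π z) = 𝒵.proj z
  real_eq : ∀ z, 𝒯.real (π z) = π (𝒵.real z)

end TwistorAction

end Spaces

/-! ### Principal bundles -/

section Bundles

variable {E : Type v} [NormedAddCommGroup E] [NormedSpace ℂ E]
  {G : Type u} [TopologicalSpace G] [ChartedSpace E G]
  {F : Type w} [NormedAddCommGroup F] [NormedSpace ℂ F]
  {T : Type u} [TopologicalSpace T] [ChartedSpace F T]

/-- A principal `𝒢`-bundle over `T`: a smooth space `P` with a real structure over `ℂP¹` and a free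
regular action of `𝒢` on it, with quotient `P / 𝒢 = T`. -/
structure PrincipalBundle (𝒢 : TwistorGroup E G) (𝒯 : RealSpace F T) where
  carrier : Type u
  dim : ℕ
  [topologicalSpace : TopologicalSpace carrier]
  [t2Space : T2Space carrier]
  [chartedSpace : ChartedSpace (EuclideanSpace ℂ (Fin dim)) carrier]
  [isManifold : IsManifold 𝓘(ℂ, EuclideanSpace ℂ (Fin dim)) ω carrier]
  space : RealSpace (EuclideanSpace ℂ (Fin dim)) carrier
  action : TwistorAction 𝒢 space
  free : action.IsFree
  π : carrier → T
  regular : action.IsRegularQuotient 𝒯 π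

namespace PrincipalBundle

attribute [instance] topologicalSpace t2Space chartedSpace isManifold

variable {𝒢 : TwistorGroup E G} {𝒯 : RealSpace F T}

/-- Isomorphism of principal `𝒢`-bundles over `T`: a biholomorphic map over `T` which is
`𝒢`-equivariant and commutes with the real structures. -/
def Isomorphic (P Q : PrincipalBundle 𝒢 𝒯) : Prop :=
  ∃ Φ : Diffeomorph 𝓘(ℂ, EuclideanSpace ℂ (Fin P.dim)) 𝓘(ℂ, EuclideanSpace ℂ (Fin Q.dim))
      P.carrier Q.carrier ω,
    (∀ z, Q.π (Φ z) = P.π z) ∧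
    (∀ g z, 𝒢.proj g = P.space.proj z → Φ (P.action.act g z) = Q.action.act g (Φ z)) ∧
    (∀ z, Φ (P.space.real z) = Q.space.real (Φ z))

theorem proj_eq_of_π_eq {P Q : PrincipalBundle 𝒢 𝒯} {z : P.carrier} {z' : Q.carrier}
    (h : Q.π z' = P.π z) : Q.space.proj z' = P.space.proj z := by
  rw [← P.regular.proj_eq, ← Q.regular.proj_eq, h]

variable (𝒢 𝒯) in
theorem isomorphic_equivalence :
    Equivalence (Isomorphic (𝒢 := 𝒢) (𝒯 := 𝒯)) where
  refl P := ⟨Diffeomorph.refl _ _ _, fun _ => rfl, fun _ _ _ => rfl, fun _ => rfl⟩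
  symm := by
    rintro P Q ⟨Φ, h1, h2, h3⟩
    have h1' : ∀ z, P.π (Φ.symm z) = Q.π z := fun z => by rw [← h1, Φ.apply_symm_apply]
    refine ⟨Φ.symm, h1', fun g z hg => ?_, fun z => ?_⟩
    · apply Φ.injective; change Φ _ = Φ _
      rw [h2 _ _ (hg.trans (proj_eq_of_π_eq (h1' z)).symm), Φ.apply_symm_apply,
        Φ.apply_symm_apply]
    · apply Φ.injective; change Φ _ = Φ _
      rw [h3, Φ.apply_symm_apply, Φ.apply_symm_apply]
  trans := by
    rintro P Q R ⟨Φ, h1, h2, h3⟩ ⟨Ψ, k1, k2, k3⟩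
    refine ⟨Φ.trans Ψ, fun z => ?_, fun g z hg => ?_, fun z => ?_⟩
    · simp [h1, k1]
    · simp only [Diffeomorph.coe_trans, Function.comp_apply]
      rw [h2 _ _ hg, k2 _ _ (hg.trans (proj_eq_of_π_eq (h1 z)).symm)]
    · simp [h3, k3]

variable (𝒢 𝒯) in
/-- Isomorphism as an equivalence relation on principal `𝒢`-bundles over `T`. -/
def isoSetoid : Setoid (PrincipalBundle 𝒢 𝒯) := ⟨Isomorphic, isomorphic_equivalence 𝒢 𝒯⟩

variable (𝒢 𝒯) in
/-- The isomorphism classes of principal `𝒢`-bundles over `T`. -/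
def IsoClass := Quotient (isoSetoid 𝒢 𝒯)

/-- The isomorphism class of a principal bundle. -/
def isoClass (P : PrincipalBundle 𝒢 𝒯) : IsoClass 𝒢 𝒯 := Quotient.mk (isoSetoid 𝒢 𝒯) P

end PrincipalBundle

/-! ### Real nonabelian cohomology -/

/-- An open covering of `T` invariant under the real structure `σ`: an involution `bar` of the
index set with `U_{bar i} = σ(U_i)`. -/
structure RealCover (𝒯 : RealSpace F T) where
  ι : Type u
  U : ι → Set T
  isOpen : ∀ i, IsOpen (U i)
  covers : ∀ x, ∃ i, x ∈ U i
  bar : ι → ι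
  bar_bar : ∀ i, bar (bar i) = i
  U_bar : ∀ i, U (bar i) = 𝒯.real '' U i

/-- `s` restricts to a section over `U` of the sheaf `𝒪(p^*𝒢)` on `T`, that is, to a holomorphic map
`U → G` over `ℂP¹` (the section of `p^*𝒢 = T ×_{ℂP¹} G` being `x ↦ (x, s x)`). Values off `U` are
ignored. -/
def IsSection (𝒢 : TwistorGroup E G) (𝒯 : RealSpace F T) (U : Set T) (s : T → G) : Prop :=
  ContMDiffOn 𝓘(ℂ, F) 𝓘(ℂ, E) ω s U ∧ ∀ x ∈ U, 𝒢.proj (s x) = 𝒯.proj x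

/-- A real 1-cocycle of a real covering with values in `𝒪(p^*𝒢)`: sections `φ_{ij}` over
`U_i ∩ U_j` with `φ_{ij} φ_{jk} = φ_{ik}` on `U_i ∩ U_j ∩ U_k`, equivariant for the real
structures: `φ_{bar i, bar j}(σ(x)) = τ(φ_{ij}(x))`. -/
structure RealCocycle (𝒢 : TwistorGroup E G) {𝒯 : RealSpace F T} (𝒰 : RealCover 𝒯) where
  φ : 𝒰.ι → 𝒰.ι → T → G
  isSection : ∀ i j, IsSection 𝒢 𝒯 (𝒰.U i ∩ 𝒰.U j) (φ i j)
  cocycle : ∀ i j k, ∀ x ∈ 𝒰.U i ∩ 𝒰.U j ∩ 𝒰.U k, 𝒢.mul (φ i j x) (φ j k x) = φ i k x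
  real : ∀ i j, ∀ x ∈ 𝒰.U i ∩ 𝒰.U j,
    φ (𝒰.bar i) (𝒰.bar j) (𝒯.real x) = 𝒢.real (φ i j x)

/-- A refinement `𝒱` of a real covering `𝒰`, with its index map, compatible with the involutions. -/
structure RealCover.Refinement {𝒯 : RealSpace F T} (𝒱 𝒰 : RealCover 𝒯) where
  index : 𝒱.ι → 𝒰.ι
  subset : ∀ k, 𝒱.U k ⊆ 𝒰.U (index k)
  index_bar : ∀ k, index (𝒱.bar k) = 𝒰.bar (index k)

namespace RealCocycle

variable {𝒢 : TwistorGroup E G} {𝒯 : RealSpace F T}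

/-- The restriction of a cocycle to a refinement. -/
def restrict {𝒰 𝒱 : RealCover 𝒯} (c : RealCocycle 𝒢 𝒰) (r : 𝒱.Refinement 𝒰) :
    RealCocycle 𝒢 𝒱 where
  φ k l := c.φ (r.index k) (r.index l)
  isSection k l :=
    have h : 𝒱.U k ∩ 𝒱.U l ⊆ 𝒰.U (r.index k) ∩ 𝒰.U (r.index l) :=
      Set.inter_subset_inter (r.subset k) (r.subset l)
    ⟨(c.isSection _ _).1.mono h, fun x hx => (c.isSection _ _).2 x (h hx)⟩
  cocycle _ _ _ x hx :=
    c.cocycle _ _ _ x ⟨⟨r.subset _ hx.1.1, r.subset _ hx.1.2⟩, r.subset _ hx.2⟩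
  real k l x hx := by
    rw [r.index_bar, r.index_bar]
    exact c.real _ _ x ⟨r.subset _ hx.1, r.subset _ hx.2⟩

/-- Two real cocycles on one real covering are cohomologous: `φ'_{ij} = f_i φ_{ij} f_j⁻¹` for a real
0-cochain `f`, i.e. sections `f_i` over `U_i` with `f_{bar i}(σ(x)) = τ(f_i(x))`. -/
def Cohomologous {𝒰 : RealCover 𝒯} (c c' : RealCocycle 𝒢 𝒰) : Prop :=
  ∃ f : 𝒰.ι → T → G,
    (∀ i, IsSection 𝒢 𝒯 (𝒰.U i) (f i)) ∧
    (∀ i, ∀ x ∈ 𝒰.U i, f (𝒰.bar i) (𝒯.real x) = 𝒢.real (f i x)) ∧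
    ∀ i j, ∀ x ∈ 𝒰.U i ∩ 𝒰.U j,
      c'.φ i j x = 𝒢.mul (𝒢.mul (f i x) (c.φ i j x)) (𝒢.inv (f j x))

end RealCocycle

section H1

variable (𝒢 : TwistorGroup E G) (𝒯 : RealSpace F T)

/-- Two real cocycles, on possibly different real coverings, are equivalent if they become
cohomologous on a common refinement. -/
def H1RRel (a b : Σ 𝒰 : RealCover 𝒯, RealCocycle 𝒢 𝒰) : Prop :=
  ∃ (𝒲 : RealCover 𝒯) (r : 𝒲.Refinement a.1) (s : 𝒲.Refinement b.1),
    (a.2.restrict r).Cohomologous (b.2.restrict s)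

/-- The real nonabelian sheaf cohomology `H¹_ℝ(T, 𝒪(p^*𝒢))`: real cocycles on real coverings modulo
real coboundaries and refinement. -/
def H1R := Quot (H1RRel 𝒢 𝒯)

variable {𝒢 𝒯} in
/-- The cohomology class of a real cocycle. -/
def H1R.mk {𝒰 : RealCover 𝒯} (c : RealCocycle 𝒢 𝒰) : H1R 𝒢 𝒯 := Quot.mk _ ⟨𝒰, c⟩

end H1

/-- The principal bundle `P` has the transition cocycle `φ` on the real covering `U`: there are
holomorphic local sections `s_i` of `P → T` over `U_i`, compatible with the real structures, with
`s_i = φ_{ij} · s_j` on `U_i ∩ U_j`. (Such sections are the same as equivariant local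
trivializations `h_i : π⁻¹(U_i) → p^*𝒢|_{U_i}`, `h_i (g · s_i) = g`, and `φ_{ij}` is then the section
which `h_j ∘ h_i⁻¹` makes correspond to the identity section.) -/
def PrincipalBundle.HasTransitionCocycle {𝒢 : TwistorGroup E G} {𝒯 : RealSpace F T}
    (P : PrincipalBundle 𝒢 𝒯) {𝒰 : RealCover 𝒯} (c : RealCocycle 𝒢 𝒰) : Prop :=
  ∃ s : 𝒰.ι → T → P.carrier,
    (∀ i, ContMDiffOn 𝓘(ℂ, F) 𝓘(ℂ, EuclideanSpace ℂ (Fin P.dim)) ω (s i) (𝒰.U i)) ∧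
    (∀ i, ∀ x ∈ 𝒰.U i, P.π (s i x) = x) ∧
    (∀ i, ∀ x ∈ 𝒰.U i, s (𝒰.bar i) (𝒯.real x) = P.space.real (s i x)) ∧
    ∀ i j, ∀ x ∈ 𝒰.U i ∩ 𝒰.U j, s i x = P.action.act (c.φ i j x) (s j x)

end Bundles

/-!
A principal bundle and a real cocycle correspond to each other when the bundle has local sections,
compatible with the real structures, whose transition functions are the cocycle. The theorem says
that this relation induces a bijection, which comes down to four facts.

*Every principal bundle has a transition cocycle* (`PrincipalBundle.exists_hasTransitionCocycle`).
Since `P → T` is a submersion, it has local sections; listing each of them together with its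
conjugate by the real structures gives a compatible family on a real covering. As the action is
free, two points `z`, `w` of one fibre have a quotient `z / w` in `𝒢`, and the transition functions
are the quotients of the local sections. The point is that they are holomorphic
(`PrincipalBundle.contMDiffAt_div_section`). The orbit map `(t, g) ↦ g · s(t)` of a local section
`s` is holomorphic and injective, so on a fibre it is immersive somewhere
(`Set.InjOn.exists_injective_fderiv`). Because `𝒢` is second countable, countably many charts of the
fibre of `𝒢` cover the fibre of `P`, and a comparison of Hausdorff dimensions
(`finrank_le_of_subset_iUnion_image`) shows that the fibre of `P` is not of larger dimension. So the
orbit map is invertible near some point of each fibre by the inverse function theorem, and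
translation by a local section of `𝒢 → ℂP¹` carries this to all points of the fibre
(`PrincipalBundle.contMDiffAt_div_of_contMDiffAt`).

*The transition cocycles of a bundle form exactly one cohomology class.* Two of them become
cohomologous on the intersections of their coverings, by the quotients of the two families of local
sections (`PrincipalBundle.HasTransitionCocycle.h1RRel`). Conversely, a cocycle cohomologous to a
transition cocycle on a common refinement is a transition cocycle: local sections may be
restricted, multiplied by a cochain, and glued over a coarser covering
(`PrincipalBundle.hasTransitionCocycle_congr`).

*Bundles with a common transition cocycle are isomorphic*
(`PrincipalBundle.HasTransitionCocycle.isomorphic`), by the map `g · s_i ↦ g · t_i`, which is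
holomorphic because division by `s_i` is.

*Every real cocycle `φ` is a transition cocycle*
(`RealCocycle.hasTransitionCocycle_bundle`). The products `U_i ×_{ℂP¹} G` are glued by right
multiplication by `φ_{ij}`. The group acts by left multiplication, and the real structure sends
`g · s_i(x)` to `τ(g) · s_{bar i}(σ(x))`. It is antiholomorphic because this may be tested on the
linear coordinates of charts, where conjugation of power series applies
(`antiHolomorphic_of_forall_coordinate`).
-/

/-! ### Submersions as local projections -/

section SubmersionCharts

variable {E : Type*} [NormedAddCommGroup E] [NormedSpace ℂ E]
  {F : Type*} [NormedAddCommGroup F] [NormedSpace ℂ F]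
  {K : Type*} [NormedAddCommGroup K] [NormedSpace ℂ K]
  {M : Type*} [TopologicalSpace M] [ChartedSpace E M]
  {N : Type*} [TopologicalSpace N] [ChartedSpace F N]

/-- A biholomorphic map `θ` from an open subset of `M` onto an open subset of `N × K` which turns
the map `f : M → N` into the first projection. -/
structure IsSubmersionChart (f : M → N) (θ : OpenPartialHomeomorph M (N × K)) : Prop where
  contMDiffOn : ContMDiffOn 𝓘(ℂ, E) (𝓘(ℂ, F).prod 𝓘(ℂ, K)) ω θ θ.source
  contMDiffOn_symm : ContMDiffOn (𝓘(ℂ, F).prod 𝓘(ℂ, K)) 𝓘(ℂ, E) ω θ.symm θ.target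
  fst_apply : ∀ x ∈ θ.source, (θ x).1 = f x

namespace IsSubmersionChart

variable {f : M → N} {θ : OpenPartialHomeomorph M (N × K)}

theorem contMDiffAt (h : IsSubmersionChart (E := E) (F := F) f θ) {x : M} (hx : x ∈ θ.source) :
    ContMDiffAt 𝓘(ℂ, E) (𝓘(ℂ, F).prod 𝓘(ℂ, K)) ω θ x :=
  h.contMDiffOn.contMDiffAt (θ.open_source.mem_nhds hx)

theorem contMDiffAt_symm (h : IsSubmersionChart (E := E) (F := F) f θ) {y : N × K}
    (hy : y ∈ θ.target) : ContMDiffAt (𝓘(ℂ, F).prod 𝓘(ℂ, K)) 𝓘(ℂ, E) ω θ.symm y :=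
  h.contMDiffOn_symm.contMDiffAt (θ.open_target.mem_nhds hy)

theorem apply_symm (h : IsSubmersionChart (E := E) (F := F) f θ) {y : N × K}
    (hy : y ∈ θ.target) : f (θ.symm y) = y.1 := by
  rw [← h.fst_apply _ (θ.map_target hy), θ.right_inv hy]

theorem apply_eq (h : IsSubmersionChart (E := E) (F := F) f θ) {x : M} (hx : x ∈ θ.source) :
    θ x = (f x, (θ x).2) :=
  Prod.ext (h.fst_apply x hx) rfl

/-- A submersion has holomorphic local sections through every point. -/
theorem exists_section (h : IsSubmersionChart (E := E) (F := F) f θ) {x : M} (hx : x ∈ θ.source) :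
    ∃ (V : Set N) (s : N → M), IsOpen V ∧ f x ∈ V ∧ ContMDiffOn 𝓘(ℂ, F) 𝓘(ℂ, E) ω s V ∧
      (∀ y ∈ V, f (s y) = y) ∧ s (f x) = x := by
  have hc : Continuous fun y : N => (y, (θ x).2) := by fun_prop
  refine ⟨(fun y => (y, (θ x).2)) ⁻¹' θ.target, fun y => θ.symm (y, (θ x).2),
    θ.open_target.preimage hc, ?_, ?_, fun y hy => h.apply_symm hy, ?_⟩
  · rw [Set.mem_preimage, ← h.apply_eq hx]
    exact θ.map_source hx
  · exact h.contMDiffOn_symm.comp (contMDiff_id.prodMk contMDiff_const).contMDiffOn fun y hy => hy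
  · change θ.symm (f x, (θ x).2) = x
    rw [← h.apply_eq hx, θ.left_inv hx]

/-- A submersion chart is a submersion in the sense of charts. -/
theorem isSubmersionAtOfComplement [IsManifold 𝓘(ℂ, E) ω M] [IsManifold 𝓘(ℂ, F) ω N]
    (h : IsSubmersionChart (E := E) (F := F) f θ) {x : M} (hx : x ∈ θ.source)
    (e : E ≃L[ℂ] F × K) :
    Manifold.IsSubmersionAtOfComplement K 𝓘(ℂ, E) 𝓘(ℂ, F) ω f x := by
  have hfc : ContinuousAt f x := by
    have h1 : ContinuousAt (fun y => (θ y).1) x := (θ.continuousAt hx).fst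
    refine h1.congr ?_
    filter_upwards [θ.open_source.mem_nhds hx] with y hy using h.fst_apply y hy
  set c := chartAt F (f x) with hc
  set d : OpenPartialHomeomorph M E :=
    (θ.trans (c.prod (OpenPartialHomeomorph.refl K))).trans
      e.symm.toHomeomorph.toOpenPartialHomeomorph with hd
  have hds : d.source = θ.source ∩ {y | (θ y).1 ∈ c.source} := by
    ext y; simp [hd]
  have hdt : d.target = {v | e v ∈ c.target ×ˢ Set.univ ∧ (c.symm (e v).1, (e v).2) ∈ θ.target} := by
    ext y; simp [hd]
  have hcm : c ∈ IsManifold.maximalAtlas 𝓘(ℂ, F) ω N := IsManifold.chart_mem_maximalAtlas _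
  have hdm : d ∈ IsManifold.maximalAtlas 𝓘(ℂ, E) ω M := by
    apply OpenPartialHomeomorph.mem_maximalAtlas_of_contMDiffOn
    · intro y hy
      rw [hds] at hy
      refine ContMDiffAt.contMDiffWithinAt ?_
      have h1 := h.contMDiffAt hy.1
      have h2 : ContMDiffAt 𝓘(ℂ, E) 𝓘(ℂ, F) ω (fun z => c (θ z).1) y :=
        (contMDiffAt_of_mem_maximalAtlas hcm hy.2).comp y h1.fst
      have h3 : ContMDiffAt 𝓘(ℂ, E) 𝓘(ℂ, F × K) ω (fun z => (c (θ z).1, (θ z).2)) y :=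
        h2.prodMk_space h1.snd
      exact e.symm.contDiff.contMDiff.contMDiffAt.comp y h3
    · intro v hv
      rw [hdt] at hv
      refine ContMDiffAt.contMDiffWithinAt ?_
      have h0 : ContMDiffAt 𝓘(ℂ, E) 𝓘(ℂ, F × K) ω e v := e.contDiff.contMDiff.contMDiffAt
      have h1 : ContMDiffAt 𝓘(ℂ, E) 𝓘(ℂ, F) ω (fun v => c.symm (e v).1) v :=
        (contMDiffAt_symm_of_mem_maximalAtlas hcm hv.1.1).comp v
          (contDiff_fst.contMDiff.contMDiffAt.comp v h0)
      have h2 : ContMDiffAt 𝓘(ℂ, E) 𝓘(ℂ, K) ω (fun v => (e v).2) v :=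
        contDiff_snd.contMDiff.contMDiffAt.comp v h0
      exact ContMDiffAt.comp (f := fun v => (c.symm (e v).1, (e v).2)) v (h.contMDiffAt_symm hv.2)
        (h1.prodMk h2)
  refine Manifold.IsSubmersionAtOfComplement.mk_of_continuousAt hfc e d c ?_
    (mem_chart_source F (f x)) hdm hcm ?_
  · rw [hds]
    exact ⟨hx, by
      change (θ x).1 ∈ c.source
      rw [h.fst_apply x hx]; exact mem_chart_source F (f x)⟩
  · intro v hv
    have hv' : v ∈ d.target := by simpa using hv
    rw [hdt] at hv'
    have h1 : d.symm v = θ.symm (c.symm (e v).1, (e v).2) := by simp [hd]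
    simp only [OpenPartialHomeomorph.extend, Function.comp_apply]
    change c (f (d.symm v)) = (e v).1
    rw [h1, h.apply_symm hv'.2]
    exact c.right_inv hv'.1.1

end IsSubmersionChart

/-- A submersion is, near each point, the projection of a product. -/
theorem Manifold.IsSubmersionAtOfComplement.exists_isSubmersionChart {f : M → N} {x : M}
    (h : Manifold.IsSubmersionAtOfComplement K 𝓘(ℂ, E) 𝓘(ℂ, F) ω f x) :
    ∃ θ : OpenPartialHomeomorph M (N × K), IsSubmersionChart (E := E) (F := F) f θ ∧
      x ∈ θ.source := by
  obtain ⟨d, c, hxd, hfc, hdm, hcm, hsub, e, heq⟩ := h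
  have heq' : ∀ v ∈ d.target, c (f (d.symm v)) = (e v).1 := fun v hv =>
    heq (show v ∈ (d.extend 𝓘(ℂ, E)).target by simpa using hv)
  have heq'' : ∀ y ∈ d.source, c (f y) = (e (d y)).1 := fun y hy => by
    rw [← heq' _ (d.map_source hy), d.left_inv hy]
  set θ : OpenPartialHomeomorph M (N × K) :=
    (d.trans e.toHomeomorph.toOpenPartialHomeomorph).trans
      (c.symm.prod (OpenPartialHomeomorph.refl K)) with hθ
  have hs : θ.source = d.source := by
    ext y
    simp only [hθ, OpenPartialHomeomorph.trans_source]
    constructor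
    · rintro ⟨⟨h1, -⟩, -⟩; exact h1
    · intro hy
      refine ⟨⟨hy, trivial⟩, ?_, trivial⟩
      change (e (d y)).1 ∈ c.target
      rw [← heq'' y hy]; exact c.map_source (hsub hy)
  have ht : ∀ q ∈ θ.target, q.1 ∈ c.source ∧ e.symm (c q.1, q.2) ∈ d.target := by
    intro q hq
    simpa [hθ] using hq
  have happ : ∀ y, θ y = (c.symm (e (d y)).1, (e (d y)).2) := fun y => rfl
  refine ⟨θ, ⟨?_, ?_, ?_⟩, by rw [hs]; exact hxd⟩
  · intro y hy
    rw [hs] at hy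
    refine ContMDiffAt.contMDiffWithinAt ?_
    have h0 : ContMDiffAt 𝓘(ℂ, E) 𝓘(ℂ, F × K) ω (fun z => e (d z)) y :=
      e.contDiff.contMDiff.contMDiffAt.comp y (contMDiffAt_of_mem_maximalAtlas hdm hy)
    have hmem : (e (d y)).1 ∈ c.target := by
      rw [← heq'' y hy]; exact c.map_source (hsub hy)
    exact ((contMDiffAt_symm_of_mem_maximalAtlas hcm hmem).comp y
      (contDiff_fst.contMDiff.contMDiffAt.comp y h0)).prodMk
      (contDiff_snd.contMDiff.contMDiffAt.comp y h0)
  · intro q hq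
    obtain ⟨h1, h2⟩ := ht q hq
    refine ContMDiffAt.contMDiffWithinAt ?_
    have h3 : ContMDiffAt (𝓘(ℂ, F).prod 𝓘(ℂ, K)) 𝓘(ℂ, F) ω (fun q : N × K => c q.1) q :=
      (contMDiffAt_of_mem_maximalAtlas hcm h1).comp q contMDiffAt_fst
    have h4 : ContMDiffAt (𝓘(ℂ, F).prod 𝓘(ℂ, K)) 𝓘(ℂ, F × K) ω
        (fun q : N × K => (c q.1, q.2)) q := h3.prodMk_space contMDiffAt_snd
    exact ContMDiffAt.comp (f := fun q : N × K => e.symm (c q.1, q.2)) q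
      (contMDiffAt_symm_of_mem_maximalAtlas hdm h2)
      (e.symm.contDiff.contMDiff.contMDiffAt.comp q h4)
  · intro y hy
    rw [hs] at hy
    rw [happ, ← heq'' y hy]
    exact c.left_inv (hsub hy)

/-- A submersion has a holomorphic local section through every point of its domain. -/
theorem Manifold.IsSubmersion.exists_section {f : M → N}
    (h : Manifold.IsSubmersion 𝓘(ℂ, E) 𝓘(ℂ, F) ω f) (x : M) :
    ∃ (V : Set N) (s : N → M), IsOpen V ∧ f x ∈ V ∧ ContMDiffOn 𝓘(ℂ, F) 𝓘(ℂ, E) ω s V ∧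
      (∀ y ∈ V, f (s y) = y) ∧ s (f x) = x := by
  obtain ⟨K, _, _, hK⟩ := h
  obtain ⟨θ, hθ, hx⟩ := (hK x).exists_isSubmersionChart
  exact hθ.exists_section hx

end SubmersionCharts

/-! ### Injective holomorphic maps and dimension -/

section Analysis

variable {K : Type*} [NormedAddCommGroup K] [NormedSpace ℂ K] [FiniteDimensional ℂ K]
  {K' : Type*} [NormedAddCommGroup K'] [NormedSpace ℂ K'] [FiniteDimensional ℂ K']

/-- An injective `C¹` map on a nonempty open set is immersive at some point, namely at each point
where the rank of the differential is maximal: near such a point the rank is constant, and by the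
constant rank theorem the map would collapse the directions of the kernel of its differential. -/
theorem Set.InjOn.exists_injective_fderiv {f : K → K'} {V : Set K} (hV : IsOpen V)
    (hne : V.Nonempty) (hf : ContDiffOn ℂ 1 f V) (hinj : Set.InjOn f V) :
    ∃ v ∈ V, Function.Injective (fderiv ℂ f v) := by
  let rk : K → ℕ := fun v => Module.finrank ℂ (LinearMap.range (fderiv ℂ f v).toLinearMap)
  obtain ⟨a, haV, hmax⟩ : ∃ a ∈ V, ∀ w ∈ V, rk w ≤ rk a := by
    have hb : BddAbove (rk '' V) :=
      ⟨Module.finrank ℂ K', by rintro _ ⟨v, -, rfl⟩; exact Submodule.finrank_le _⟩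
    obtain ⟨a, ha, hae⟩ := Nat.sSup_mem (hne.image rk) hb
    exact ⟨a, ha, fun w hw => hae ▸ le_csSup hb ⟨w, hw, rfl⟩⟩
  refine ⟨a, haV, ?_⟩
  have hfa : ∀ w ∈ V, ContDiffAt ℂ 1 f w := fun w hw => hf.contDiffAt (hV.mem_nhds hw)
  set A := fderiv ℂ f a with hA
  let R := LinearMap.range A.toLinearMap
  let N := LinearMap.ker A.toLinearMap
  obtain ⟨q, hq⟩ : R.ClosedComplemented := Submodule.ClosedComplemented.of_finiteDimensional R
  obtain ⟨p, hp⟩ : N.ClosedComplemented := Submodule.ClosedComplemented.of_finiteDimensional N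
  -- In the coordinates `Ψ`, the `R`-component of `f` is the first projection.
  let Ψ : K → R × N := fun x => (q (f x), p x)
  let D : K →L[ℂ] R × N := (q.comp A).prod p
  have hDinj : Function.Injective D := by
    rw [injective_iff_map_eq_zero]
    intro x hx
    have h1 : q (A x) = 0 := congrArg Prod.fst hx
    have h2 : p x = 0 := congrArg Prod.snd hx
    have h3 : A x = 0 := by
      have := hq ⟨A x, x, rfl⟩
      rw [h1] at this
      exact (congrArg Subtype.val this).symm
    have h4 := hp ⟨x, h3⟩
    rw [h2] at h4
    exact (congrArg Subtype.val h4).symm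
  have hDsurj : Function.Surjective D := by
    rintro ⟨⟨_, x, rfl⟩, n⟩
    refine ⟨x - p x + n, Prod.ext ?_ ?_⟩
    · change q (A (x - p x + n)) = _
      have h1 : A (p x : K) = 0 := (p x).2
      have h2 : A (n : K) = 0 := n.2
      rw [map_add, map_sub, h1, h2, sub_zero, add_zero]
      exact hq ⟨A x, x, rfl⟩
    · change p (x - p x + n) = n
      rw [map_add, map_sub, hp, hp, sub_self, zero_add]
  let D' : K ≃L[ℂ] R × N :=
    (LinearEquiv.ofBijective D.toLinearMap ⟨hDinj, hDsurj⟩).toContinuousLinearEquiv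
  have hΨa : ContDiffAt ℂ 1 Ψ a :=
    (q.contDiff.contDiffAt.comp a (hfa a haV)).prodMk p.contDiff.contDiffAt
  have hΨ' : HasFDerivAt Ψ (D' : K →L[ℂ] R × N) a := by
    have h1 : HasFDerivAt f A a := ((hfa a haV).differentiableAt one_ne_zero).hasFDerivAt
    exact (q.hasFDerivAt.comp a h1).prodMk p.hasFDerivAt
  let Φ := hΨa.toOpenPartialHomeomorph Ψ hΨ' one_ne_zero
  have hΦ : ∀ x, Φ x = Ψ x := fun x => rfl
  have haΦ : a ∈ Φ.source := hΨa.mem_toOpenPartialHomeomorph_source hΨ' one_ne_zero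
  have hgΨ : ContDiffAt ℂ 1 Φ.symm (Ψ a) := hΨa.to_localInverse hΨ' one_ne_zero
  have hga : Φ.symm (Ψ a) = a := Φ.left_inv haΦ
  have hev : ∀ᶠ z in 𝓝 (Ψ a), ContDiffAt ℂ 1 Φ.symm z ∧ Φ.symm z ∈ V ∧ z ∈ Φ.target := by
    refine (hgΨ.eventually (by simp)).and (Filter.Eventually.and ?_ ?_)
    · refine hgΨ.continuousAt ?_
      rw [hga]; exact hV.mem_nhds haV
    · exact Φ.open_target.mem_nhds (Φ.map_source haΦ)
  obtain ⟨ε, hε, hball⟩ := Metric.eventually_nhds_iff_ball.1 hev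
  obtain ⟨r₀, n₀, hra⟩ : ∃ r₀ n₀, Ψ a = (r₀, n₀) := ⟨_, _, rfl⟩
  have hmem : ∀ n ∈ Metric.ball n₀ ε, (r₀, n) ∈ Metric.ball (Ψ a) ε := by
    intro n hn
    rw [hra, Metric.mem_ball, Prod.dist_eq, dist_self]
    exact max_lt hε hn
  -- `f` is constant along the fibres of the first projection.
  have hder : ∀ n ∈ Metric.ball n₀ ε,
      HasFDerivAt (fun n => f (Φ.symm (r₀, n))) (0 : N →L[ℂ] K') n := by
    intro n hn
    obtain ⟨h1, h2, h3⟩ := hball _ (hmem n hn)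
    have hg := (h1.differentiableAt one_ne_zero).hasFDerivAt
    have hfw := ((hfa _ h2).differentiableAt one_ne_zero).hasFDerivAt
    set B := fderiv ℂ f (Φ.symm (r₀, n)) with hB
    set Dg := fderiv ℂ Φ.symm (r₀, n)
    have hcomp : HasFDerivAt (fun z => f (Φ.symm z)) (B.comp Dg) (r₀, n) := hfw.comp _ hg
    have hqz : ∀ z, q (B (Dg z)) = z.1 := by
      have e1 : HasFDerivAt (fun z => q (f (Φ.symm z))) (q.comp (B.comp Dg)) (r₀, n) :=
        q.hasFDerivAt.comp _ hcomp
      have e2 : HasFDerivAt (fun z => q (f (Φ.symm z))) (ContinuousLinearMap.fst ℂ R N)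
          (r₀, n) := by
        refine hasFDerivAt_fst.congr_of_eventuallyEq ?_
        filter_upwards [Φ.open_target.mem_nhds h3] with z hz
        exact congrArg Prod.fst (Φ.right_inv hz)
      intro z
      exact congrArg (fun L : R × N →L[ℂ] R => L z) (e1.unique e2)
    let q' : LinearMap.range B.toLinearMap →ₗ[ℂ] R :=
      q.toLinearMap.domRestrict (LinearMap.range B.toLinearMap)
    have hq's : Function.Surjective q' := fun r =>
      ⟨⟨B (Dg (r, 0)), Dg (r, 0), rfl⟩, hqz (r, 0)⟩
    have hfin : Module.finrank ℂ (LinearMap.range B.toLinearMap) = Module.finrank ℂ R :=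
      le_antisymm (hmax _ h2) (LinearMap.finrank_le_finrank_of_surjective hq's)
    have hq'i : Function.Injective q' :=
      (LinearMap.injective_iff_surjective_of_finrank_eq_finrank hfin).2 hq's
    have hzero : (B.comp Dg).comp (ContinuousLinearMap.inr ℂ R N) = 0 := by
      ext n'
      have e1 : q' ⟨B (Dg (0, n')), Dg (0, n'), rfl⟩ = q' 0 := by
        rw [map_zero]; exact hqz (0, n')
      exact congrArg Subtype.val (hq'i e1)
    have hin : HasFDerivAt (fun n : N => (r₀, n)) (ContinuousLinearMap.inr ℂ R N) n :=
      hasFDerivAt_prodMk_right r₀ n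
    have := hcomp.comp n hin
    rwa [hzero] at this
  have hconst : ∀ n ∈ Metric.ball n₀ ε, n = n₀ := by
    intro n hn
    have hn₀ : n₀ ∈ Metric.ball n₀ ε := Metric.mem_ball_self hε
    have e1 : f (Φ.symm (r₀, n)) = f (Φ.symm (r₀, n₀)) := by
      refine Metric.isOpen_ball.is_const_of_fderiv_eq_zero (𝕜 := ℂ)
        (f := fun n => f (Φ.symm (r₀, n)))
        (convex_ball n₀ ε).isPreconnected ?_ ?_ hn hn₀
      · exact fun m hm => (hder m hm).differentiableAt.differentiableWithinAt
      · exact fun m hm => (hder m hm).fderiv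
    have e2 := hinj (hball _ (hmem n hn)).2.1 (hball _ (hmem n₀ hn₀)).2.1 e1
    have e3 := Φ.symm.injOn (hball _ (hmem n hn)).2.2 (hball _ (hmem n₀ hn₀)).2.2 e2
    exact congrArg Prod.snd e3
  rw [injective_iff_map_eq_zero]
  by_contra! hcon
  obtain ⟨x, hx, hx0⟩ := hcon
  let m : N := ⟨x, hx⟩
  have hm : m ≠ 0 := fun h => hx0 (congrArg Subtype.val h)
  have hmn : 0 < ‖m‖ := norm_pos_iff.2 hm
  let c : ℂ := ((ε / (2 * ‖m‖) : ℝ) : ℂ)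
  have hc : 0 < ε / (2 * ‖m‖) := by positivity
  have hmb : n₀ + c • m ∈ Metric.ball n₀ ε := by
    rw [Metric.mem_ball, dist_self_add_left, norm_smul, Complex.norm_real, Real.norm_of_nonneg hc.le]
    have : ε / (2 * ‖m‖) * ‖m‖ = ε / 2 := by field_simp
    linarith
  have := hconst _ hmb
  rw [add_eq_left, smul_eq_zero] at this
  rcases this with h | h
  · exact hc.ne' (Complex.ofReal_eq_zero.1 h)
  · exact hm h

/-- If countably many `C¹` images of open subsets of `K` cover a nonempty open subset of `K'`, then
`dim K' ≤ dim K`, because locally Lipschitz maps do not raise the Hausdorff dimension. -/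
theorem finrank_le_of_subset_iUnion_image {ι : Type*} [Countable ι] {O : Set K'}
    (hO : IsOpen O) (hne : O.Nonempty) {V : ι → Set K} (hV : ∀ i, IsOpen (V i)) {f : ι → K → K'}
    (hf : ∀ i, ContDiffOn ℂ 1 (f i) (V i)) (hcov : O ⊆ ⋃ i, f i '' V i) :
    Module.finrank ℂ K' ≤ Module.finrank ℂ K := by
  have : ProperSpace K := FiniteDimensional.proper ℂ K
  have h1 : dimH O = Module.finrank ℝ K' :=
    Real.dimH_of_nonempty_interior (by rwa [hO.interior_eq])
  have h2 : dimH (⋃ i, f i '' V i) ≤ Module.finrank ℝ K := by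
    rw [dimH_iUnion]
    refine iSup_le fun i => ?_
    calc dimH (f i '' V i) ≤ dimH (V i) := by
          refine dimH_image_le_of_locally_lipschitzOn fun x hx => ?_
          obtain ⟨C, t, ht, hl⟩ :=
            ((hf i).contDiffAt ((hV i).mem_nhds hx)).restrict_scalars ℝ |>.exists_lipschitzOnWith
          exact ⟨C, t, mem_nhdsWithin_of_mem_nhds ht, hl⟩
      _ ≤ dimH (Set.univ : Set K) := dimH_mono (Set.subset_univ _)
      _ = Module.finrank ℝ K := Real.dimH_univ_eq_finrank K
  have h3 : (Module.finrank ℝ K' : ENNReal) ≤ Module.finrank ℝ K :=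
    h1 ▸ (dimH_mono hcov).trans h2
  rw [finrank_real_of_complex, finrank_real_of_complex] at h3
  have h4 : 2 * Module.finrank ℂ K' ≤ 2 * Module.finrank ℂ K := by exact_mod_cast h3
  omega

/-- A holomorphic map over a base `F`, whose restriction to one fibre is immersive at a point, is
locally invertible at this point as soon as the fibre dimensions allow it. -/
theorem exists_localInverse_of_injective_fderiv_snd {F : Type*} [NormedAddCommGroup F]
    [NormedSpace ℂ F] [FiniteDimensional ℂ F] {m : F × K → F × K'} {y : F} {v : K}
    (hm : ContDiffAt ℂ ω m (y, v)) (hfst : ∀ᶠ z in 𝓝 (y, v), (m z).1 = z.1)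
    (hinj : Function.Injective (fderiv ℂ (fun v' => (m (y, v')).2) v))
    (hdim : Module.finrank ℂ K' ≤ Module.finrank ℂ K) :
    ∃ g : F × K' → F × K, ContDiffAt ℂ ω g (m (y, v)) ∧ g (m (y, v)) = (y, v) ∧
      ∀ᶠ z in 𝓝 (m (y, v)), m (g z) = z := by
  have hω : (ω : WithTop ℕ∞) ≠ 0 := by simp
  have hd := (hm.differentiableAt hω).hasFDerivAt
  set D := fderiv ℂ m (y, v) with hD
  have hD1 : ∀ z, (D z).1 = z.1 := by
    have e1 : HasFDerivAt (fun z => (m z).1) ((ContinuousLinearMap.fst ℂ F K').comp D) (y, v) :=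
      hasFDerivAt_fst.comp _ hd
    have e2 : HasFDerivAt (fun z => (m z).1) (ContinuousLinearMap.fst ℂ F K) (y, v) :=
      hasFDerivAt_fst.congr_of_eventuallyEq hfst
    intro z
    exact congrArg (fun L : F × K →L[ℂ] F => L z) (e1.unique e2)
  have hD2 : ∀ v', (D (0, v')).2 = fderiv ℂ (fun v' => (m (y, v')).2) v v' := by
    have e1 : HasFDerivAt (fun v' => (m (y, v')).2)
        (((ContinuousLinearMap.snd ℂ F K').comp D).comp (ContinuousLinearMap.inr ℂ F K)) v :=
      HasFDerivAt.comp (g := fun z => (m z).2) v (hasFDerivAt_snd.comp _ hd)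
        (hasFDerivAt_prodMk_right y v)
    intro v'
    rw [e1.fderiv]; rfl
  have hDinj : Function.Injective D := by
    rw [injective_iff_map_eq_zero]
    rintro ⟨y', v'⟩ hz
    have h1 : y' = 0 := (hD1 (y', v')).symm.trans (congrArg Prod.fst hz)
    subst h1
    have h2 : fderiv ℂ (fun v' => (m (y, v')).2) v v' = 0 := by rw [← hD2, hz]; rfl
    rw [hinj (h2.trans (map_zero _).symm)]; rfl
  have hfin : Module.finrank ℂ (F × K) = Module.finrank ℂ (F × K') :=
    le_antisymm (LinearMap.finrank_le_finrank_of_injective (f := D.toLinearMap) hDinj)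
      (by rw [Module.finrank_prod, Module.finrank_prod]; omega)
  have hDsurj : Function.Surjective D :=
    (LinearMap.injective_iff_surjective_of_finrank_eq_finrank (f := D.toLinearMap) hfin).1 hDinj
  let D' : (F × K) ≃L[ℂ] F × K' :=
    (LinearEquiv.ofBijective D.toLinearMap ⟨hDinj, hDsurj⟩).toContinuousLinearEquiv
  have hd' : HasFDerivAt m (D' : F × K →L[ℂ] F × K') (y, v) := hd
  refine ⟨hm.localInverse hd' hω, hm.to_localInverse hd' hω, hm.localInverse_apply_image hd' hω, ?_⟩
  let Φ := hm.toOpenPartialHomeomorph m hd' hω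
  filter_upwards [Φ.open_target.mem_nhds (hm.image_mem_toOpenPartialHomeomorph_target hd' hω)]
    with z hz
  exact Φ.right_inv hz

end Analysis

/-! ### Calculus with twistor groups and their actions -/

section Actions

variable {E : Type*} [NormedAddCommGroup E] [NormedSpace ℂ E]
  {F : Type*} [NormedAddCommGroup F] [NormedSpace ℂ F]
  {G : Type*} [TopologicalSpace G] [ChartedSpace E G]
  {Z : Type*} [TopologicalSpace Z] [ChartedSpace F Z]
  {E' : Type*} [NormedAddCommGroup E'] [NormedSpace ℂ E']
  {H' : Type*} [TopologicalSpace H'] {I : ModelWithCorners ℂ E' H'}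
  {N : Type*} [TopologicalSpace N] [ChartedSpace H' N]

namespace RealSpace

variable (𝒵 : RealSpace F Z)

theorem contMDiff_proj : ContMDiff 𝓘(ℂ, F) 𝓘(ℂ, ℂ) ω 𝒵.proj :=
  𝒵.proj_submersion.contMDiff

theorem continuous_real : Continuous 𝒵.real := 𝒵.real_antiholomorphic.1

end RealSpace

namespace TwistorGroup

variable (𝒢 : TwistorGroup E G)

theorem contMDiffWithinAt_mul {f g : N → G} {s : Set N} {x : N}
    (hf : ContMDiffWithinAt I 𝓘(ℂ, E) ω f s x) (hg : ContMDiffWithinAt I 𝓘(ℂ, E) ω g s x)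
    (h : ∀ y ∈ s, 𝒢.proj (f y) = 𝒢.proj (g y)) (hx : 𝒢.proj (f x) = 𝒢.proj (g x)) :
    ContMDiffWithinAt I 𝓘(ℂ, E) ω (fun y => 𝒢.mul (f y) (g y)) s x :=
  ContMDiffWithinAt.comp (f := fun y => (f y, g y)) (g := fun q : G × G => 𝒢.mul q.1 q.2) x
    (𝒢.mul_holomorphic (f x, g x) hx) (hf.prodMk hg) h

theorem contMDiffAt_mul {f g : N → G} {x : N}
    (hf : ContMDiffAt I 𝓘(ℂ, E) ω f x) (hg : ContMDiffAt I 𝓘(ℂ, E) ω g x)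
    (h : ∀ᶠ y in 𝓝 x, 𝒢.proj (f y) = 𝒢.proj (g y)) :
    ContMDiffAt I 𝓘(ℂ, E) ω (fun y => 𝒢.mul (f y) (g y)) x :=
  (𝒢.contMDiffWithinAt_mul hf.contMDiffWithinAt hg.contMDiffWithinAt
    (s := {y | 𝒢.proj (f y) = 𝒢.proj (g y)}) (fun _ hy => hy) h.self_of_nhds).contMDiffAt h

theorem inv_mul_cancel_left {g h : G} (hgh : 𝒢.proj g = 𝒢.proj h) :
    𝒢.mul (𝒢.inv g) (𝒢.mul g h) = h := by
  rw [← 𝒢.mul_assoc _ _ _ (𝒢.proj_inv g) hgh, 𝒢.inv_mul, hgh, 𝒢.one_mul]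

theorem mul_inv_cancel_left {g h : G} (hgh : 𝒢.proj g = 𝒢.proj h) :
    𝒢.mul g (𝒢.mul (𝒢.inv g) h) = h := by
  rw [← 𝒢.mul_assoc _ _ _ (𝒢.proj_inv g).symm ((𝒢.proj_inv g).trans hgh), 𝒢.mul_inv, hgh,
    𝒢.one_mul]

theorem mul_inv_cancel_right {g h : G} (hgh : 𝒢.proj g = 𝒢.proj h) :
    𝒢.mul (𝒢.mul g h) (𝒢.inv h) = g := by
  rw [𝒢.mul_assoc _ _ _ hgh (𝒢.proj_inv h).symm, 𝒢.mul_inv, ← hgh, 𝒢.mul_one]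

theorem inv_mul_cancel_right {g h : G} (hgh : 𝒢.proj g = 𝒢.proj h) :
    𝒢.mul (𝒢.mul g (𝒢.inv h)) h = g := by
  rw [𝒢.mul_assoc _ _ _ (hgh.trans (𝒢.proj_inv h).symm) (𝒢.proj_inv h), 𝒢.inv_mul, ← hgh,
    𝒢.mul_one]

theorem eq_one_of_mul_eq_self {g h : G} (hgh : 𝒢.proj g = 𝒢.proj h) (h1 : 𝒢.mul g h = h) :
    g = 𝒢.one (𝒢.proj h) := by
  rw [← 𝒢.mul_inv_cancel_right hgh, h1, 𝒢.mul_inv]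

end TwistorGroup

namespace TwistorAction

variable {𝒢 : TwistorGroup E G} {𝒵 : RealSpace F Z} (a : TwistorAction 𝒢 𝒵)

theorem contMDiffWithinAt_act {f : N → G} {g : N → Z} {s : Set N} {x : N}
    (hf : ContMDiffWithinAt I 𝓘(ℂ, E) ω f s x) (hg : ContMDiffWithinAt I 𝓘(ℂ, F) ω g s x)
    (h : ∀ y ∈ s, 𝒢.proj (f y) = 𝒵.proj (g y)) (hx : 𝒢.proj (f x) = 𝒵.proj (g x)) :
    ContMDiffWithinAt I 𝓘(ℂ, F) ω (fun y => a.act (f y) (g y)) s x :=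
  ContMDiffWithinAt.comp (f := fun y => (f y, g y)) (g := fun q : G × Z => a.act q.1 q.2) x
    (a.act_holomorphic (f x, g x) hx) (hf.prodMk hg) h

theorem contMDiffAt_act {f : N → G} {g : N → Z} {x : N}
    (hf : ContMDiffAt I 𝓘(ℂ, E) ω f x) (hg : ContMDiffAt I 𝓘(ℂ, F) ω g x)
    (h : ∀ᶠ y in 𝓝 x, 𝒢.proj (f y) = 𝒵.proj (g y)) :
    ContMDiffAt I 𝓘(ℂ, F) ω (fun y => a.act (f y) (g y)) x :=
  (a.contMDiffWithinAt_act hf.contMDiffWithinAt hg.contMDiffWithinAt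
    (s := {y | 𝒢.proj (f y) = 𝒵.proj (g y)}) (fun _ hy => hy) h.self_of_nhds).contMDiffAt h

theorem act_inv_act {g : G} {z : Z} (h : 𝒢.proj g = 𝒵.proj z) :
    a.act g (a.act (𝒢.inv g) z) = z := by
  rw [← a.mul_act _ _ _ h ((𝒢.proj_inv g).trans h), 𝒢.mul_inv, h, a.one_act]

theorem inv_act_act {g : G} {z : Z} (h : 𝒢.proj g = 𝒵.proj z) :
    a.act (𝒢.inv g) (a.act g z) = z := by
  rw [← a.mul_act _ _ _ ((𝒢.proj_inv g).trans h) h, 𝒢.inv_mul, h, a.one_act]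

variable {a} in
theorem IsFree.eq_of_act_eq (ha : a.IsFree) {g h : G} {z : Z} (hg : 𝒢.proj g = 𝒵.proj z)
    (hh : 𝒢.proj h = 𝒵.proj z) (e : a.act g z = a.act h z) : g = h := by
  have h1 : a.act (𝒢.mul (𝒢.inv h) g) z = z := by
    rw [a.mul_act _ _ _ ((𝒢.proj_inv h).trans hh) hg, e, a.inv_act_act hh]
  have hp : 𝒢.proj (𝒢.inv h) = 𝒢.proj g := (𝒢.proj_inv h).trans (hh.trans hg.symm)
  have h2 := ha _ _ ((𝒢.proj_mul _ _ hp).trans ((𝒢.proj_inv h).trans hh)) h1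
  rw [← 𝒢.mul_inv_cancel_left (hh.trans hg.symm), h2, ← hh, 𝒢.mul_one]

end TwistorAction

end Actions

/-! ### Division in a principal bundle -/

section Division

variable {E : Type v} [NormedAddCommGroup E] [NormedSpace ℂ E]
  {G : Type u} [TopologicalSpace G] [ChartedSpace E G]
  {F : Type w} [NormedAddCommGroup F] [NormedSpace ℂ F]
  {T : Type u} [TopologicalSpace T] [ChartedSpace F T]
  {𝒢 : TwistorGroup E G} {𝒯 : RealSpace F T}

namespace PrincipalBundle

variable (P : PrincipalBundle 𝒢 𝒯)

theorem contMDiff_π : ContMDiff 𝓘(ℂ, EuclideanSpace ℂ (Fin P.dim)) 𝓘(ℂ, F) ω P.π :=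
  P.regular.submersion.contMDiff

theorem proj_eq (z : P.carrier) : P.space.proj z = 𝒯.proj (P.π z) := (P.regular.proj_eq z).symm

theorem π_act {g : G} {z : P.carrier} (h : 𝒢.proj g = P.space.proj z) :
    P.π (P.action.act g z) = P.π z :=
  ((P.regular.eq_iff _ _).2 ⟨g, h, rfl⟩).symm

theorem exists_act_eq {z w : P.carrier} (h : P.π z = P.π w) :
    ∃ g, 𝒢.proj g = P.space.proj w ∧ P.action.act g w = z :=
  (P.regular.eq_iff _ _).1 h.symm

open Classical in
/-- The quotient `z / w` of two points of one fibre of `P → T`: the element `g` of the structure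
group with `z = g · w`. It is the unit if the points lie in different fibres. -/
noncomputable def div (z w : P.carrier) : G :=
  if h : P.π z = P.π w then (P.exists_act_eq h).choose else 𝒢.one (P.space.proj w)

variable {P}

theorem proj_div {z w : P.carrier} (h : P.π z = P.π w) :
    𝒢.proj (P.div z w) = P.space.proj w := by
  rw [div, dif_pos h]; exact (P.exists_act_eq h).choose_spec.1

theorem div_act {z w : P.carrier} (h : P.π z = P.π w) : P.action.act (P.div z w) w = z := by
  rw [div, dif_pos h]; exact (P.exists_act_eq h).choose_spec.2

theorem div_eq {z w : P.carrier} {g : G} (hg : 𝒢.proj g = P.space.proj w)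
    (h : P.action.act g w = z) : P.div z w = g := by
  have hπ : P.π z = P.π w := by rw [← h, P.π_act hg]
  exact P.free.eq_of_act_eq (proj_div hπ) hg ((div_act hπ).trans h.symm)

theorem div_mul_div {x y z : P.carrier} (h : P.π x = P.π y) (h' : P.π y = P.π z) :
    𝒢.mul (P.div x y) (P.div y z) = P.div x z := by
  have e1 : 𝒢.proj (P.div x y) = P.space.proj z := by rw [proj_div h, P.proj_eq, h', ← P.proj_eq]
  have e2 := proj_div h'
  refine (div_eq ?_ ?_).symm
  · rw [𝒢.proj_mul _ _ (e1.trans e2.symm), e1]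
  · rw [P.action.mul_act _ _ _ e1 e2, div_act h', div_act h]

theorem div_real {z w : P.carrier} (h : P.π z = P.π w) :
    P.div (P.space.real z) (P.space.real w) = 𝒢.real (P.div z w) := by
  refine div_eq ?_ ?_
  · rw [𝒢.proj_real, P.space.proj_real, proj_div h]
  · rw [← P.action.real_act _ _ (proj_div h), div_act h]

/-- Division by a local section is holomorphic at all points of a fibre if it is so at one of them:
a local section of `G → ℂP¹` gives a local translation which carries one point to the other. -/
theorem contMDiffAt_div_of_contMDiffAt {s : T → P.carrier} {z₀ z₁ : P.carrier}
    (h01 : P.π z₀ = P.π z₁) (hs : ∀ᶠ x in 𝓝 (P.π z₁), P.π (s x) = x)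
    (h : ContMDiffAt 𝓘(ℂ, EuclideanSpace ℂ (Fin P.dim)) 𝓘(ℂ, E) ω
      (fun z => P.div z (s (P.π z))) z₁) :
    ContMDiffAt 𝓘(ℂ, EuclideanSpace ℂ (Fin P.dim)) 𝓘(ℂ, E) ω
      (fun z => P.div z (s (P.π z))) z₀ := by
  obtain ⟨V, η, hV, hxV, hη, hη1, hη2⟩ := 𝒢.proj_submersion.exists_section (P.div z₀ z₁)
  have hp01 : P.space.proj z₀ = P.space.proj z₁ := by rw [P.proj_eq, h01, ← P.proj_eq]
  rw [proj_div h01, ← hp01] at hxV hη2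
  -- `τ` is the translation of the group coordinate, `q` the translated point.
  let τ : P.carrier → G := fun z => η (P.space.proj z)
  let q : P.carrier → P.carrier := fun z => P.action.act (𝒢.inv (τ z)) z
  have hVz : ∀ᶠ z in 𝓝 z₀, P.space.proj z ∈ V :=
    P.space.contMDiff_proj.continuous.continuousAt (hV.mem_nhds hxV)
  have hτp : ∀ᶠ z in 𝓝 z₀, 𝒢.proj (τ z) = P.space.proj z := hVz.mono fun z hz => hη1 _ hz
  have hτ : ContMDiffAt 𝓘(ℂ, EuclideanSpace ℂ (Fin P.dim)) 𝓘(ℂ, E) ω τ z₀ :=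
    (hη.contMDiffAt (hV.mem_nhds hxV)).comp z₀ P.space.contMDiff_proj.contMDiffAt
  have hq : ContMDiffAt 𝓘(ℂ, EuclideanSpace ℂ (Fin P.dim))
      𝓘(ℂ, EuclideanSpace ℂ (Fin P.dim)) ω q z₀ :=
    P.action.contMDiffAt_act (𝒢.inv_holomorphic.contMDiffAt.comp z₀ hτ) contMDiffAt_id
      (hτp.mono fun z hz => (𝒢.proj_inv _).trans hz)
  have hq0 : q z₀ = z₁ := by
    change P.action.act (𝒢.inv (η (P.space.proj z₀))) z₀ = z₁
    have h1 := P.action.inv_act_act (proj_div h01)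
    rw [div_act h01] at h1
    rwa [hη2]
  have hqπ : ∀ᶠ z in 𝓝 z₀, P.π (q z) = P.π z :=
    hτp.mono fun z hz => P.π_act ((𝒢.proj_inv _).trans hz)
  have hsz : ∀ᶠ z in 𝓝 z₀, P.π (s (P.π z)) = P.π z := by
    rw [← h01] at hs
    exact P.contMDiff_π.continuous.continuousAt hs
  have hdq : ContMDiffAt 𝓘(ℂ, EuclideanSpace ℂ (Fin P.dim)) 𝓘(ℂ, E) ω
      (fun z => P.div (q z) (s (P.π (q z)))) z₀ :=
    ContMDiffAt.comp z₀ (g := fun z => P.div z (s (P.π z))) (by rw [hq0]; exact h) hq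
  have hpd : ∀ᶠ z in 𝓝 z₀, 𝒢.proj (P.div (q z) (s (P.π (q z)))) = P.space.proj z := by
    filter_upwards [hqπ, hsz] with z h1 h2
    rw [h1, proj_div (h1.trans h2.symm), P.proj_eq, h2, ← P.proj_eq]
  refine (𝒢.contMDiffAt_mul hτ hdq ?_).congr_of_eventuallyEq ?_
  · filter_upwards [hτp, hpd] with z h1 h2 using h1.trans h2.symm
  · filter_upwards [hτp, hpd, hqπ, hsz] with z h1 h2 h3 h4
    have h5 : P.space.proj (s (P.π z)) = P.space.proj z := by rw [P.proj_eq, h4, ← P.proj_eq]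
    refine div_eq ?_ ?_
    · rw [𝒢.proj_mul _ _ (h1.trans h2.symm), h1, h5]
    · rw [P.action.mul_act _ _ _ (h1.trans h5.symm) (h2.trans h5.symm), h3,
        div_act (h3.trans h4.symm), P.action.act_inv_act h1]

end PrincipalBundle

end Division

/-! ### Orbit maps and holomorphy of the division -/

section OrbitMap

variable {E : Type v} [NormedAddCommGroup E] [NormedSpace ℂ E]
  {G : Type u} [TopologicalSpace G] [ChartedSpace E G]
  {F : Type w} [NormedAddCommGroup F] [NormedSpace ℂ F]
  {T : Type u} [TopologicalSpace T] [ChartedSpace F T]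
  {𝒢 : TwistorGroup E G} {𝒯 : RealSpace F T}
  {K : Type*} [NormedAddCommGroup K] [NormedSpace ℂ K]
  {K' : Type*} [NormedAddCommGroup K'] [NormedSpace ℂ K']

namespace PrincipalBundle

variable (P : PrincipalBundle 𝒢 𝒯)

/-- The orbit map `(t, g) ↦ g · s(t)` of a local section `s` of `P → T`, with `g` expressed by a
submersion chart of `𝒢`. -/
noncomputable def orbitMap (θ : OpenPartialHomeomorph G (CP1 × K)) (s : T → P.carrier)
    (q : T × K) : P.carrier :=
  P.action.act (θ.symm (𝒯.proj q.1, q.2)) (s q.1)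

/-- The natural domain of the orbit map. -/
def orbitDomain (𝒯 : RealSpace F T) (θ : OpenPartialHomeomorph G (CP1 × K)) (U : Set T) :
    Set (T × K) :=
  {q | q.1 ∈ U ∧ (𝒯.proj q.1, q.2) ∈ θ.target}

omit [NormedSpace ℂ K] in
theorem isOpen_orbitDomain (θ : OpenPartialHomeomorph G (CP1 × K)) {U : Set T} (hU : IsOpen U) :
    IsOpen (orbitDomain 𝒯 θ U) := by
  have h : Continuous fun q : T × K => (𝒯.proj q.1, q.2) :=
    (𝒯.contMDiff_proj.continuous.comp continuous_fst).prodMk continuous_snd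
  exact (hU.preimage continuous_fst).inter (θ.open_target.preimage h)

variable {P} {θ : OpenPartialHomeomorph G (CP1 × K)} {U : Set T} {s : T → P.carrier}
  (hθ : IsSubmersionChart (E := E) (F := ℂ) 𝒢.proj θ) (hU : IsOpen U)
  (hs : ContMDiffOn 𝓘(ℂ, F) 𝓘(ℂ, EuclideanSpace ℂ (Fin P.dim)) ω s U)
  (hsec : ∀ x ∈ U, P.π (s x) = x)

include hθ hsec in
theorem proj_symm_eq {q : T × K} (hq : q ∈ orbitDomain 𝒯 θ U) :
    𝒢.proj (θ.symm (𝒯.proj q.1, q.2)) = P.space.proj (s q.1) := by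
  rw [hθ.apply_symm hq.2, P.proj_eq, hsec _ hq.1]

include hθ hU hs hsec in
theorem contMDiffAt_orbitMap {q : T × K} (hq : q ∈ orbitDomain 𝒯 θ U) :
    ContMDiffAt (𝓘(ℂ, F).prod 𝓘(ℂ, K)) 𝓘(ℂ, EuclideanSpace ℂ (Fin P.dim)) ω
      (P.orbitMap θ s) q := by
  have h1 : ContMDiffAt (𝓘(ℂ, F).prod 𝓘(ℂ, K)) (𝓘(ℂ, ℂ).prod 𝓘(ℂ, K)) ω
      (fun q : T × K => (𝒯.proj q.1, q.2)) q :=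
    (𝒯.contMDiff_proj.contMDiffAt.comp q contMDiffAt_fst).prodMk contMDiffAt_snd
  refine P.action.contMDiffAt_act ?_ ?_ ?_
  · exact ContMDiffAt.comp (f := fun q : T × K => (𝒯.proj q.1, q.2)) q (hθ.contMDiffAt_symm hq.2) h1
  · exact (hs.contMDiffAt (hU.mem_nhds hq.1)).comp q contMDiffAt_fst
  · filter_upwards [(isOpen_orbitDomain θ hU).mem_nhds hq] with q' hq'
    exact proj_symm_eq hθ hsec hq'

include hθ hsec in
theorem π_orbitMap {q : T × K} (hq : q ∈ orbitDomain 𝒯 θ U) : P.π (P.orbitMap θ s q) = q.1 := by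
  rw [orbitMap, P.π_act (proj_symm_eq hθ hsec hq), hsec _ hq.1]

include hθ hsec in
theorem orbitMap_injOn : Set.InjOn (P.orbitMap θ s) (orbitDomain 𝒯 θ U) := by
  rintro ⟨t, v⟩ hq ⟨t', v'⟩ hq' h
  obtain rfl : t = t' := by
    have := congrArg P.π h
    rwa [π_orbitMap hθ hsec hq, π_orbitMap hθ hsec hq'] at this
  have h1 : θ.symm (𝒯.proj t, v) = θ.symm (𝒯.proj t, v') :=
    P.free.eq_of_act_eq (proj_symm_eq hθ hsec hq) (proj_symm_eq (q := (t, v')) hθ hsec hq') h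
  have h2 : (𝒯.proj t, v) = (𝒯.proj t, v') := θ.symm.injOn hq.2 hq'.2 h1
  exact Prod.ext rfl (congrArg (fun q => q.2) h2)

variable {χ : OpenPartialHomeomorph P.carrier (T × K')}
  (hχ : IsSubmersionChart (E := EuclideanSpace ℂ (Fin P.dim)) (F := F) P.π χ)

/-- The orbit map of the fibre over `t`, expressed in a submersion chart of `P`. -/
noncomputable def fibreMap (θ : OpenPartialHomeomorph G (CP1 × K)) (s : T → P.carrier)
    (χ : OpenPartialHomeomorph P.carrier (T × K')) (t : T) (v : K) : K' :=
  (χ (P.orbitMap θ s (t, v))).2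

/-- The natural domain of `fibreMap`. -/
def fibreDomain (θ : OpenPartialHomeomorph G (CP1 × K)) (U : Set T) (s : T → P.carrier)
    (χ : OpenPartialHomeomorph P.carrier (T × K')) (t : T) : Set K :=
  {v | (t, v) ∈ orbitDomain 𝒯 θ U ∧ P.orbitMap θ s (t, v) ∈ χ.source}

omit [NormedSpace ℂ K'] in
include hθ hU hs hsec in
theorem isOpen_fibreDomain (t : T) : IsOpen (fibreDomain θ U s χ t) := by
  rw [isOpen_iff_mem_nhds]
  intro v hv
  have hc : ContinuousAt (fun v : K => (t, v)) v := by fun_prop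
  refine Filter.inter_mem (hc ((isOpen_orbitDomain θ hU).mem_nhds hv.1)) ?_
  exact ((contMDiffAt_orbitMap hθ hU hs hsec hv.1).continuousAt.comp hc)
    (χ.open_source.mem_nhds hv.2)

include hθ hU hs hsec hχ in
theorem contDiffOn_fibreMap (t : T) :
    ContDiffOn ℂ ω (fibreMap θ s χ t) (fibreDomain θ U s χ t) := by
  rw [← contMDiffOn_iff_contDiffOn]
  intro v hv
  refine ContMDiffAt.contMDiffWithinAt ?_
  have h1 : ContMDiffAt 𝓘(ℂ, K) (𝓘(ℂ, F).prod 𝓘(ℂ, K)) ω (fun v : K => (t, v)) v :=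
    contMDiffAt_const.prodMk contMDiffAt_id
  have h2 : ContMDiffAt 𝓘(ℂ, K) 𝓘(ℂ, EuclideanSpace ℂ (Fin P.dim)) ω
      (fun v => P.orbitMap θ s (t, v)) v :=
    ContMDiffAt.comp (f := fun v : K => (t, v)) v (contMDiffAt_orbitMap hθ hU hs hsec hv.1) h1
  exact ((hχ.contMDiffAt hv.2).comp v h2).snd

include hθ hsec hχ in
theorem fibreMap_injOn (t : T) : Set.InjOn (fibreMap θ s χ t) (fibreDomain θ U s χ t) := by
  intro v hv v' hv' h
  have h1 : χ (P.orbitMap θ s (t, v)) = χ (P.orbitMap θ s (t, v')) := by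
    rw [hχ.apply_eq hv.2, hχ.apply_eq hv'.2, π_orbitMap hθ hsec hv.1, π_orbitMap hθ hsec hv'.1]
    exact Prod.ext rfl h
  have h2 := orbitMap_injOn hθ hsec hv.1 hv'.1 (χ.injOn hv.2 hv'.2 h1)
  exact congrArg Prod.snd h2

include hθ hU hs hsec hχ in
/-- If the orbit map of one fibre is immersive at a point, and the fibre of `P` has at most the
dimension of the fibre of `𝒢`, then the inverse function theorem inverts the orbit map near this
point, and division by the section is holomorphic there. -/
theorem contMDiffAt_div_of_injective_fderiv [FiniteDimensional ℂ F] [FiniteDimensional ℂ K]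
    [FiniteDimensional ℂ K'] [IsManifold 𝓘(ℂ, F) ω T]
    (hdim : Module.finrank ℂ K' ≤ Module.finrank ℂ K) {t : T} {v : K}
    (hv : v ∈ fibreDomain θ U s χ t)
    (hinj : Function.Injective (fderiv ℂ (fibreMap θ s χ t) v)) :
    ContMDiffAt 𝓘(ℂ, EuclideanSpace ℂ (Fin P.dim)) 𝓘(ℂ, E) ω
      (fun z => P.div z (s (P.π z))) (P.orbitMap θ s (t, v)) := by
  set c := chartAt F t with hc
  have hcm : c ∈ IsManifold.maximalAtlas 𝓘(ℂ, F) ω T := IsManifold.chart_mem_maximalAtlas _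
  have htc : t ∈ c.source := mem_chart_source F t
  have hct : c.symm (c t) = t := c.left_inv htc
  let M : F × K → P.carrier := fun p => P.orbitMap θ s (c.symm p.1, p.2)
  let m : F × K → F × K' := fun p => (c (χ (M p)).1, (χ (M p)).2)
  set z₁ := P.orbitMap θ s (t, v) with hz₁
  have hM0 : M (c t, v) = z₁ := by simp only [M, hct, hz₁]
  have hπz₁ : P.π z₁ = t := π_orbitMap hθ hsec hv.1
  have hκ : ContMDiffAt 𝓘(ℂ, F × K) (𝓘(ℂ, F).prod 𝓘(ℂ, K)) ω
      (fun p : F × K => (c.symm p.1, p.2)) (c t, v) :=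
    (ContMDiffAt.comp (f := Prod.fst) (c t, v)
      (contMDiffAt_symm_of_mem_maximalAtlas hcm (c.map_source htc))
      contDiff_fst.contMDiff.contMDiffAt).prodMk contDiff_snd.contMDiff.contMDiffAt
  have hM : ContMDiffAt 𝓘(ℂ, F × K) 𝓘(ℂ, EuclideanSpace ℂ (Fin P.dim)) ω M (c t, v) :=
    ContMDiffAt.comp (f := fun p : F × K => (c.symm p.1, p.2)) (g := P.orbitMap θ s) (c t, v)
      (contMDiffAt_orbitMap hθ hU hs hsec (by rw [hct]; exact hv.1)) hκ
  have hχM : ContMDiffAt 𝓘(ℂ, F × K) (𝓘(ℂ, F).prod 𝓘(ℂ, K')) ω (fun p => χ (M p)) (c t, v) :=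
    ContMDiffAt.comp (f := M) (c t, v) (hχ.contMDiffAt (by rw [hM0]; exact hv.2)) hM
  have hm : ContDiffAt ℂ ω m (c t, v) := by
    rw [← contMDiffAt_iff_contDiffAt]
    refine ContMDiffAt.prodMk_space ?_ hχM.snd
    refine ContMDiffAt.comp (f := fun p => (χ (M p)).1) (c t, v)
      (contMDiffAt_of_mem_maximalAtlas hcm ?_) hχM.fst
    rw [hM0, hχ.fst_apply _ hv.2, hπz₁]; exact htc
  -- Near the base point all the charts are defined.
  have hgood : ∀ᶠ p in 𝓝 (c t, v), p.1 ∈ c.target ∧ (c.symm p.1, p.2) ∈ orbitDomain 𝒯 θ U ∧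
      M p ∈ χ.source := by
    refine Filter.Eventually.and ?_ (Filter.Eventually.and ?_ ?_)
    · exact continuousAt_fst (c.open_target.mem_nhds (c.map_source htc))
    · refine hκ.continuousAt ((isOpen_orbitDomain θ hU).mem_nhds ?_)
      rw [hct]; exact hv.1
    · refine hM.continuousAt (χ.open_source.mem_nhds ?_)
      rw [hM0]; exact hv.2
  have hm1 : ∀ p : F × K, p.1 ∈ c.target → (c.symm p.1, p.2) ∈ orbitDomain 𝒯 θ U →
      M p ∈ χ.source → m p = (p.1, (χ (M p)).2) := by
    intro p h1 h2 h3
    refine Prod.ext ?_ rfl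
    change c (χ (M p)).1 = p.1
    rw [hχ.fst_apply _ h3, π_orbitMap hθ hsec h2]
    exact c.right_inv h1
  have hfib : (fun v' => (m (c t, v')).2) = fibreMap θ s χ t := by
    funext v'
    simp only [m, M, fibreMap, hct]
  obtain ⟨g, hg, hg0, hgr⟩ := exists_localInverse_of_injective_fderiv_snd hm
    (hgood.mono fun p hp => by rw [hm1 p hp.1 hp.2.1 hp.2.2]) (by rwa [hfib]) hdim
  have hm0 : m (c t, v) = (c (P.π z₁), (χ z₁).2) := by
    rw [hm1 _ (c.map_source htc) (by rw [hct]; exact hv.1) (by rw [hM0]; exact hv.2), hM0, hπz₁]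
  rw [hm0] at hg hg0 hgr
  -- The local inverse, as a function on `P`.
  let κ : P.carrier → F × K' := fun z => (c (P.π z), (χ z).2)
  have hκ' : ContMDiffAt 𝓘(ℂ, EuclideanSpace ℂ (Fin P.dim)) 𝓘(ℂ, F × K') ω κ z₁ := by
    refine ContMDiffAt.prodMk_space ?_ (hχ.contMDiffAt hv.2).snd
    exact ContMDiffAt.comp z₁ (contMDiffAt_of_mem_maximalAtlas hcm (by rw [hπz₁]; exact htc))
      P.contMDiff_π.contMDiffAt
  have hgκ : ContMDiffAt 𝓘(ℂ, EuclideanSpace ℂ (Fin P.dim)) 𝓘(ℂ, F × K) ω (fun z => g (κ z)) z₁ :=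
    ContMDiffAt.comp (f := κ) z₁ hg.contMDiffAt hκ'
  have hpair : ContMDiffAt 𝓘(ℂ, EuclideanSpace ℂ (Fin P.dim)) (𝓘(ℂ, ℂ).prod 𝓘(ℂ, K)) ω
      (fun z => (𝒯.proj (P.π z), (g (κ z)).2)) z₁ :=
    ((𝒯.contMDiff_proj.comp P.contMDiff_π).contMDiffAt).prodMk
      (contDiff_snd.contMDiff.contMDiffAt.comp z₁ hgκ)
  have hgz₁ : g (κ z₁) = (c t, v) := hg0
  have htar : (𝒯.proj (P.π z₁), (g (κ z₁)).2) ∈ θ.target := by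
    rw [hgz₁, hπz₁]; exact hv.1.2
  refine (ContMDiffAt.comp (f := fun z => (𝒯.proj (P.π z), (g (κ z)).2)) z₁
    (hθ.contMDiffAt_symm htar) hpair).congr_of_eventuallyEq ?_
  have e1 : ∀ᶠ z in 𝓝 z₁, m (g (κ z)) = κ z := hκ'.continuousAt hgr
  have e2 := hgκ.continuousAt
  rw [ContinuousAt, hgz₁] at e2
  have e3 : ∀ᶠ z in 𝓝 z₁, P.π z ∈ c.source :=
    P.contMDiff_π.continuous.continuousAt (c.open_source.mem_nhds (by rw [hπz₁]; exact htc))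
  filter_upwards [e1, e2 hgood, e3, χ.open_source.mem_nhds hv.2] with z h1 h2 h3 h4
  obtain ⟨h5, h6, h7⟩ := h2
  rw [hm1 _ h5 h6 h7] at h1
  have h8 : c.symm (g (κ z)).1 = P.π z := by
    rw [(Prod.ext_iff.1 h1).1]; exact c.left_inv h3
  have h9 : M (g (κ z)) = z := by
    refine χ.injOn h7 h4 ?_
    rw [hχ.apply_eq h7, hχ.apply_eq h4, π_orbitMap hθ hsec h6, h8]
    exact Prod.ext rfl (Prod.ext_iff.1 h1).2
  rw [h8] at h6
  refine div_eq (proj_symm_eq hθ hsec h6) ?_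
  have h10 : M (g (κ z)) = P.orbitMap θ s (P.π z, (g (κ z)).2) := by
    simp only [M, h8]
  rw [h10] at h9
  exact h9

/-- Division by a local section is holomorphic. Here second countability of `𝒢` is used: without
it, the orbits could have a larger dimension than the group. -/
theorem contMDiffAt_div_section [FiniteDimensional ℂ E] [SecondCountableTopology G]
    [FiniteDimensional ℂ F] [IsManifold 𝓘(ℂ, F) ω T] {U : Set T} {s : T → P.carrier}
    (hU : IsOpen U) (hs : ContMDiffOn 𝓘(ℂ, F) 𝓘(ℂ, EuclideanSpace ℂ (Fin P.dim)) ω s U)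
    (hsec : ∀ x ∈ U, P.π (s x) = x) {z₀ : P.carrier} (hz₀ : P.π z₀ ∈ U) :
    ContMDiffAt 𝓘(ℂ, EuclideanSpace ℂ (Fin P.dim)) 𝓘(ℂ, E) ω
      (fun z => P.div z (s (P.π z))) z₀ := by
  obtain ⟨K, _, _, hK⟩ := 𝒢.proj_submersion
  obtain ⟨K', _, _, hK'⟩ := P.regular.submersion
  set t := P.π z₀ with ht
  let g₁ := 𝒢.one (𝒯.proj t)
  have hKf : FiniteDimensional ℂ K :=
    Module.Finite.of_surjective
      ((ContinuousLinearMap.snd ℂ ℂ K).comp (hK g₁).equiv.toContinuousLinearMap).toLinearMap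
      (Prod.snd_surjective.comp (hK g₁).equiv.surjective)
  have hK'f : FiniteDimensional ℂ K' :=
    Module.Finite.of_surjective
      ((ContinuousLinearMap.snd ℂ F K').comp (hK' z₀).equiv.toContinuousLinearMap).toLinearMap
      (Prod.snd_surjective.comp (hK' z₀).equiv.surjective)
  choose θ hθ hθs using fun g => (hK g).exists_isSubmersionChart
  have hproj : P.space.proj (s t) = 𝒯.proj t := by rw [P.proj_eq, hsec t hz₀]
  -- Countably many charts of the fibre of `𝒢` cover it, hence their images cover the fibre of `P`.
  have hdim : Module.finrank ℂ K' ≤ Module.finrank ℂ K := by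
    obtain ⟨χ, hχ, hχs⟩ := (hK' z₀).exists_isSubmersionChart
    obtain ⟨S, hS, hcov⟩ := TopologicalSpace.countable_cover_nhds
      fun g => (θ g).open_source.mem_nhds (hθs g)
    have : Countable S := hS.to_subtype
    have hcont : Continuous fun w : K' => (t, w) := by fun_prop
    refine finrank_le_of_subset_iUnion_image (O := {w | (t, w) ∈ χ.target}) (ι := S)
      (V := fun i => fibreDomain (θ i) U s χ t) (f := fun i => fibreMap (θ i) s χ t)
      (χ.open_target.preimage hcont) ⟨(χ z₀).2, ?_⟩
      (fun i => isOpen_fibreDomain (hθ i) hU hs hsec t)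
      (fun i => (contDiffOn_fibreMap (hθ i) hU hs hsec hχ t).of_le (by simp)) ?_
    · change (t, (χ z₀).2) ∈ χ.target
      rw [ht, ← hχ.apply_eq hχs]
      exact χ.map_source hχs
    · intro w hw
      have hπ : P.π (χ.symm (t, w)) = P.π (s t) := by rw [hχ.apply_symm hw, hsec t hz₀]
      have hg : 𝒢.proj (P.div (χ.symm (t, w)) (s t)) = 𝒯.proj t := by rw [proj_div hπ, hproj]
      obtain ⟨i, hi, hgi⟩ : ∃ i ∈ S, P.div (χ.symm (t, w)) (s t) ∈ (θ i).source := by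
        have := hcov.symm ▸ Set.mem_univ (P.div (χ.symm (t, w)) (s t))
        simpa using this
      have h1 := (hθ i).apply_eq hgi
      rw [hg] at h1
      have h2 : P.orbitMap (θ i) s (t, (θ i (P.div (χ.symm (t, w)) (s t))).2) = χ.symm (t, w) := by
        change P.action.act ((θ i).symm (𝒯.proj t, _)) (s t) = _
        rw [← h1, (θ i).left_inv hgi, div_act hπ]
      refine Set.mem_iUnion.2 ⟨⟨i, hi⟩, (θ i (P.div (χ.symm (t, w)) (s t))).2, ⟨⟨hz₀, ?_⟩, ?_⟩, ?_⟩
      · change (𝒯.proj t, _) ∈ _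
        rw [← h1]; exact (θ i).map_source hgi
      · rw [h2]; exact χ.map_target hw
      · change (χ _).2 = w
        rw [h2, χ.right_inv hw]
  obtain ⟨χ, hχ, hχs⟩ := (hK' (s t)).exists_isSubmersionChart
  have hg₁ : 𝒢.proj g₁ = 𝒯.proj t := 𝒢.proj_one _
  have hθg₁ : θ g₁ g₁ = (𝒯.proj t, (θ g₁ g₁).2) := by rw [(hθ g₁).apply_eq (hθs g₁), hg₁]
  have hne : (fibreDomain (θ g₁) U s χ t).Nonempty := by
    refine ⟨(θ g₁ g₁).2, ⟨hz₀, ?_⟩, ?_⟩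
    · change (𝒯.proj t, (θ g₁ g₁).2) ∈ _
      rw [← hθg₁]; exact (θ g₁).map_source (hθs g₁)
    · change P.action.act ((θ g₁).symm (𝒯.proj t, (θ g₁ g₁).2)) (s t) ∈ χ.source
      rw [← hθg₁, (θ g₁).left_inv (hθs g₁)]
      change P.action.act (𝒢.one (𝒯.proj t)) (s t) ∈ χ.source
      rw [← hproj, P.action.one_act]; exact hχs
  obtain ⟨v, hv, hinj⟩ := (fibreMap_injOn (hθ g₁) hsec hχ t).exists_injective_fderiv
    (isOpen_fibreDomain (hθ g₁) hU hs hsec t) hne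
    ((contDiffOn_fibreMap (hθ g₁) hU hs hsec hχ t).of_le (by simp))
  have hπv : P.π (P.orbitMap (θ g₁) s (t, v)) = t := π_orbitMap (hθ g₁) hsec hv.1
  refine contMDiffAt_div_of_contMDiffAt (z₁ := P.orbitMap (θ g₁) s (t, v)) (ht.symm.trans hπv.symm)
    ?_ (contMDiffAt_div_of_injective_fderiv (hθ g₁) hU hs hsec hχ hdim hv hinj)
  rw [hπv]
  filter_upwards [hU.mem_nhds hz₀] with x hx using hsec x hx

end PrincipalBundle

end OrbitMap

/-! ### Antiholomorphic maps -/

section AntiHolomorphic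

variable {E : Type*} [NormedAddCommGroup E] [NormedSpace ℂ E]
  {H : Type*} [NormedAddCommGroup H] [NormedSpace ℂ H] [FiniteDimensional ℂ H]
  {A : Type*} [TopologicalSpace A] [ChartedSpace E A]
  {D : Type*} [TopologicalSpace D] [ChartedSpace H D]

/-- Holomorphy of a map into a finite-dimensional manifold may be tested on linear coordinates of a
chart. -/
theorem contMDiffAt_of_forall_coordinate [IsManifold 𝓘(ℂ, H) ω D] {f : A → D} {x : A}
    (hf : ContinuousAt f x)
    (h : ∀ l : H →L[ℂ] ℂ, ContMDiffAt 𝓘(ℂ, E) 𝓘(ℂ, ℂ) ω (fun y => l (chartAt H (f x) (f y))) x) :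
    ContMDiffAt 𝓘(ℂ, E) 𝓘(ℂ, H) ω f x := by
  set d := chartAt H (f x)
  have hdm : d ∈ IsManifold.maximalAtlas 𝓘(ℂ, H) ω D := IsManifold.chart_mem_maximalAtlas _
  have hx : f x ∈ d.source := mem_chart_source H (f x)
  let e : H ≃L[ℂ] (Fin (Module.finrank ℂ H) → ℂ) :=
    (Module.finBasis ℂ H).equivFun.toContinuousLinearEquiv
  have h1 : ContMDiffAt 𝓘(ℂ, E) 𝓘(ℂ, Fin (Module.finrank ℂ H) → ℂ) ω (fun y => e (d (f y))) x :=
    contMDiffAt_pi_space.2 fun k =>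
      h ((ContinuousLinearMap.proj (R := ℂ) (φ := fun _ => ℂ) k).comp e.toContinuousLinearMap)
  have h2 : ContMDiffAt 𝓘(ℂ, E) 𝓘(ℂ, H) ω (fun y => d (f y)) x := by
    have := e.symm.contDiff.contMDiff.contMDiffAt.comp x h1
    refine this.congr_of_eventuallyEq (Filter.Eventually.of_forall fun y => ?_)
    exact (e.symm_apply_apply _).symm
  refine (ContMDiffAt.comp (f := fun y => d (f y)) x
    (contMDiffAt_symm_of_mem_maximalAtlas hdm (d.map_source hx)) h2).congr_of_eventuallyEq ?_
  filter_upwards [hf (d.open_source.mem_nhds hx)] with y hy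
  exact (d.left_inv hy).symm

variable {E' : Type*} [NormedAddCommGroup E'] [NormedSpace ℂ E']
  {B : Type*} [TopologicalSpace B] [ChartedSpace E' B]
  {E'' : Type*} [NormedAddCommGroup E''] [NormedSpace ℂ E'']
  {C : Type*} [TopologicalSpace C] [ChartedSpace E'' C]

/-- The conjugate of a holomorphic map by antiholomorphic maps is holomorphic. -/
theorem AntiHolomorphic.contMDiffOn_comp_comp [IsManifold 𝓘(ℂ, H) ω D] {f : A → B} {s : B → C}
    {g : C → D} {U : Set B} (hf : AntiHolomorphic (E := E) (F := E') f) (hU : IsOpen U)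
    (hs : ContMDiffOn 𝓘(ℂ, E') 𝓘(ℂ, E'') ω s U) (hg : AntiHolomorphic (E := E'') (F := H) g) :
    ContMDiffOn 𝓘(ℂ, E) 𝓘(ℂ, H) ω (fun x => g (s (f x))) (f ⁻¹' U) := by
  intro x hx
  have hsx : ContinuousAt (fun x => g (s (f x))) x :=
    hg.1.continuousAt.comp ((hs.contMDiffAt (hU.mem_nhds hx)).continuousAt.comp hf.1.continuousAt)
  refine ContMDiffAt.contMDiffWithinAt (contMDiffAt_of_forall_coordinate hsx fun l => ?_)
  set d := chartAt H (g (s (f x)))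
  have hd : ContMDiffOn 𝓘(ℂ, H) 𝓘(ℂ, ℂ) ω (fun y => l (d y)) d.source :=
    l.contDiff.contMDiff.comp_contMDiffOn
      (contMDiffOn_of_mem_maximalAtlas (IsManifold.chart_mem_maximalAtlas _))
  have hW : IsOpen (U ∩ s ⁻¹' (g ⁻¹' d.source)) :=
    hs.continuousOn.isOpen_inter_preimage hU (d.open_source.preimage hg.1)
  have h1 := hg.2 _ _ d.open_source hd
  have h2 : ContMDiffOn 𝓘(ℂ, E') 𝓘(ℂ, ℂ) ω (fun y => star (l (d (g (s y)))))
      (U ∩ s ⁻¹' (g ⁻¹' d.source)) :=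
    h1.comp (hs.mono Set.inter_subset_left) fun y hy => hy.2
  have h3 := hf.2 _ _ hW h2
  simp only [star_star] at h3
  exact h3.contMDiffAt ((hW.preimage hf.1).mem_nhds ⟨hx, mem_chart_source H (g (s (f x)))⟩)

end AntiHolomorphic

/-! ### Transition cocycles -/

section Transition

variable {E : Type v} [NormedAddCommGroup E] [NormedSpace ℂ E]
  {G : Type u} [TopologicalSpace G] [ChartedSpace E G]
  {F : Type w} [NormedAddCommGroup F] [NormedSpace ℂ F]
  {T : Type u} [TopologicalSpace T] [ChartedSpace F T]
  {𝒢 : TwistorGroup E G} {𝒯 : RealSpace F T}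

namespace RealCover

theorem real_mem (𝒰 : RealCover 𝒯) {i : 𝒰.ι} {x : T} (hx : x ∈ 𝒰.U i) :
    𝒯.real x ∈ 𝒰.U (𝒰.bar i) := by
  rw [𝒰.U_bar]; exact ⟨x, hx, rfl⟩

/-- The common refinement of two real coverings by the pairwise intersections. -/
def inter (𝒰 𝒱 : RealCover 𝒯) : RealCover 𝒯 where
  ι := 𝒰.ι × 𝒱.ι
  U k := 𝒰.U k.1 ∩ 𝒱.U k.2
  isOpen k := (𝒰.isOpen _).inter (𝒱.isOpen _)
  covers x := by
    obtain ⟨i, hi⟩ := 𝒰.covers x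
    obtain ⟨j, hj⟩ := 𝒱.covers x
    exact ⟨(i, j), hi, hj⟩
  bar k := (𝒰.bar k.1, 𝒱.bar k.2)
  bar_bar k := Prod.ext (𝒰.bar_bar _) (𝒱.bar_bar _)
  U_bar k := by
    have hinj : Function.Injective 𝒯.real := Function.LeftInverse.injective 𝒯.real_real
    rw [𝒰.U_bar, 𝒱.U_bar, Set.image_inter hinj]

/-- The real covering generated by an open covering: each of its members is listed together with
its image under the real structure, and `bar` exchanges the two copies of the index set. -/
def double (𝒯 : RealSpace F T) {ι : Type u} (U : ι → Set T) (hU : ∀ i, IsOpen (U i))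
    (hc : ∀ x, ∃ i, x ∈ U i) : RealCover 𝒯 where
  ι := ι × Bool
  U k := if k.2 then 𝒯.real ⁻¹' U k.1 else U k.1
  isOpen := by
    rintro ⟨i, _ | _⟩
    · simpa using hU i
    · simpa using (hU i).preimage 𝒯.continuous_real
  covers x := (hc x).imp' (fun i => (i, false)) fun i hi => by simpa using hi
  bar k := (k.1, !k.2)
  bar_bar k := by simp
  U_bar := by
    have him : ∀ V : Set T, 𝒯.real '' V = 𝒯.real ⁻¹' V := fun V =>
      congrFun (Set.image_eq_preimage_of_inverse 𝒯.real_real 𝒯.real_real) V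
    rintro ⟨i, _ | _⟩
    · simp [him]
    · ext x; simp [him, 𝒯.real_real]

end RealCover

namespace RealCocycle

variable {𝒰 𝒱 : RealCover 𝒯}

theorem proj_φ (c : RealCocycle 𝒢 𝒰) {i j : 𝒰.ι} {x : T} (hi : x ∈ 𝒰.U i) (hj : x ∈ 𝒰.U j) :
    𝒢.proj (c.φ i j x) = 𝒯.proj x :=
  (c.isSection i j).2 x ⟨hi, hj⟩

theorem contMDiffAt_φ (c : RealCocycle 𝒢 𝒰) {i j : 𝒰.ι} {x : T} (hi : x ∈ 𝒰.U i)
    (hj : x ∈ 𝒰.U j) : ContMDiffAt 𝓘(ℂ, F) 𝓘(ℂ, E) ω (c.φ i j) x :=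
  (c.isSection i j).1.contMDiffAt (((𝒰.isOpen i).inter (𝒰.isOpen j)).mem_nhds ⟨hi, hj⟩)

theorem mul_φ (c : RealCocycle 𝒢 𝒰) {i j : 𝒰.ι} (k : 𝒰.ι) {x : T} (hi : x ∈ 𝒰.U i)
    (hj : x ∈ 𝒰.U j) (hk : x ∈ 𝒰.U k) : 𝒢.mul (c.φ i j x) (c.φ j k x) = c.φ i k x :=
  c.cocycle i j k x ⟨⟨hi, hj⟩, hk⟩

theorem φ_self (c : RealCocycle 𝒢 𝒰) {i : 𝒰.ι} {x : T} (hi : x ∈ 𝒰.U i) :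
    c.φ i i x = 𝒢.one (𝒯.proj x) := by
  rw [𝒢.eq_one_of_mul_eq_self rfl (c.mul_φ i hi hi hi), c.proj_φ hi hi]

theorem Cohomologous.symm {c c' : RealCocycle 𝒢 𝒰} (h : c.Cohomologous c') :
    c'.Cohomologous c := by
  obtain ⟨f, hf, hr, hc⟩ := h
  refine ⟨fun i x => 𝒢.inv (f i x), fun i => ⟨?_, fun x hx => ?_⟩, fun i x hx => ?_, ?_⟩
  · exact 𝒢.inv_holomorphic.comp_contMDiffOn (hf i).1
  · rw [𝒢.proj_inv, (hf i).2 x hx]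
  · beta_reduce
    rw [hr i x hx, 𝒢.real_inv]
  · rintro i j x ⟨hi, hj⟩
    have p1 := (hf i).2 x hi
    have p2 := (hf j).2 x hj
    have p3 := c.proj_φ hi hj
    have p4 := (𝒢.proj_mul _ _ (p1.trans p3.symm)).trans p1
    have q1 := (𝒢.proj_inv (f i x)).trans p1
    have q2 := (𝒢.proj_inv (f j x)).trans p2
    have hinv : 𝒢.inv (𝒢.inv (f j x)) = f j x := by
      rw [← 𝒢.mul_one (𝒢.inv (𝒢.inv (f j x))), 𝒢.proj_inv, 𝒢.proj_inv, ← 𝒢.inv_mul (f j x),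
        𝒢.inv_mul_cancel_left (𝒢.proj_inv _)]
    rw [hc i j x ⟨hi, hj⟩, hinv, ← 𝒢.mul_assoc _ _ _ (q1.trans p4.symm) (p4.trans q2.symm),
      𝒢.inv_mul_cancel_left (p1.trans p3.symm), 𝒢.inv_mul_cancel_right (p3.trans p2.symm)]

end RealCocycle

namespace PrincipalBundle

variable {P Q : PrincipalBundle 𝒢 𝒯} {𝒰 𝒱 : RealCover 𝒯}

/-- A family of holomorphic sections of `P → T` over the members of a real covering, compatible with
the real structures. -/
structure IsSectionFamily (P : PrincipalBundle 𝒢 𝒯) (𝒰 : RealCover 𝒯)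
    (s : 𝒰.ι → T → P.carrier) : Prop where
  contMDiffOn : ∀ i, ContMDiffOn 𝓘(ℂ, F) 𝓘(ℂ, EuclideanSpace ℂ (Fin P.dim)) ω (s i) (𝒰.U i)
  π_apply : ∀ i, ∀ x ∈ 𝒰.U i, P.π (s i x) = x
  real : ∀ i, ∀ x ∈ 𝒰.U i, s (𝒰.bar i) (𝒯.real x) = P.space.real (s i x)

theorem hasTransitionCocycle_iff {c : RealCocycle 𝒢 𝒰} :
    P.HasTransitionCocycle c ↔ ∃ s, P.IsSectionFamily 𝒰 s ∧
      ∀ i j, ∀ x ∈ 𝒰.U i ∩ 𝒰.U j, s i x = P.action.act (c.φ i j x) (s j x) :=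
  ⟨fun ⟨s, h1, h2, h3, h4⟩ => ⟨s, ⟨h1, h2, h3⟩, h4⟩,
    fun ⟨s, ⟨h1, h2, h3⟩, h4⟩ => ⟨s, h1, h2, h3, h4⟩⟩

namespace IsSectionFamily

variable {s : 𝒰.ι → T → P.carrier} (hs : P.IsSectionFamily 𝒰 s)

include hs in
theorem contMDiffAt {i : 𝒰.ι} {x : T} (hx : x ∈ 𝒰.U i) :
    ContMDiffAt 𝓘(ℂ, F) 𝓘(ℂ, EuclideanSpace ℂ (Fin P.dim)) ω (s i) x :=
  (hs.contMDiffOn i).contMDiffAt ((𝒰.isOpen i).mem_nhds hx)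

include hs in
theorem proj_apply {i : 𝒰.ι} {x : T} (hx : x ∈ 𝒰.U i) : P.space.proj (s i x) = 𝒯.proj x := by
  rw [P.proj_eq, hs.π_apply i x hx]

include hs in
/-- The quotient of two local sections of a principal bundle is a holomorphic section of the
structure group. -/
theorem contMDiffAt_div [FiniteDimensional ℂ E] [SecondCountableTopology G]
    [FiniteDimensional ℂ F] [IsManifold 𝓘(ℂ, F) ω T] {t : 𝒱.ι → T → P.carrier}
    (ht : P.IsSectionFamily 𝒱 t) {i : 𝒰.ι} {j : 𝒱.ι} {x : T} (hi : x ∈ 𝒰.U i) (hj : x ∈ 𝒱.U j) :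
    ContMDiffAt 𝓘(ℂ, F) 𝓘(ℂ, E) ω (fun x => P.div (s i x) (t j x)) x := by
  have h1 : ContMDiffAt 𝓘(ℂ, EuclideanSpace ℂ (Fin P.dim)) 𝓘(ℂ, E) ω
      (fun z => P.div z (t j (P.π z))) (s i x) :=
    contMDiffAt_div_section (𝒱.isOpen j) (ht.contMDiffOn j) (ht.π_apply j)
      (by rw [hs.π_apply i x hi]; exact hj)
  refine (ContMDiffAt.comp (f := s i) x h1 (hs.contMDiffAt hi)).congr_of_eventuallyEq ?_
  filter_upwards [(𝒰.isOpen i).mem_nhds hi] with y hy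
  simp only [Function.comp_apply, hs.π_apply i y hy]

include hs in
theorem isSection_div [FiniteDimensional ℂ E] [SecondCountableTopology G]
    [FiniteDimensional ℂ F] [IsManifold 𝓘(ℂ, F) ω T] {t : 𝒱.ι → T → P.carrier}
    (ht : P.IsSectionFamily 𝒱 t) (i : 𝒰.ι) (j : 𝒱.ι) :
    IsSection 𝒢 𝒯 (𝒰.U i ∩ 𝒱.U j) fun x => P.div (s i x) (t j x) := by
  refine ⟨fun x hx => (hs.contMDiffAt_div ht hx.1 hx.2).contMDiffWithinAt, fun x hx => ?_⟩
  rw [proj_div (by rw [hs.π_apply i x hx.1, ht.π_apply j x hx.2]), ht.proj_apply hx.2]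

/-- The transition cocycle of a family of local sections. -/
noncomputable def cocycle [FiniteDimensional ℂ E] [SecondCountableTopology G]
    [FiniteDimensional ℂ F] [IsManifold 𝓘(ℂ, F) ω T] (hs : P.IsSectionFamily 𝒰 s) :
    RealCocycle 𝒢 𝒰 where
  φ i j x := P.div (s i x) (s j x)
  isSection i j := hs.isSection_div hs i j
  cocycle i j k x hx := div_mul_div
    (by rw [hs.π_apply i x hx.1.1, hs.π_apply j x hx.1.2])
    (by rw [hs.π_apply j x hx.1.2, hs.π_apply k x hx.2])
  real i j x hx := by
    rw [hs.real i x hx.1, hs.real j x hx.2,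
      div_real (by rw [hs.π_apply i x hx.1, hs.π_apply j x hx.2])]

end IsSectionFamily

/-- Every principal bundle is locally trivial: it has a transition cocycle on some real covering.
Each local section is listed together with its conjugate by the real structures. -/
theorem exists_hasTransitionCocycle [FiniteDimensional ℂ E] [SecondCountableTopology G]
    [FiniteDimensional ℂ F] [IsManifold 𝓘(ℂ, F) ω T] (P : PrincipalBundle 𝒢 𝒯) :
    ∃ (𝒰 : RealCover 𝒯) (c : RealCocycle 𝒢 𝒰), P.HasTransitionCocycle c := by
  have hsec : ∀ x : T, ∃ (V : Set T) (s : T → P.carrier), IsOpen V ∧ x ∈ V ∧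
      ContMDiffOn 𝓘(ℂ, F) 𝓘(ℂ, EuclideanSpace ℂ (Fin P.dim)) ω s V ∧ ∀ y ∈ V, P.π (s y) = y := by
    intro x
    obtain ⟨z, rfl⟩ := P.regular.isQuotientMap.surjective x
    obtain ⟨V, s, h1, h2, h3, h4, -⟩ := P.regular.submersion.exists_section z
    exact ⟨V, s, h1, h2, h3, h4⟩
  choose V s hV hxV hs hπ using hsec
  let 𝒰 := RealCover.double 𝒯 V hV fun x => ⟨x, hxV x⟩
  let S : T × Bool → T → P.carrier := fun k x =>
    if k.2 then P.space.real (s k.1 (𝒯.real x)) else s k.1 x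
  have hS : P.IsSectionFamily 𝒰 S := by
    refine ⟨?_, ?_, ?_⟩
    · rintro ⟨i, _ | _⟩
      · simpa [S, 𝒰, RealCover.double] using hs i
      · simpa [S, 𝒰, RealCover.double] using 𝒯.real_antiholomorphic.contMDiffOn_comp_comp (hV i)
          (hs i) P.space.real_antiholomorphic
    · rintro ⟨i, _ | _⟩ x hx
      · simp only [𝒰, RealCover.double, Bool.false_eq_true, if_false] at hx
        simpa [S] using hπ i x hx
      · simp only [𝒰, RealCover.double, if_true] at hx
        simp only [S, if_true]
        rw [← P.regular.real_eq, hπ i _ hx, 𝒯.real_real]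
    · rintro ⟨i, _ | _⟩ x hx
      · simp [S, 𝒰, RealCover.double, 𝒯.real_real]
      · simp [S, 𝒰, RealCover.double, P.space.real_real]
  refine ⟨𝒰, hS.cocycle, hasTransitionCocycle_iff.2 ⟨S, hS, fun i j x hx => ?_⟩⟩
  exact (div_act (by rw [hS.π_apply i x hx.1, hS.π_apply j x hx.2])).symm

/-- Two transition cocycles of one principal bundle are cohomologous on the intersection of their
coverings, by the quotients of the local sections. -/
theorem HasTransitionCocycle.h1RRel [FiniteDimensional ℂ E] [SecondCountableTopology G]
    [FiniteDimensional ℂ F] [IsManifold 𝓘(ℂ, F) ω T] {c : RealCocycle 𝒢 𝒰} {c' : RealCocycle 𝒢 𝒱}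
    (h : P.HasTransitionCocycle c) (h' : P.HasTransitionCocycle c') :
    H1RRel 𝒢 𝒯 ⟨𝒰, c⟩ ⟨𝒱, c'⟩ := by
  obtain ⟨s, hs, hc⟩ := hasTransitionCocycle_iff.1 h
  obtain ⟨t, ht, hc'⟩ := hasTransitionCocycle_iff.1 h'
  have hts : ∀ i j, ∀ x ∈ 𝒰.U i ∩ 𝒱.U j, P.π (t j x) = P.π (s i x) := fun i j x hx => by
    rw [hs.π_apply i x hx.1, ht.π_apply j x hx.2]
  refine ⟨𝒰.inter 𝒱, ⟨Prod.fst, fun _ => Set.inter_subset_left, fun _ => rfl⟩,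
    ⟨Prod.snd, fun _ => Set.inter_subset_right, fun _ => rfl⟩,
    fun k x => P.div (t k.2 x) (s k.1 x), fun k => ?_, fun k x hx => ?_, fun k l x hx => ?_⟩
  · have := ht.isSection_div hs k.2 k.1
    rwa [Set.inter_comm] at this
  · change P.div (t (𝒱.bar k.2) _) (s (𝒰.bar k.1) _) = _
    rw [ht.real _ x hx.2, hs.real _ x hx.1, div_real (hts _ _ x hx)]
  · obtain ⟨hk, hl⟩ := hx
    change c'.φ k.2 l.2 x = 𝒢.mul (𝒢.mul _ (c.φ k.1 l.1 x)) _
    have e1 : P.div (t k.2 x) (t l.2 x) = c'.φ k.2 l.2 x :=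
      div_eq ((c'.proj_φ hk.2 hl.2).trans (ht.proj_apply hl.2).symm) (hc' _ _ x ⟨hk.2, hl.2⟩).symm
    have e2 : P.div (s k.1 x) (s l.1 x) = c.φ k.1 l.1 x :=
      div_eq ((c.proj_φ hk.1 hl.1).trans (hs.proj_apply hl.1).symm) (hc _ _ x ⟨hk.1, hl.1⟩).symm
    have p1 : P.π (s k.1 x) = P.π (s l.1 x) := by rw [hs.π_apply _ x hk.1, hs.π_apply _ x hl.1]
    have p2 := hts l.1 l.2 x hl
    rw [← e1, ← e2, div_mul_div (hts _ _ x hk) p1,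
      ← div_mul_div (((hts _ _ x hk).trans p1).trans p2.symm) p2, 𝒢.mul_inv_cancel_right]
    rw [proj_div p2, proj_div (((hts _ _ x hk).trans p1).trans p2.symm), P.proj_eq, p2, ← P.proj_eq]

theorem HasTransitionCocycle.restrict {c : RealCocycle 𝒢 𝒰} (h : P.HasTransitionCocycle c)
    (r : 𝒱.Refinement 𝒰) : P.HasTransitionCocycle (c.restrict r) := by
  obtain ⟨s, h1, h2, h3, h4⟩ := h
  refine ⟨fun k => s (r.index k), fun k => (h1 _).mono (r.subset k),
    fun k x hx => h2 _ x (r.subset k hx), fun k x hx => ?_,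
    fun k l x hx => h4 _ _ x ⟨r.subset k hx.1, r.subset l hx.2⟩⟩
  beta_reduce
  rw [r.index_bar]; exact h3 _ x (r.subset k hx)

/-- A cocycle is a transition cocycle of `P` as soon as one of its restrictions is: the sections
`φ_{jk} s_k` over `U_j ∩ V_k`, for varying `k`, glue to a section over `U_j`. -/
theorem HasTransitionCocycle.of_restrict {c : RealCocycle 𝒢 𝒰} {r : 𝒱.Refinement 𝒰}
    (h : P.HasTransitionCocycle (c.restrict r)) : P.HasTransitionCocycle c := by
  obtain ⟨s, hs, hc⟩ := hasTransitionCocycle_iff.1 h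
  choose k hk using 𝒱.covers
  let S : 𝒰.ι → T → P.carrier := fun j x => P.action.act (c.φ j (r.index (k x)) x) (s (k x) x)
  have hp : ∀ j l x, x ∈ 𝒰.U j → x ∈ 𝒱.U l →
      𝒢.proj (c.φ j (r.index l) x) = P.space.proj (s l x) := fun j l x hj hl => by
    rw [c.proj_φ hj (r.subset l hl), hs.proj_apply hl]
  have hS : ∀ j l x, x ∈ 𝒰.U j → x ∈ 𝒱.U l →
      S j x = P.action.act (c.φ j (r.index l) x) (s l x) := by
    intro j l x hj hl
    change P.action.act _ (s (k x) x) = _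
    have e1 : s (k x) x = P.action.act (c.φ (r.index (k x)) (r.index l) x) (s l x) :=
      hc _ _ x ⟨hk x, hl⟩
    have hrk := r.subset _ (hk x)
    rw [e1, ← P.action.mul_act _ _ _ _ (hp _ l x hrk hl),
      c.mul_φ _ hj hrk (r.subset _ hl)]
    rw [c.proj_φ hj hrk, hs.proj_apply hl]
  refine hasTransitionCocycle_iff.2 ⟨S, ⟨fun j x hx => ?_, fun j x hx => ?_, fun j x hx => ?_⟩, ?_⟩
  · have hkx := hk x
    refine ContMDiffAt.contMDiffWithinAt ?_
    have hev : ∀ᶠ y in 𝓝 x, y ∈ 𝒰.U j ∧ y ∈ 𝒱.U (k x) :=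
      ((𝒰.isOpen j).mem_nhds hx) |> fun h => Filter.inter_mem h ((𝒱.isOpen _).mem_nhds hkx)
    refine (P.action.contMDiffAt_act (c.contMDiffAt_φ hx (r.subset _ hkx)) (hs.contMDiffAt hkx)
      (hev.mono fun y hy => hp _ _ _ hy.1 hy.2)).congr_of_eventuallyEq ?_
    exact hev.mono fun y hy => hS _ _ _ hy.1 hy.2
  · rw [hS j _ x hx (hk x), P.π_act (hp _ _ _ hx (hk x)), hs.π_apply _ x (hk x)]
  · have hkx := hk x
    rw [hS _ _ _ (𝒰.real_mem hx) (𝒱.real_mem hkx), r.index_bar, c.real _ _ x ⟨hx, r.subset _ hkx⟩,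
      hs.real _ x hkx, ← P.action.real_act _ _ (hp _ _ _ hx hkx)]
  · rintro i j x ⟨hi, hj⟩
    have hkx := hk x
    have hrk := r.subset _ hkx
    rw [hS i _ x hi hkx, hS j _ x hj hkx, ← P.action.mul_act _ _ _ _ (hp _ _ _ hj hkx),
      c.mul_φ _ hi hj hrk]
    rw [c.proj_φ hi hj, hs.proj_apply hkx]

theorem HasTransitionCocycle.of_cohomologous {c c' : RealCocycle 𝒢 𝒰}
    (h : P.HasTransitionCocycle c) (hcc : c.Cohomologous c') : P.HasTransitionCocycle c' := by
  obtain ⟨s, hs, hc⟩ := hasTransitionCocycle_iff.1 h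
  obtain ⟨f, hf, hr, hφ⟩ := hcc
  have hp : ∀ i, ∀ x ∈ 𝒰.U i, 𝒢.proj (f i x) = P.space.proj (s i x) := fun i x hx => by
    rw [(hf i).2 x hx, hs.proj_apply hx]
  refine hasTransitionCocycle_iff.2 ⟨fun i x => P.action.act (f i x) (s i x),
    ⟨fun i x hx => ?_, fun i x hx => ?_, fun i x hx => ?_⟩, ?_⟩
  · exact P.action.contMDiffWithinAt_act ((hf i).1 x hx) (hs.contMDiffOn i x hx) (hp i) (hp i x hx)
  · rw [P.π_act (hp i x hx), hs.π_apply i x hx]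
  · rw [hr i x hx, hs.real i x hx, ← P.action.real_act _ _ (hp i x hx)]
  · rintro i j x ⟨hi, hj⟩
    have p1 := (hf i).2 x hi
    have p2 := (hf j).2 x hj
    have p3 := c.proj_φ hi hj
    have p4 := (𝒢.proj_mul _ _ (p1.trans p3.symm)).trans p1
    have q2 := (𝒢.proj_inv (f j x)).trans p2
    have ps := hs.proj_apply hj
    beta_reduce
    rw [hc i j x ⟨hi, hj⟩, hφ i j x ⟨hi, hj⟩, ← P.action.mul_act _ _ _ (p1.trans ps.symm)
      (p3.trans ps.symm), ← P.action.mul_act _ _ _ _ (p2.trans ps.symm),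
      𝒢.inv_mul_cancel_right (p4.trans p2.symm)]
    rw [𝒢.proj_mul _ _ (p4.trans q2.symm), p4, ps]

/-- Having a given transition cocycle depends on the cohomology class of the cocycle only. -/
theorem hasTransitionCocycle_congr {c : RealCocycle 𝒢 𝒰} {c' : RealCocycle 𝒢 𝒱}
    (h : H1R.mk c = H1R.mk c') : P.HasTransitionCocycle c ↔ P.HasTransitionCocycle c' := by
  have key : ∀ a b : Σ 𝒰 : RealCover 𝒯, RealCocycle 𝒢 𝒰, H1RRel 𝒢 𝒯 a b →
      (P.HasTransitionCocycle a.2 ↔ P.HasTransitionCocycle b.2) := by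
    rintro a b ⟨𝒲, r, s, hrs⟩
    exact ⟨fun ha => ((ha.restrict r).of_cohomologous hrs).of_restrict,
      fun hb => ((hb.restrict s).of_cohomologous hrs.symm).of_restrict⟩
  have h2 := congrArg (Quot.lift (fun a : Σ 𝒰 : RealCover 𝒯, RealCocycle 𝒢 𝒰 =>
    P.HasTransitionCocycle a.2) fun a b hab => propext (key a b hab)) h
  exact iff_of_eq h2

theorem Isomorphic.hasTransitionCocycle {c : RealCocycle 𝒢 𝒰} (h : Isomorphic P Q)
    (hP : P.HasTransitionCocycle c) : Q.HasTransitionCocycle c := by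
  obtain ⟨Φ, h1, h2, h3⟩ := h
  obtain ⟨s, hs, hc⟩ := hasTransitionCocycle_iff.1 hP
  refine hasTransitionCocycle_iff.2 ⟨fun i x => Φ (s i x),
    ⟨fun i => ?_, fun i x hx => ?_, fun i x hx => ?_⟩, fun i j x hx => ?_⟩
  · exact Φ.contMDiff.comp_contMDiffOn (hs.contMDiffOn i)
  · rw [h1, hs.π_apply i x hx]
  · rw [hs.real i x hx, h3]
  · beta_reduce
    rw [hc i j x hx, h2 _ _ ((c.proj_φ hx.1 hx.2).trans (hs.proj_apply hx.2).symm)]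

/-- The map `g · s_i ↦ g · t_i` between principal bundles whose local sections `s_i` and `t_i` have
the same transition cocycle. -/
theorem exists_equivariant_map [FiniteDimensional ℂ E] [SecondCountableTopology G]
    [FiniteDimensional ℂ F] [IsManifold 𝓘(ℂ, F) ω T] {c : RealCocycle 𝒢 𝒰}
    {s : 𝒰.ι → T → P.carrier} {t : 𝒰.ι → T → Q.carrier} (hs : P.IsSectionFamily 𝒰 s)
    (ht : Q.IsSectionFamily 𝒰 t)
    (hsc : ∀ i j, ∀ x ∈ 𝒰.U i ∩ 𝒰.U j, s i x = P.action.act (c.φ i j x) (s j x))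
    (htc : ∀ i j, ∀ x ∈ 𝒰.U i ∩ 𝒰.U j, t i x = Q.action.act (c.φ i j x) (t j x)) :
    ∃ Φ : P.carrier → Q.carrier,
      ContMDiff 𝓘(ℂ, EuclideanSpace ℂ (Fin P.dim)) 𝓘(ℂ, EuclideanSpace ℂ (Fin Q.dim)) ω Φ ∧
      (∀ z, Q.π (Φ z) = P.π z) ∧
      (∀ g z, 𝒢.proj g = P.space.proj z → Φ (P.action.act g z) = Q.action.act g (Φ z)) ∧
      (∀ z, Φ (P.space.real z) = Q.space.real (Φ z)) ∧
      ∀ i, ∀ x ∈ 𝒰.U i, Φ (s i x) = t i x := by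
  choose k hk using 𝒰.covers
  let Φ : P.carrier → Q.carrier := fun z =>
    Q.action.act (P.div z (s (k (P.π z)) (P.π z))) (t (k (P.π z)) (P.π z))
  have hsz : ∀ i z, P.π z ∈ 𝒰.U i → P.π z = P.π (s i (P.π z)) := fun i z hz =>
    (hs.π_apply i _ hz).symm
  have hp : ∀ i z, P.π z ∈ 𝒰.U i →
      𝒢.proj (P.div z (s i (P.π z))) = 𝒯.proj (P.π z) := fun i z hz => by
    rw [proj_div (hsz i z hz), hs.proj_apply hz]
  have hΦ : ∀ i z, P.π z ∈ 𝒰.U i →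
      Φ z = Q.action.act (P.div z (s i (P.π z))) (t i (P.π z)) := by
    intro i z hz
    have hkz := hk (P.π z)
    have pc := c.proj_φ hkz hz
    have e1 : P.div z (s i (P.π z)) =
        𝒢.mul (P.div z (s (k (P.π z)) (P.π z))) (c.φ (k (P.π z)) i (P.π z)) := by
      refine div_eq ?_ ?_
      · rw [𝒢.proj_mul _ _ ((hp _ z hkz).trans pc.symm), hp _ z hkz, hs.proj_apply hz]
      · rw [P.action.mul_act _ _ _ ((hp _ z hkz).trans (hs.proj_apply hz).symm)
          (pc.trans (hs.proj_apply hz).symm), ← hsc _ _ _ ⟨hkz, hz⟩, div_act (hsz _ z hkz)]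
    rw [e1, Q.action.mul_act _ _ _ ((hp _ z hkz).trans (ht.proj_apply hz).symm)
      (pc.trans (ht.proj_apply hz).symm), ← htc _ _ _ ⟨hkz, hz⟩]
  have hπΦ : ∀ z, Q.π (Φ z) = P.π z := fun z => by
    have hkz := hk (P.π z)
    rw [hΦ _ z hkz, Q.π_act ((hp _ z hkz).trans (ht.proj_apply hkz).symm), ht.π_apply _ _ hkz]
  refine ⟨Φ, fun z => ?_, hπΦ, fun g z hg => ?_, fun z => ?_, fun i x hx => ?_⟩
  · have hkz := hk (P.π z)
    have hev : ∀ᶠ y in 𝓝 z, P.π y ∈ 𝒰.U (k (P.π z)) :=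
      P.contMDiff_π.continuous.continuousAt ((𝒰.isOpen _).mem_nhds hkz)
    refine (Q.action.contMDiffAt_act (contMDiffAt_div_section (𝒰.isOpen _) (hs.contMDiffOn _)
      (hs.π_apply _) hkz) (ContMDiffAt.comp z (ht.contMDiffAt hkz) P.contMDiff_π.contMDiffAt)
      (hev.mono fun y hy => ?_)).congr_of_eventuallyEq (hev.mono fun y hy => hΦ _ y hy)
    exact (hp _ y hy).trans (ht.proj_apply hy).symm
  · have hkz := hk (P.π z)
    have hπg := P.π_act hg
    have pg : 𝒢.proj g = 𝒯.proj (P.π z) := hg.trans (P.proj_eq z)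
    rw [hΦ _ z hkz, hΦ (k (P.π z)) _ (by rw [hπg]; exact hkz), hπg,
      ← Q.action.mul_act _ _ _ (pg.trans (ht.proj_apply hkz).symm)
        ((hp _ z hkz).trans (ht.proj_apply hkz).symm)]
    congr 1
    refine div_eq ?_ ?_
    · rw [𝒢.proj_mul _ _ (pg.trans (hp _ z hkz).symm), pg, hs.proj_apply hkz]
    · rw [P.action.mul_act _ _ _ (pg.trans (hs.proj_apply hkz).symm)
        ((hp _ z hkz).trans (hs.proj_apply hkz).symm), div_act (hsz _ z hkz)]
  · have hkz := hk (P.π z)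
    have hπr : P.π (P.space.real z) = 𝒯.real (P.π z) := (P.regular.real_eq z).symm
    rw [hΦ _ z hkz, hΦ (𝒰.bar (k (P.π z))) _ (by rw [hπr]; exact 𝒰.real_mem hkz), hπr,
      hs.real _ _ hkz, ht.real _ _ hkz, div_real (hsz _ z hkz),
      ← Q.action.real_act _ _ ((hp _ z hkz).trans (ht.proj_apply hkz).symm)]
  · have hπs := hs.π_apply i x hx
    rw [hΦ i _ (by rw [hπs]; exact hx), hπs]
    have e1 : P.div (s i x) (s i x) = 𝒢.one (P.space.proj (s i x)) :=
      div_eq (𝒢.proj_one _) (P.action.one_act _)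
    rw [e1, hs.proj_apply hx, ← ht.proj_apply hx, Q.action.one_act]

/-- Principal bundles with a common transition cocycle are isomorphic. -/
theorem HasTransitionCocycle.isomorphic [FiniteDimensional ℂ E] [SecondCountableTopology G]
    [FiniteDimensional ℂ F] [IsManifold 𝓘(ℂ, F) ω T] {c : RealCocycle 𝒢 𝒰}
    (hP : P.HasTransitionCocycle c) (hQ : Q.HasTransitionCocycle c) : Isomorphic P Q := by
  obtain ⟨s, hs, hsc⟩ := hasTransitionCocycle_iff.1 hP
  obtain ⟨t, ht, htc⟩ := hasTransitionCocycle_iff.1 hQ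
  obtain ⟨Φ, h1, h2, h3, h4, h5⟩ := exists_equivariant_map hs ht hsc htc
  obtain ⟨Ψ, k1, k2, k3, -, k5⟩ := exists_equivariant_map ht hs htc hsc
  have hΨΦ : ∀ z, Ψ (Φ z) = z := by
    intro z
    obtain ⟨i, hi⟩ := 𝒰.covers (P.π z)
    have hπ : P.π z = P.π (s i (P.π z)) := (hs.π_apply i _ hi).symm
    have hg := proj_div hπ
    rw [← div_act hπ, h3 _ _ hg, h5 i _ hi,
      k3 _ _ (hg.trans ((hs.proj_apply hi).trans (ht.proj_apply hi).symm)), k5 i _ hi]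
  have hΦΨ : ∀ z, Φ (Ψ z) = z := by
    intro z
    obtain ⟨i, hi⟩ := 𝒰.covers (Q.π z)
    have hπ : Q.π z = Q.π (t i (Q.π z)) := (ht.π_apply i _ hi).symm
    have hg := proj_div hπ
    rw [← div_act hπ, k3 _ _ hg, k5 i _ hi,
      h3 _ _ (hg.trans ((ht.proj_apply hi).trans (hs.proj_apply hi).symm)), h5 i _ hi]
  exact ⟨⟨⟨Φ, Ψ, hΨΦ, hΦΨ⟩, h1, k1⟩, h2, h3, h4⟩

end PrincipalBundle

end Transition

/-! ### Composition of submersions -/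

section SubmersionComp

variable {E : Type*} [NormedAddCommGroup E] [NormedSpace ℂ E]
  {F : Type*} [NormedAddCommGroup F] [NormedSpace ℂ F]
  {F' : Type*} [NormedAddCommGroup F'] [NormedSpace ℂ F']
  {M : Type*} [TopologicalSpace M] [ChartedSpace E M]
  {N : Type*} [TopologicalSpace N] [ChartedSpace F N]
  {L : Type*} [TopologicalSpace L] [ChartedSpace F' L]

theorem IsSubmersionChart.comp {K : Type*} [NormedAddCommGroup K] [NormedSpace ℂ K]
    {K' : Type*} [NormedAddCommGroup K'] [NormedSpace ℂ K'] {f : M → N} {f' : N → L}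
    {θ : OpenPartialHomeomorph M (N × K)} {θ' : OpenPartialHomeomorph N (L × K')}
    (h : IsSubmersionChart (E := E) (F := F) f θ)
    (h' : IsSubmersionChart (E := F) (F := F') f' θ') :
    IsSubmersionChart (E := E) (F := F') (f' ∘ f)
      ((θ.trans (θ'.prod (OpenPartialHomeomorph.refl K))).trans
        (Homeomorph.prodAssoc L K' K).toOpenPartialHomeomorph) := by
  set Θ := (θ.trans (θ'.prod (OpenPartialHomeomorph.refl K))).trans
    (Homeomorph.prodAssoc L K' K).toOpenPartialHomeomorph with hΘ
  have hs : ∀ x ∈ Θ.source, x ∈ θ.source ∧ (θ x).1 ∈ θ'.source := by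
    intro x hx
    simpa [hΘ] using hx
  have ht : ∀ q ∈ Θ.target, (q.1, q.2.1) ∈ θ'.target ∧
      (θ'.symm (q.1, q.2.1), q.2.2) ∈ θ.target := by
    intro q hq
    have h0 : (Homeomorph.prodAssoc L K' K).symm q = ((q.1, q.2.1), q.2.2) := rfl
    simpa [hΘ, h0] using hq
  refine ⟨fun x hx => ContMDiffAt.contMDiffWithinAt ?_,
    fun q hq => ContMDiffAt.contMDiffWithinAt ?_, fun x hx => ?_⟩
  · obtain ⟨h1, h2⟩ := hs x hx
    have e1 := h.contMDiffAt h1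
    have e2 : ContMDiffAt 𝓘(ℂ, E) (𝓘(ℂ, F').prod 𝓘(ℂ, K')) ω (fun x => θ' (θ x).1) x :=
      ContMDiffAt.comp (f := fun x => (θ x).1) x (h'.contMDiffAt h2) e1.fst
    exact e2.fst.prodMk (e2.snd.prodMk_space e1.snd)
  · obtain ⟨h1, h2⟩ := ht q hq
    have e0 : ContMDiffAt (𝓘(ℂ, F').prod 𝓘(ℂ, K' × K)) 𝓘(ℂ, K' × K) ω
        (fun q : L × K' × K => q.2) q := contMDiffAt_snd
    have e1 : ContMDiffAt (𝓘(ℂ, F').prod 𝓘(ℂ, K' × K)) (𝓘(ℂ, F').prod 𝓘(ℂ, K')) ω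
        (fun q : L × K' × K => (q.1, q.2.1)) q :=
      contMDiffAt_fst.prodMk (contDiff_fst.contMDiff.contMDiffAt.comp q e0)
    have e2 : ContMDiffAt (𝓘(ℂ, F').prod 𝓘(ℂ, K' × K)) 𝓘(ℂ, F) ω
        (fun q : L × K' × K => θ'.symm (q.1, q.2.1)) q :=
      ContMDiffAt.comp (f := fun q : L × K' × K => (q.1, q.2.1)) q (h'.contMDiffAt_symm h1) e1
    have e3 : ContMDiffAt (𝓘(ℂ, F').prod 𝓘(ℂ, K' × K)) (𝓘(ℂ, F).prod 𝓘(ℂ, K)) ω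
        (fun q : L × K' × K => (θ'.symm (q.1, q.2.1), q.2.2)) q :=
      e2.prodMk (contDiff_snd.contMDiff.contMDiffAt.comp q e0)
    exact ContMDiffAt.comp (f := fun q : L × K' × K => (θ'.symm (q.1, q.2.1), q.2.2)) q
      (h.contMDiffAt_symm h2) e3
  · obtain ⟨h1, h2⟩ := hs x hx
    change (θ' (θ x).1).1 = f' (f x)
    rw [h'.fst_apply _ h2, h.fst_apply _ h1]

theorem Manifold.IsSubmersion.comp [IsManifold 𝓘(ℂ, E) ω M] [IsManifold 𝓘(ℂ, F) ω N]
    [IsManifold 𝓘(ℂ, F') ω L] {f : M → N} {f' : N → L}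
    (h' : Manifold.IsSubmersion 𝓘(ℂ, F) 𝓘(ℂ, F') ω f')
    (h : Manifold.IsSubmersion 𝓘(ℂ, E) 𝓘(ℂ, F) ω f) :
    Manifold.IsSubmersion 𝓘(ℂ, E) 𝓘(ℂ, F') ω (f' ∘ f) := by
  obtain ⟨K, _, _, hK⟩ := h
  obtain ⟨K', _, _, hK'⟩ := h'
  refine Manifold.IsSubmersionOfComplement.isSubmersion (F := K' × K) fun x => ?_
  obtain ⟨θ, hθ, hx⟩ := (hK x).exists_isSubmersionChart
  obtain ⟨θ', hθ', hx'⟩ := (hK' (f x)).exists_isSubmersionChart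
  refine (hθ.comp hθ').isSubmersionAtOfComplement ?_
    ((hK x).equiv.trans (((hK' (f x)).equiv.prodCongr (ContinuousLinearEquiv.refl ℂ K)).trans
      (ContinuousLinearEquiv.prodAssoc ℂ F' K' K)))
  simpa [hx, hθ.fst_apply x hx] using hx'

end SubmersionComp

/-! ### Conjugation of holomorphic functions -/

section Conjugation

variable {V : Type*} [NormedAddCommGroup V] [NormedSpace ℂ V] [StarAddMonoid V]
  [NormedStarGroup V] [StarModule ℂ V]

/-- The power series with conjugate coefficients. -/
noncomputable def FormalMultilinearSeries.conjugate (p : FormalMultilinearSeries ℂ V ℂ) :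
    FormalMultilinearSeries ℂ V ℂ := fun n =>
  MultilinearMap.mkContinuous
    { toFun := fun m => star (p n fun i => star (m i))
      map_update_add' := by
        intro _ m i x y
        have h : ∀ z : V, (fun j => star (Function.update m i z j)) =
            Function.update (fun j => star (m j)) i (star z) := fun z => by
          ext j; by_cases hj : j = i
          · subst hj; simp
          · simp [hj]
        simp only [h, star_add, ContinuousMultilinearMap.map_update_add]
      map_update_smul' := by
        intro _ m i a x
        have h : ∀ z : V, (fun j => star (Function.update m i z j)) =
            Function.update (fun j => star (m j)) i (star z) := fun z => by
          ext j; by_cases hj : j = i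
          · subst hj; simp
          · simp [hj]
        simp only [h, star_smul, ContinuousMultilinearMap.map_update_smul, star_star] }
    ‖p n‖ fun m => by
      change ‖star (p n fun i => star (m i))‖ ≤ _
      rw [norm_star]
      refine ((p n).le_opNorm _).trans_eq ?_
      simp only [norm_star]

theorem FormalMultilinearSeries.conjugate_apply (p : FormalMultilinearSeries ℂ V ℂ) (n : ℕ)
    (m : Fin n → V) : p.conjugate n m = star (p n fun i => star (m i)) := rfl

/-- The conjugate `y ↦ conj (f (conj y))` of a holomorphic function is holomorphic. -/
theorem ContDiffAt.star_comp_star {f : V → ℂ} {x : V} (hf : ContDiffAt ℂ ω f (star x)) :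
    ContDiffAt ℂ ω (fun y => star (f (star y))) x := by
  rw [← contDiffWithinAt_univ, contDiffWithinAt_omega_iff_analyticWithinAt,
    analyticWithinAt_univ] at hf ⊢
  obtain ⟨p, r, hp⟩ := hf
  refine ⟨p.conjugate, r, hp.r_le.trans (FormalMultilinearSeries.radius_le_of_le fun n =>
    MultilinearMap.mkContinuous_norm_le _ (norm_nonneg _) _), hp.r_pos, fun {y} hy => ?_⟩
  have hy' : star y ∈ Metric.eball (0 : V) r := by
    simpa [Metric.mem_eball, edist_zero_right, enorm_eq_nnnorm, nnnorm_star] using hy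
  have h := (hp.hasSum hy').star
  simpa only [FormalMultilinearSeries.conjugate_apply, star_add] using h

variable {E : Type*} [NormedAddCommGroup E] [NormedSpace ℂ E]
  {H : Type*} [NormedAddCommGroup H] [NormedSpace ℂ H] [FiniteDimensional ℂ H]
  {A : Type*} [TopologicalSpace A] [ChartedSpace E A]
  {D : Type*} [TopologicalSpace D] [ChartedSpace H D]

/-- Antiholomorphy may be tested on the linear coordinates of charts. -/
theorem antiHolomorphic_of_forall_coordinate {g : A → D} (hg : Continuous g)
    (h : ∀ x, ∃ e ∈ IsManifold.maximalAtlas 𝓘(ℂ, H) ω D, g x ∈ e.source ∧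
      ∀ l : H →L[ℂ] ℂ, ContMDiffAt 𝓘(ℂ, E) 𝓘(ℂ, ℂ) ω (fun y => star (l (e (g y)))) x) :
    AntiHolomorphic (E := E) (F := H) g := by
  refine ⟨hg, fun V φ hV hφ x hx => ContMDiffAt.contMDiffWithinAt ?_⟩
  obtain ⟨e, he, hxe, hl⟩ := h x
  let L : H ≃L[ℂ] (Fin (Module.finrank ℂ H) → ℂ) :=
    (Module.finBasis ℂ H).equivFun.toContinuousLinearEquiv
  let κ : A → Fin (Module.finrank ℂ H) → ℂ := fun y => star (L (e (g y)))
  have hκ : ContMDiffAt 𝓘(ℂ, E) 𝓘(ℂ, Fin (Module.finrank ℂ H) → ℂ) ω κ x :=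
    contMDiffAt_pi_space.2 fun k =>
      hl ((ContinuousLinearMap.proj (R := ℂ) (φ := fun _ => ℂ) k).comp L.toContinuousLinearMap)
  let ψ : (Fin (Module.finrank ℂ H) → ℂ) → ℂ := fun v => φ (e.symm (L.symm v))
  have hψ : ContDiffAt ℂ ω ψ (star (κ x)) := by
    rw [← contMDiffAt_iff_contDiffAt]
    have h1 : L.symm (star (κ x)) = e (g x) := by simp [κ]
    have h2 : ContMDiffAt 𝓘(ℂ, H) 𝓘(ℂ, ℂ) ω (fun w => φ (e.symm w)) (L.symm (star (κ x))) := by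
      rw [h1]
      refine ContMDiffAt.comp (f := e.symm) _ ?_
        (contMDiffAt_symm_of_mem_maximalAtlas he (e.map_source hxe))
      rw [e.left_inv hxe]
      exact hφ.contMDiffAt (hV.mem_nhds hx)
    exact ContMDiffAt.comp (f := L.symm) _ h2 L.symm.contDiff.contMDiff.contMDiffAt
  refine (ContMDiffAt.comp (f := κ) x hψ.star_comp_star.contMDiffAt hκ).congr_of_eventuallyEq ?_
  filter_upwards [hg.continuousAt (e.open_source.mem_nhds hxe)] with y hy
  simp only [Function.comp_apply, ψ, κ, star_star, L.symm_apply_apply]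
  rw [e.left_inv hy]

end Conjugation

/-! ### The space of a cocycle -/

section FibreModel

variable {E : Type v} [NormedAddCommGroup E] [NormedSpace ℂ E]
  {G : Type u} [TopologicalSpace G] [ChartedSpace E G]

namespace TwistorGroup

variable (𝒢 : TwistorGroup E G)

/-- The model space of the fibres of a twistor group. -/
abbrev FibreModel : Type v := 𝒢.proj_submersion.complement

instance [FiniteDimensional ℂ E] : FiniteDimensional ℂ 𝒢.FibreModel :=
  Module.Finite.of_surjective
    ((ContinuousLinearMap.snd ℂ ℂ 𝒢.FibreModel).comp
      (𝒢.proj_submersion.isSubmersionOfComplement_complement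
        (𝒢.one OnePoint.infty)).equiv.toContinuousLinearMap).toLinearMap
    (Prod.snd_surjective.comp
      (𝒢.proj_submersion.isSubmersionOfComplement_complement
        (𝒢.one OnePoint.infty)).equiv.surjective)

theorem exists_chart (g : G) : ∃ θ : OpenPartialHomeomorph G (CP1 × 𝒢.FibreModel),
    IsSubmersionChart (E := E) (F := ℂ) 𝒢.proj θ ∧ g ∈ θ.source :=
  (𝒢.proj_submersion.isSubmersionOfComplement_complement g).exists_isSubmersionChart

/-- A submersion chart of `𝒢 → ℂP¹` around `g`. -/
noncomputable def chart (g : G) : OpenPartialHomeomorph G (CP1 × 𝒢.FibreModel) :=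
  (𝒢.exists_chart g).choose

theorem isSubmersionChart_chart (g : G) :
    IsSubmersionChart (E := E) (F := ℂ) 𝒢.proj (𝒢.chart g) :=
  (𝒢.exists_chart g).choose_spec.1

theorem mem_chart_source (g : G) : g ∈ (𝒢.chart g).source :=
  (𝒢.exists_chart g).choose_spec.2

/-- The dimension of a principal `𝒢`-bundle over a space modelled on `F`. -/
noncomputable def bundleDim (F : Type w) [NormedAddCommGroup F] [NormedSpace ℂ F] : ℕ :=
  Module.finrank ℂ F + Module.finrank ℂ 𝒢.FibreModel

/-- The model space of a principal `𝒢`-bundle over a space modelled on `F`. -/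
abbrev BundleModel (F : Type w) [NormedAddCommGroup F] [NormedSpace ℂ F] : Type :=
  EuclideanSpace ℂ (Fin (𝒢.bundleDim F))

/-- Linear coordinates which split the model space of a principal bundle. -/
noncomputable def bundleModelEquiv [FiniteDimensional ℂ E] (F : Type w) [NormedAddCommGroup F]
    [NormedSpace ℂ F] [FiniteDimensional ℂ F] : 𝒢.BundleModel F ≃L[ℂ] F × 𝒢.FibreModel :=
  ContinuousLinearEquiv.ofFinrankEq (by
    rw [finrank_euclideanSpace_fin, Module.finrank_prod, bundleDim])

end TwistorGroup

end FibreModel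

section CocycleSpace

variable {E : Type v} [NormedAddCommGroup E] [NormedSpace ℂ E]
  {G : Type u} [TopologicalSpace G] [ChartedSpace E G]
  {F : Type w} [NormedAddCommGroup F] [NormedSpace ℂ F]
  {T : Type u} [TopologicalSpace T] [ChartedSpace F T]
  {𝒢 : TwistorGroup E G} {𝒯 : RealSpace F T} {𝒰 : RealCover 𝒯}

/-- An index of a member of the covering containing `x`. -/
noncomputable def RealCover.indexAt (𝒰 : RealCover 𝒯) (x : T) : 𝒰.ι := (𝒰.covers x).choose

theorem RealCover.mem_indexAt (𝒰 : RealCover 𝒯) (x : T) : x ∈ 𝒰.U (𝒰.indexAt x) :=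
  (𝒰.covers x).choose_spec

/-- The total space of the principal bundle glued from the products `U_i ×_{ℂP¹} G` by a cocycle
`φ`. For every `x ∈ T` an index `i` with `x ∈ U_i` is chosen; the fibre over `x` is represented by
the fibre of `G`, where `g` stands for the point `g · s_i(x)`. So the underlying set is the fibre
product `T ×_{ℂP¹} G`, and the cocycle only enters the topology and the complex structure. -/
@[ext]
structure CocycleSpace (c : RealCocycle 𝒢 𝒰) where
  base : T
  fibre : G
  proj_fibre : 𝒢.proj fibre = 𝒯.proj base

namespace CocycleSpace

variable {c : RealCocycle 𝒢 𝒰}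

/-- The group coordinate of the local trivialization over `U_i`: `z = coord i z · s_i`. (It has no
meaning at points `z` which do not lie over `U_i`.) -/
noncomputable def coord (i : 𝒰.ι) (z : CocycleSpace c) : G :=
  𝒢.mul z.fibre (c.φ (𝒰.indexAt z.base) i z.base)

theorem proj_coord {i : 𝒰.ι} {z : CocycleSpace c} (hz : z.base ∈ 𝒰.U i) :
    𝒢.proj (coord i z) = 𝒯.proj z.base := by
  have h := c.proj_φ (𝒰.mem_indexAt z.base) hz
  rw [coord, 𝒢.proj_mul _ _ (z.proj_fibre.trans h.symm), z.proj_fibre]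

theorem coord_mul_φ {i j : 𝒰.ι} {z : CocycleSpace c} (hi : z.base ∈ 𝒰.U i) (hj : z.base ∈ 𝒰.U j) :
    𝒢.mul (coord i z) (c.φ i j z.base) = coord j z := by
  have h0 := 𝒰.mem_indexAt z.base
  have h1 := c.proj_φ h0 hi
  have h2 := c.proj_φ hi hj
  rw [coord, 𝒢.mul_assoc _ _ _ (z.proj_fibre.trans h1.symm) (h1.trans h2.symm),
    c.mul_φ _ h0 hi hj, coord]

open Classical in
variable (c) in
/-- The point `g · s_i(x)` over `x ∈ U_i`. (If `x ∉ U_i`, or if `g` lies in another fibre, the value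
is the unit in the fibre over `x`.) -/
noncomputable def point (i : 𝒰.ι) (x : T) (g : G) : CocycleSpace c :=
  if h : x ∈ 𝒰.U i ∧ 𝒢.proj g = 𝒯.proj x then
    ⟨x, 𝒢.mul g (c.φ i (𝒰.indexAt x) x), by
      rw [𝒢.proj_mul _ _ (h.2.trans (c.proj_φ h.1 (𝒰.mem_indexAt x)).symm), h.2]⟩
  else ⟨x, 𝒢.one (𝒯.proj x), 𝒢.proj_one _⟩

@[simp] theorem base_point (i : 𝒰.ι) (x : T) (g : G) : (point c i x g).base = x := by
  unfold point; split_ifs <;> rfl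

theorem coord_point_of_mem {i j : 𝒰.ι} {x : T} {g : G} (hi : x ∈ 𝒰.U i) (hj : x ∈ 𝒰.U j)
    (hg : 𝒢.proj g = 𝒯.proj x) : coord j (point c i x g) = 𝒢.mul g (c.φ i j x) := by
  have h0 := 𝒰.mem_indexAt x
  have h1 := c.proj_φ hi h0
  rw [point, dif_pos ⟨hi, hg⟩]
  change 𝒢.mul (𝒢.mul g (c.φ i (𝒰.indexAt x) x)) (c.φ (𝒰.indexAt x) j x) = _
  rw [𝒢.mul_assoc _ _ _ (hg.trans h1.symm) (h1.trans (c.proj_φ h0 hj).symm), c.mul_φ _ hi h0 hj]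

theorem coord_point {i : 𝒰.ι} {x : T} {g : G} (hi : x ∈ 𝒰.U i) (hg : 𝒢.proj g = 𝒯.proj x) :
    coord i (point c i x g) = g := by
  rw [coord_point_of_mem hi hi hg, c.φ_self hi, ← hg, 𝒢.mul_one]

theorem ext_coord {i : 𝒰.ι} {z z' : CocycleSpace c} (hi : z.base ∈ 𝒰.U i)
    (hb : z.base = z'.base) (hc : coord i z = coord i z') : z = z' := by
  obtain ⟨b, g, h⟩ := z
  obtain ⟨b', g', h'⟩ := z'
  obtain rfl : b = b' := hb
  have hp := (c.proj_φ (𝒰.mem_indexAt b) hi).symm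
  have hc' : 𝒢.mul g (c.φ (𝒰.indexAt b) i b) = 𝒢.mul g' (c.φ (𝒰.indexAt b) i b) := hc
  have hg := 𝒢.mul_inv_cancel_right (h.trans hp)
  rw [hc', 𝒢.mul_inv_cancel_right (h'.trans hp)] at hg
  exact CocycleSpace.ext rfl hg.symm

theorem point_coord {i : 𝒰.ι} {z : CocycleSpace c} (hz : z.base ∈ 𝒰.U i) :
    point c i z.base (coord i z) = z :=
  ext_coord (i := i) (by simpa using hz) (by simp) (coord_point hz (proj_coord hz))

/-! ### The complex structure -/

section Charts

variable [FiniteDimensional ℂ E] [FiniteDimensional ℂ F]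

/-- The point of `T` with given coordinates. -/
noncomputable def paramBase (𝒢 : TwistorGroup E G) (t₀ : T) (w : 𝒢.BundleModel F) : T :=
  (chartAt F t₀).symm (𝒢.bundleModelEquiv F w).1

/-- The point of `G` with given coordinates. -/
noncomputable def paramCoord (𝒯 : RealSpace F T) (g₀ : G) (t₀ : T) (w : 𝒢.BundleModel F) : G :=
  (𝒢.chart g₀).symm (𝒯.proj (paramBase 𝒢 t₀ w), (𝒢.bundleModelEquiv F w).2)

/-- The range of the chart `chartEquiv`. -/
def chartTarget (𝒢 : TwistorGroup E G) (𝒰 : RealCover 𝒯) (i : 𝒰.ι) (g₀ : G) (t₀ : T) :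
    Set (𝒢.BundleModel F) :=
  {w | (𝒢.bundleModelEquiv F w).1 ∈ (chartAt F t₀).target ∧ paramBase 𝒢 t₀ w ∈ 𝒰.U i ∧
    (𝒯.proj (paramBase 𝒢 t₀ w), (𝒢.bundleModelEquiv F w).2) ∈ (𝒢.chart g₀).target}

theorem proj_paramCoord {i : 𝒰.ι} {g₀ : G} {t₀ : T} {w : 𝒢.BundleModel F}
    (hw : w ∈ chartTarget 𝒢 𝒰 i g₀ t₀) :
    𝒢.proj (paramCoord 𝒯 g₀ t₀ w) = 𝒯.proj (paramBase 𝒢 t₀ w) :=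
  (𝒢.isSubmersionChart_chart g₀).apply_symm hw.2.2

variable (c) in
/-- The chart of the total space given by the trivialization over `U_i`, the chart of `T` around
`t₀`, and the submersion chart of `G` around `g₀`. -/
noncomputable def chartEquiv (i : 𝒰.ι) (g₀ : G) (t₀ : T) :
    PartialEquiv (CocycleSpace c) (𝒢.BundleModel F) where
  toFun z := (𝒢.bundleModelEquiv F).symm (chartAt F t₀ z.base, (𝒢.chart g₀ (coord i z)).2)
  invFun w := point c i (paramBase 𝒢 t₀ w) (paramCoord 𝒯 g₀ t₀ w)
  source := {z | z.base ∈ 𝒰.U i ∧ z.base ∈ (chartAt F t₀).source ∧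
    coord i z ∈ (𝒢.chart g₀).source}
  target := chartTarget 𝒢 𝒰 i g₀ t₀
  map_source' := by
    rintro z ⟨h1, h2, h3⟩
    have hb : paramBase 𝒢 t₀ ((𝒢.bundleModelEquiv F).symm
        (chartAt F t₀ z.base, (𝒢.chart g₀ (coord i z)).2)) = z.base := by
      rw [paramBase, ContinuousLinearEquiv.apply_symm_apply]
      exact (chartAt F t₀).left_inv h2
    refine ⟨?_, by rwa [hb], ?_⟩
    · rw [ContinuousLinearEquiv.apply_symm_apply]
      exact (chartAt F t₀).map_source h2
    · rw [hb, ContinuousLinearEquiv.apply_symm_apply, ← proj_coord h1,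
        ← (𝒢.isSubmersionChart_chart g₀).apply_eq h3]
      exact (𝒢.chart g₀).map_source h3
  map_target' := by
    intro w hw
    change (point c i _ _).base ∈ 𝒰.U i ∧ (point c i _ _).base ∈ (chartAt F t₀).source ∧
      coord i (point c i _ _) ∈ (𝒢.chart g₀).source
    rw [base_point, coord_point hw.2.1 (proj_paramCoord hw)]
    exact ⟨hw.2.1, (chartAt F t₀).map_target hw.1, (𝒢.chart g₀).map_target hw.2.2⟩
  left_inv' := by
    rintro z ⟨h1, h2, h3⟩
    have hb : paramBase 𝒢 t₀ ((𝒢.bundleModelEquiv F).symm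
        (chartAt F t₀ z.base, (𝒢.chart g₀ (coord i z)).2)) = z.base := by
      rw [paramBase, ContinuousLinearEquiv.apply_symm_apply]
      exact (chartAt F t₀).left_inv h2
    rw [paramCoord, hb, ContinuousLinearEquiv.apply_symm_apply, ← proj_coord h1,
      ← (𝒢.isSubmersionChart_chart g₀).apply_eq h3, (𝒢.chart g₀).left_inv h3, point_coord h1]
  right_inv' := by
    intro w hw
    rw [base_point, coord_point hw.2.1 (proj_paramCoord hw), paramCoord,
      (𝒢.chart g₀).right_inv hw.2.2, paramBase, (chartAt F t₀).right_inv hw.1]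
    exact (𝒢.bundleModelEquiv F).symm_apply_apply w

variable [IsManifold 𝓘(ℂ, F) ω T]

omit [IsManifold 𝓘(ℂ, F) ω T] in
theorem continuous_model : Continuous (𝒢.bundleModelEquiv F) :=
  (𝒢.bundleModelEquiv F).continuous

theorem contMDiffAt_paramBase {t₀ : T} {w : 𝒢.BundleModel F}
    (hw : (𝒢.bundleModelEquiv F w).1 ∈ (chartAt F t₀).target) :
    ContMDiffAt 𝓘(ℂ, 𝒢.BundleModel F) 𝓘(ℂ, F) ω (paramBase 𝒢 t₀) w :=
  (contMDiffAt_symm_of_mem_maximalAtlas (IsManifold.chart_mem_maximalAtlas t₀) hw).comp w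
    (contDiff_fst.comp (𝒢.bundleModelEquiv F).contDiff).contMDiff.contMDiffAt

theorem contMDiffAt_paramPair {t₀ : T} {w : 𝒢.BundleModel F}
    (hw : (𝒢.bundleModelEquiv F w).1 ∈ (chartAt F t₀).target) :
    ContMDiffAt 𝓘(ℂ, 𝒢.BundleModel F) (𝓘(ℂ, ℂ).prod 𝓘(ℂ, 𝒢.FibreModel)) ω
      (fun w => (𝒯.proj (paramBase 𝒢 t₀ w), (𝒢.bundleModelEquiv F w).2)) w :=
  (𝒯.contMDiff_proj.contMDiffAt.comp w (contMDiffAt_paramBase hw)).prodMk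
    (contDiff_snd.comp (𝒢.bundleModelEquiv F).contDiff).contMDiff.contMDiffAt

theorem contMDiffAt_paramCoord {i : 𝒰.ι} {g₀ : G} {t₀ : T} {w : 𝒢.BundleModel F}
    (hw : w ∈ chartTarget 𝒢 𝒰 i g₀ t₀) :
    ContMDiffAt 𝓘(ℂ, 𝒢.BundleModel F) 𝓘(ℂ, E) ω (paramCoord 𝒯 g₀ t₀) w :=
  ContMDiffAt.comp
    (f := fun w => (𝒯.proj (paramBase 𝒢 t₀ w), (𝒢.bundleModelEquiv F w).2)) w
    ((𝒢.isSubmersionChart_chart g₀).contMDiffAt_symm hw.2.2) (contMDiffAt_paramPair hw.1)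

theorem isOpen_chartTarget (i : 𝒰.ι) (g₀ : G) (t₀ : T) : IsOpen (chartTarget 𝒢 𝒰 i g₀ t₀) := by
  rw [isOpen_iff_mem_nhds]
  intro w hw
  have h1 := (contMDiffAt_paramBase hw.1).continuousAt ((𝒰.isOpen i).mem_nhds hw.2.1)
  have h2 := (contMDiffAt_paramPair (𝒯 := 𝒯) hw.1).continuousAt
    ((𝒢.chart g₀).open_target.mem_nhds hw.2.2)
  have h3 : ∀ᶠ w' in 𝓝 w, (𝒢.bundleModelEquiv F w').1 ∈ (chartAt F t₀).target :=
    (continuous_fst.comp continuous_model).continuousAt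
      ((chartAt F t₀).open_target.mem_nhds hw.1)
  filter_upwards [h1, h2, h3] with w' k1 k2 k3 using ⟨k3, k1, k2⟩

/-- Coordinate changes are holomorphic near each point where they are defined. -/
theorem contMDiffAt_chartEquiv_trans {i j : 𝒰.ι} {g₀ g₁ : G} {t₀ t₁ : T} {w : 𝒢.BundleModel F}
    (hw : w ∈ ((chartEquiv c i g₀ t₀).symm.trans (chartEquiv c j g₁ t₁)).source) :
    ((chartEquiv c i g₀ t₀).symm.trans (chartEquiv c j g₁ t₁)).source ∈ 𝓝 w ∧
      ContMDiffAt 𝓘(ℂ, 𝒢.BundleModel F) 𝓘(ℂ, 𝒢.BundleModel F) ω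
        ((chartEquiv c i g₀ t₀).symm.trans (chartEquiv c j g₁ t₁)) w := by
  -- In coordinates the transition multiplies the group coordinate by `φ_{ij}`.
  let γ : 𝒢.BundleModel F → G := fun w =>
    𝒢.mul (paramCoord 𝒯 g₀ t₀ w) (c.φ i j (paramBase 𝒢 t₀ w))
  have hsrc : ∀ w, w ∈ ((chartEquiv c i g₀ t₀).symm.trans (chartEquiv c j g₁ t₁)).source ↔
      w ∈ chartTarget 𝒢 𝒰 i g₀ t₀ ∧ paramBase 𝒢 t₀ w ∈ 𝒰.U j ∧
        paramBase 𝒢 t₀ w ∈ (chartAt F t₁).source ∧ γ w ∈ (𝒢.chart g₁).source := by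
    intro w
    rw [PartialEquiv.trans_source]
    refine and_congr_right fun hw => ?_
    change (point c i _ _).base ∈ 𝒰.U j ∧ (point c i _ _).base ∈ (chartAt F t₁).source ∧
      coord j (point c i _ _) ∈ _ ↔ _
    rw [base_point]
    refine and_congr_right fun hj => and_congr_right fun _ => ?_
    rw [coord_point_of_mem hw.2.1 hj (proj_paramCoord hw)]
  have happ : ∀ w ∈ ((chartEquiv c i g₀ t₀).symm.trans (chartEquiv c j g₁ t₁)).source,
      ((chartEquiv c i g₀ t₀).symm.trans (chartEquiv c j g₁ t₁)) w =
        (𝒢.bundleModelEquiv F).symm (chartAt F t₁ (paramBase 𝒢 t₀ w), (𝒢.chart g₁ (γ w)).2) := by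
    intro w hw
    obtain ⟨h1, h2, -, -⟩ := (hsrc w).1 hw
    change (𝒢.bundleModelEquiv F).symm (chartAt F t₁ (point c i _ _).base,
      (𝒢.chart g₁ (coord j (point c i _ _))).2) = _
    rw [base_point, coord_point_of_mem h1.2.1 h2 (proj_paramCoord h1)]
  obtain ⟨h1, h2, h3, h4⟩ := (hsrc w).1 hw
  have hb := contMDiffAt_paramBase h1.1
  have hT : ∀ᶠ w' in 𝓝 w, w' ∈ chartTarget 𝒢 𝒰 i g₀ t₀ :=
    (isOpen_chartTarget i g₀ t₀).mem_nhds h1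
  have hj : ∀ᶠ w' in 𝓝 w, paramBase 𝒢 t₀ w' ∈ 𝒰.U j :=
    hb.continuousAt ((𝒰.isOpen j).mem_nhds h2)
  have hγ : ContMDiffAt 𝓘(ℂ, 𝒢.BundleModel F) 𝓘(ℂ, E) ω γ w := by
    refine 𝒢.contMDiffAt_mul (contMDiffAt_paramCoord h1)
      ((c.contMDiffAt_φ h1.2.1 h2).comp w hb) ?_
    filter_upwards [hT, hj] with w' k1 k2
    exact (proj_paramCoord k1).trans (c.proj_φ k1.2.1 k2).symm
  have hmem : ((chartEquiv c i g₀ t₀).symm.trans (chartEquiv c j g₁ t₁)).source ∈ 𝓝 w := by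
    filter_upwards [hT, hj, hb.continuousAt ((chartAt F t₁).open_source.mem_nhds h3),
      hγ.continuousAt ((𝒢.chart g₁).open_source.mem_nhds h4)] with w' k1 k2 k3 k4
    exact (hsrc w').2 ⟨k1, k2, k3, k4⟩
  refine ⟨hmem, ?_⟩
  have e1 : ContMDiffAt 𝓘(ℂ, 𝒢.BundleModel F) 𝓘(ℂ, F × 𝒢.FibreModel) ω
      (fun w => (chartAt F t₁ (paramBase 𝒢 t₀ w), (𝒢.chart g₁ (γ w)).2)) w :=
    ((contMDiffAt_of_mem_maximalAtlas (IsManifold.chart_mem_maximalAtlas t₁) h3).comp w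
      hb).prodMk_space (((𝒢.isSubmersionChart_chart g₁).contMDiffAt h4).comp w hγ).snd
  refine ((𝒢.bundleModelEquiv F).symm.contDiff.contMDiff.contMDiffAt.comp w
    e1).congr_of_eventuallyEq ?_
  filter_upwards [hmem] with w' hw' using happ w' hw'

variable (c) in
/-- The charts of the total space. -/
noncomputable def chartCore : ChartedSpaceCore (𝒢.BundleModel F) (CocycleSpace c) where
  atlas := {e | ∃ i g₀ t₀, e = chartEquiv c i g₀ t₀}
  chartAt z := chartEquiv c (𝒰.indexAt z.base) (coord (𝒰.indexAt z.base) z) z.base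
  mem_chart_source z :=
    ⟨𝒰.mem_indexAt z.base, mem_chart_source F z.base, 𝒢.mem_chart_source _⟩
  chart_mem_atlas z := ⟨_, _, _, rfl⟩
  open_source := by
    rintro _ _ ⟨i, g₀, t₀, rfl⟩ ⟨j, g₁, t₁, rfl⟩
    exact isOpen_iff_mem_nhds.2 fun w hw => (contMDiffAt_chartEquiv_trans hw).1
  continuousOn_toFun := by
    rintro _ _ ⟨i, g₀, t₀, rfl⟩ ⟨j, g₁, t₁, rfl⟩ w hw
    exact (contMDiffAt_chartEquiv_trans hw).2.continuousAt.continuousWithinAt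

noncomputable instance : TopologicalSpace (CocycleSpace c) := (chartCore c).toTopologicalSpace

noncomputable instance : ChartedSpace (𝒢.BundleModel F) (CocycleSpace c) :=
  (chartCore c).toChartedSpace

variable (c) in
/-- `chartEquiv` as a chart of the manifold `CocycleSpace c`. -/
noncomputable def chart (i : 𝒰.ι) (g₀ : G) (t₀ : T) :
    OpenPartialHomeomorph (CocycleSpace c) (𝒢.BundleModel F) :=
  (chartCore c).openPartialHomeomorph (chartEquiv c i g₀ t₀) ⟨i, g₀, t₀, rfl⟩

theorem chart_mem_atlas (i : 𝒰.ι) (g₀ : G) (t₀ : T) :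
    chart c i g₀ t₀ ∈ atlas (𝒢.BundleModel F) (CocycleSpace c) :=
  Set.mem_iUnion.2 ⟨_, Set.mem_iUnion.2 ⟨⟨i, g₀, t₀, rfl⟩, rfl⟩⟩

instance : IsManifold 𝓘(ℂ, 𝒢.BundleModel F) ω (CocycleSpace c) := by
  apply isManifold_of_contDiffOn
  intro e e' he he'
  obtain ⟨_, he⟩ := Set.mem_iUnion.1 he
  obtain ⟨⟨i, g₀, t₀, rfl⟩, rfl⟩ := Set.mem_iUnion.1 he
  obtain ⟨_, he'⟩ := Set.mem_iUnion.1 he'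
  obtain ⟨⟨j, g₁, t₁, rfl⟩, rfl⟩ := Set.mem_iUnion.1 he'
  rw [← contMDiffOn_iff_contDiffOn]
  intro w hw
  have hw' : w ∈ ((chartEquiv c i g₀ t₀).symm.trans (chartEquiv c j g₁ t₁)).source := hw.1
  exact (contMDiffAt_chartEquiv_trans hw').2.contMDiffWithinAt

theorem chart_mem_maximalAtlas (i : 𝒰.ι) (g₀ : G) (t₀ : T) :
    chart c i g₀ t₀ ∈ IsManifold.maximalAtlas 𝓘(ℂ, 𝒢.BundleModel F) ω (CocycleSpace c) :=
  IsManifold.subset_maximalAtlas (chart_mem_atlas i g₀ t₀)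

theorem mem_chart {i : 𝒰.ι} {z : CocycleSpace c} (hz : z.base ∈ 𝒰.U i) :
    z ∈ (chart c i (coord i z) z.base).source :=
  ⟨hz, mem_chart_source F z.base, 𝒢.mem_chart_source _⟩

theorem contMDiff_base : ContMDiff 𝓘(ℂ, 𝒢.BundleModel F) 𝓘(ℂ, F) ω
    (base : CocycleSpace c → T) := by
  intro z
  have hz := 𝒰.mem_indexAt z.base
  set e := chart c (𝒰.indexAt z.base) (coord (𝒰.indexAt z.base) z) z.base with he
  have hze : z ∈ e.source := mem_chart hz
  have h1 := contMDiffAt_of_mem_maximalAtlas (chart_mem_maximalAtlas (c := c) _ _ _) hze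
  have h2 : e z ∈ chartTarget 𝒢 𝒰 _ _ z.base := e.map_source hze
  refine ((contMDiffAt_paramBase h2.1).comp z h1).congr_of_eventuallyEq ?_
  filter_upwards [e.open_source.mem_nhds hze] with y hy
  have := congrArg base (e.left_inv hy)
  exact (this.symm.trans (base_point _ _ _))

theorem contMDiffAt_coord {i : 𝒰.ι} {z : CocycleSpace c} (hz : z.base ∈ 𝒰.U i) :
    ContMDiffAt 𝓘(ℂ, 𝒢.BundleModel F) 𝓘(ℂ, E) ω (coord i : CocycleSpace c → G) z := by
  set e := chart c i (coord i z) z.base with he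
  have hze : z ∈ e.source := mem_chart hz
  have h1 := contMDiffAt_of_mem_maximalAtlas (chart_mem_maximalAtlas (c := c) _ _ _) hze
  have h2 : e z ∈ chartTarget 𝒢 𝒰 i (coord i z) z.base := e.map_source hze
  refine ((contMDiffAt_paramCoord h2).comp z h1).congr_of_eventuallyEq ?_
  filter_upwards [e.open_source.mem_nhds hze] with y hy
  have h3 : e y ∈ chartTarget 𝒢 𝒰 i (coord i z) z.base := e.map_source hy
  have := congrArg (coord i) (e.left_inv hy)
  exact (this.symm.trans (coord_point h3.2.1 (proj_paramCoord h3)))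

section Components

variable {E' : Type*} [NormedAddCommGroup E'] [NormedSpace ℂ E']
  {H' : Type*} [TopologicalSpace H'] {I : ModelWithCorners ℂ E' H'}
  {N : Type*} [TopologicalSpace N] {f : N → CocycleSpace c} {s : Set N} {x : N} {i : 𝒰.ι}

/-- Near a point of the total space, a map is the composite of the inverse of a chart with its
components. -/
theorem eventually_eq_chart_symm (hx : (f x).base ∈ 𝒰.U i)
    (hb : ContinuousWithinAt (fun y => (f y).base) s x)
    (hc : ContinuousWithinAt (fun y => coord i (f y)) s x) :
    ∀ᶠ y in 𝓝[s] x, f y = (chart c i (coord i (f x)) (f x).base).symm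
      (chart c i (coord i (f x)) (f x).base (f y)) := by
  filter_upwards [hb ((𝒰.isOpen i).mem_nhds hx),
    hb ((chartAt F (f x).base).open_source.mem_nhds (mem_chart_source F (f x).base)),
    hc ((𝒢.chart (coord i (f x))).open_source.mem_nhds (𝒢.mem_chart_source _))] with y h1 h2 h3
  exact ((chart c i (coord i (f x)) (f x).base).left_inv ⟨h1, h2, h3⟩).symm

/-- Continuity of a map into the total space may be tested on its components. -/
theorem continuousAt_of_components (hx : (f x).base ∈ 𝒰.U i)
    (hb : ContinuousAt (fun y => (f y).base) x) (hc : ContinuousAt (fun y => coord i (f y)) x) :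
    ContinuousAt f x := by
  set e := chart c i (coord i (f x)) (f x).base with he
  have hev := eventually_eq_chart_symm hx hb.continuousWithinAt (s := Set.univ)
    hc.continuousWithinAt
  rw [nhdsWithin_univ] at hev
  have hxe : f x ∈ e.source := mem_chart hx
  have h1 : ContinuousAt (fun y => e (f y)) x := by
    refine (𝒢.bundleModelEquiv F).symm.continuous.continuousAt.comp (ContinuousAt.prodMk ?_ ?_)
    · exact ContinuousAt.comp ((chartAt F (f x).base).continuousAt (mem_chart_source F (f x).base))
        hb
    · exact (ContinuousAt.comp (f := fun y => coord i (f y))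
        ((𝒢.chart (coord i (f x))).continuousAt (𝒢.mem_chart_source _)) hc).snd
  exact (ContinuousAt.comp (f := fun y => e (f y)) (e.continuousAt_symm (e.map_source hxe))
    h1).congr (hev.mono fun y hy => hy.symm)

variable [ChartedSpace H' N]

/-- Holomorphy of a map into the total space may be tested on its components. -/
theorem contMDiffWithinAt_of_components (hx : (f x).base ∈ 𝒰.U i)
    (hb : ContMDiffWithinAt I 𝓘(ℂ, F) ω (fun y => (f y).base) s x)
    (hc : ContMDiffWithinAt I 𝓘(ℂ, E) ω (fun y => coord i (f y)) s x) :
    ContMDiffWithinAt I 𝓘(ℂ, 𝒢.BundleModel F) ω f s x := by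
  set e := chart c i (coord i (f x)) (f x).base with he
  have hev := eventually_eq_chart_symm hx hb.continuousWithinAt hc.continuousWithinAt
  have hxe : f x ∈ e.source := mem_chart hx
  have e1 : ContMDiffWithinAt I 𝓘(ℂ, F) ω (fun y => chartAt F (f x).base (f y).base) s x :=
    ContMDiffAt.comp_contMDiffWithinAt (f := fun y => (f y).base) x
      (contMDiffAt_of_mem_maximalAtlas (IsManifold.chart_mem_maximalAtlas _)
        (mem_chart_source F (f x).base)) hb
  have e2 : ContMDiffWithinAt I (𝓘(ℂ, ℂ).prod 𝓘(ℂ, 𝒢.FibreModel)) ω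
      (fun y => 𝒢.chart (coord i (f x)) (coord i (f y))) s x :=
    ContMDiffAt.comp_contMDiffWithinAt (f := fun y => coord i (f y)) x
      ((𝒢.isSubmersionChart_chart _).contMDiffAt (𝒢.mem_chart_source _)) hc
  have h1 : ContMDiffWithinAt I 𝓘(ℂ, 𝒢.BundleModel F) ω (fun y => e (f y)) s x :=
    (𝒢.bundleModelEquiv F).symm.contDiff.contMDiff.contMDiffAt.comp_contMDiffWithinAt x
      (e1.prodMk_space e2.snd)
  exact (ContMDiffAt.comp_contMDiffWithinAt (f := fun y => e (f y)) x
    (contMDiffAt_symm_of_mem_maximalAtlas (chart_mem_maximalAtlas _ _ _) (e.map_source hxe))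
    h1).congr_of_eventuallyEq hev (e.left_inv hxe).symm

theorem contMDiffAt_of_components (hx : (f x).base ∈ 𝒰.U i)
    (hb : ContMDiffAt I 𝓘(ℂ, F) ω (fun y => (f y).base) x)
    (hc : ContMDiffAt I 𝓘(ℂ, E) ω (fun y => coord i (f y)) x) :
    ContMDiffAt I 𝓘(ℂ, 𝒢.BundleModel F) ω f x :=
  contMDiffWithinAt_of_components hx hb hc

end Components

end Charts

end CocycleSpace

end CocycleSpace

/-! ### The principal bundle of a cocycle -/

section CocycleBundle

variable {E : Type v} [NormedAddCommGroup E] [NormedSpace ℂ E] [FiniteDimensional ℂ E]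
  {G : Type u} [TopologicalSpace G] [ChartedSpace E G]
  {F : Type w} [NormedAddCommGroup F] [NormedSpace ℂ F] [FiniteDimensional ℂ F]
  {T : Type u} [TopologicalSpace T] [ChartedSpace F T] [IsManifold 𝓘(ℂ, F) ω T]
  {𝒢 : TwistorGroup E G} {𝒯 : RealSpace F T} {𝒰 : RealCover 𝒯} {c : RealCocycle 𝒢 𝒰}

namespace CocycleSpace

theorem continuous_base : Continuous (base : CocycleSpace c → T) := contMDiff_base.continuous

instance [T2Space G] [T2Space T] : T2Space (CocycleSpace c) := by
  rw [t2Space_iff_disjoint_nhds]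
  intro z z' hne
  by_cases hb : z.base = z'.base
  · have hz := 𝒰.mem_indexAt z.base
    have hz' : z'.base ∈ 𝒰.U (𝒰.indexAt z.base) := hb ▸ hz
    have hc : coord (𝒰.indexAt z.base) z ≠ coord (𝒰.indexAt z.base) z' := fun h =>
      hne (ext_coord hz hb h)
    exact (contMDiffAt_coord hz).continuousAt.disjoint (disjoint_nhds_nhds.2 hc)
      (contMDiffAt_coord hz').continuousAt
  · exact continuous_base.continuousAt.disjoint (disjoint_nhds_nhds.2 hb)
      continuous_base.continuousAt

/-! ### Local sections -/

variable (c) in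
/-- The tautological local section `s_i` over `U_i`. -/
noncomputable def unitSection (i : 𝒰.ι) (x : T) : CocycleSpace c := point c i x (𝒢.one (𝒯.proj x))

omit [FiniteDimensional ℂ E] [FiniteDimensional ℂ F] [IsManifold 𝓘(ℂ, F) ω T] in
theorem coord_unitSection {i : 𝒰.ι} {x : T} (hx : x ∈ 𝒰.U i) :
    coord i (unitSection c i x) = 𝒢.one (𝒯.proj x) :=
  coord_point hx (𝒢.proj_one _)

theorem contMDiffAt_unitSection {i : 𝒰.ι} {x : T} (hx : x ∈ 𝒰.U i) :
    ContMDiffAt 𝓘(ℂ, F) 𝓘(ℂ, 𝒢.BundleModel F) ω (unitSection c i) x := by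
  refine contMDiffAt_of_components (i := i) (by simpa [unitSection] using hx) ?_ ?_
  · have h : (fun y => (unitSection c i y).base) = id := funext fun y => base_point _ _ _
    rw [h]
    exact contMDiffAt_id
  · refine (𝒢.one_holomorphic.comp 𝒯.contMDiff_proj).contMDiffAt.congr_of_eventuallyEq ?_
    filter_upwards [(𝒰.isOpen i).mem_nhds hx] with y hy using coord_unitSection hy

variable (c) in
theorem isSubmersion_base : Manifold.IsSubmersion 𝓘(ℂ, 𝒢.BundleModel F) 𝓘(ℂ, F) ω
    (base : CocycleSpace c → T) := by
  refine Manifold.IsSubmersionOfComplement.isSubmersion (F := 𝒢.FibreModel) fun z => ?_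
  have hz := 𝒰.mem_indexAt z.base
  refine Manifold.IsSubmersionAtOfComplement.mk_of_continuousAt continuous_base.continuousAt
    (𝒢.bundleModelEquiv F) (chart c _ _ z.base) (chartAt F z.base) (mem_chart hz)
    (mem_chart_source F z.base) (chart_mem_maximalAtlas _ _ _)
    (IsManifold.chart_mem_maximalAtlas _) ?_
  intro w hw
  have hw' : w ∈ chartTarget 𝒢 𝒰 (𝒰.indexAt z.base) (coord (𝒰.indexAt z.base) z) z.base := by
    have h : w ∈ (chart c (𝒰.indexAt z.base) (coord (𝒰.indexAt z.base) z) z.base).target := by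
      simpa using hw
    exact h
  change chartAt F z.base (point c _ (paramBase 𝒢 z.base w) _).base = _
  rw [base_point]
  exact (chartAt F z.base).right_inv hw'.1

/-! ### The real structure -/

variable (c) in
/-- The real structure of the total space: `g · s_i(x) ↦ τ(g) · s_{bar i}(σ(x))`. -/
noncomputable def conj (z : CocycleSpace c) : CocycleSpace c :=
  point c (𝒰.bar (𝒰.indexAt z.base)) (𝒯.real z.base)
    (𝒢.real (coord (𝒰.indexAt z.base) z))

omit [FiniteDimensional ℂ E] [FiniteDimensional ℂ F] [IsManifold 𝓘(ℂ, F) ω T] in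
@[simp] theorem base_conj (z : CocycleSpace c) : (conj c z).base = 𝒯.real z.base := base_point _ _ _

omit [FiniteDimensional ℂ E] [FiniteDimensional ℂ F] [IsManifold 𝓘(ℂ, F) ω T] in
theorem coord_conj {i : 𝒰.ι} {z : CocycleSpace c} (hz : z.base ∈ 𝒰.U i) :
    coord (𝒰.bar i) (conj c z) = 𝒢.real (coord i z) := by
  have h0 := 𝒰.mem_indexAt z.base
  have hp := proj_coord h0
  rw [conj, coord_point_of_mem (𝒰.real_mem h0) (𝒰.real_mem hz), c.real _ _ _ ⟨h0, hz⟩,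
    ← 𝒢.real_mul _ _ (hp.trans (c.proj_φ h0 hz).symm), coord_mul_φ h0 hz]
  rw [𝒢.proj_real, 𝒯.proj_real, hp]

omit [FiniteDimensional ℂ E] [FiniteDimensional ℂ F] [IsManifold 𝓘(ℂ, F) ω T] in
theorem conj_conj (z : CocycleSpace c) : conj c (conj c z) = z := by
  have hz := 𝒰.mem_indexAt z.base
  have h1 : (conj c z).base ∈ 𝒰.U (𝒰.bar (𝒰.indexAt z.base)) := by
    rw [base_conj]; exact 𝒰.real_mem hz
  refine ext_coord (i := 𝒰.indexAt z.base) (by simpa [𝒯.real_real] using hz)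
    (by simp [𝒯.real_real]) ?_
  have h2 := coord_conj h1
  rwa [𝒰.bar_bar, coord_conj hz, 𝒢.real_real] at h2

theorem continuous_conj : Continuous (conj c) := by
  rw [continuous_iff_continuousAt]
  intro z
  have hz := 𝒰.mem_indexAt z.base
  refine continuousAt_of_components (i := 𝒰.bar (𝒰.indexAt z.base)) ?_ ?_ ?_
  · rw [base_conj]; exact 𝒰.real_mem hz
  · simp only [base_conj]
    exact 𝒯.continuous_real.continuousAt.comp continuous_base.continuousAt
  · have h1 : ContinuousAt (fun y : CocycleSpace c => 𝒢.real (coord (𝒰.indexAt z.base) y)) z :=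
      𝒢.continuous_real.continuousAt.comp (contMDiffAt_coord hz).continuousAt
    refine h1.congr ?_
    filter_upwards [continuous_base.continuousAt ((𝒰.isOpen _).mem_nhds hz)] with y hy
    exact (coord_conj hy).symm

/-- In the charts of the total space, each linear coordinate of `conj` is the sum of a function of
`σ(x)` and a function of `τ(g)`; hence `conj` is antiholomorphic, as `σ` and `τ` are. -/
theorem antiHolomorphic_conj :
    AntiHolomorphic (E := 𝒢.BundleModel F) (F := 𝒢.BundleModel F) (conj c) := by
  refine antiHolomorphic_of_forall_coordinate continuous_conj fun z => ?_
  have hz := 𝒰.mem_indexAt z.base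
  set i := 𝒰.indexAt z.base with hi
  have hz' : (conj c z).base ∈ 𝒰.U (𝒰.bar i) := by rw [base_conj]; exact 𝒰.real_mem hz
  set d := chartAt F (conj c z).base with hd
  set θ := 𝒢.chart (coord (𝒰.bar i) (conj c z)) with hθ
  refine ⟨chart c (𝒰.bar i) (coord (𝒰.bar i) (conj c z)) (conj c z).base,
    chart_mem_maximalAtlas _ _ _, mem_chart hz', fun l => ?_⟩
  let L := (𝒢.bundleModelEquiv F).symm
  let l₁ : F →L[ℂ] ℂ := (l.comp L.toContinuousLinearMap).comp (ContinuousLinearMap.inl ℂ _ _)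
  let l₂ : 𝒢.FibreModel →L[ℂ] ℂ :=
    (l.comp L.toContinuousLinearMap).comp (ContinuousLinearMap.inr ℂ _ _)
  have hl : ∀ p : F × 𝒢.FibreModel, l (L p) = l₁ p.1 + l₂ p.2 := fun p => by
    have : p = (p.1, 0) + (0, p.2) := by simp
    conv_lhs => rw [this, map_add, map_add]
    rfl
  have h1 : ContMDiffAt 𝓘(ℂ, 𝒢.BundleModel F) 𝓘(ℂ, ℂ) ω
      (fun y : CocycleSpace c => star (l₁ (d (𝒯.real y.base)))) z := by
    have e1 : ContMDiffOn 𝓘(ℂ, F) 𝓘(ℂ, ℂ) ω (fun x => l₁ (d x)) d.source :=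
      l₁.contDiff.contMDiff.comp_contMDiffOn
        (contMDiffOn_of_mem_maximalAtlas (IsManifold.chart_mem_maximalAtlas _))
    have e2 := 𝒯.real_antiholomorphic.2 _ _ d.open_source e1
    have e3 : z.base ∈ 𝒯.real ⁻¹' d.source := by
      rw [Set.mem_preimage, ← base_conj]; exact mem_chart_source F _
    exact (e2.contMDiffAt ((d.open_source.preimage 𝒯.continuous_real).mem_nhds e3)).comp z
      contMDiff_base.contMDiffAt
  have h2 : ContMDiffAt 𝓘(ℂ, 𝒢.BundleModel F) 𝓘(ℂ, ℂ) ω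
      (fun y : CocycleSpace c => star (l₂ (θ (𝒢.real (coord i y))).2)) z := by
    have e1 : ContMDiffOn 𝓘(ℂ, E) 𝓘(ℂ, ℂ) ω (fun g => l₂ (θ g).2) θ.source :=
      l₂.contDiff.contMDiff.comp_contMDiffOn
        (contMDiff_snd.comp_contMDiffOn (𝒢.isSubmersionChart_chart _).contMDiffOn)
    have e2 := 𝒢.real_antiholomorphic.2 _ _ θ.open_source e1
    have e3 : coord i z ∈ 𝒢.real ⁻¹' θ.source := by
      rw [Set.mem_preimage, ← coord_conj hz]; exact 𝒢.mem_chart_source _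
    exact (e2.contMDiffAt ((θ.open_source.preimage 𝒢.continuous_real).mem_nhds e3)).comp z
      (contMDiffAt_coord hz)
  have h12 : ContMDiffAt 𝓘(ℂ, 𝒢.BundleModel F) 𝓘(ℂ, ℂ) ω (fun y : CocycleSpace c =>
      star (l₁ (d (𝒯.real y.base))) + star (l₂ (θ (𝒢.real (coord i y))).2)) z := h1.add h2
  refine h12.congr_of_eventuallyEq ?_
  filter_upwards [continuous_base.continuousAt ((𝒰.isOpen _).mem_nhds hz)] with y hy
  change star (l (L (d (conj c y).base, (θ (coord (𝒰.bar i) (conj c y))).2))) = _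
  rw [hl, star_add, base_conj, coord_conj hy]

variable (c) in
/-- The total space of a cocycle as a smooth space with a real structure. -/
noncomputable def realSpace : RealSpace (𝒢.BundleModel F) (CocycleSpace c) where
  proj z := 𝒯.proj z.base
  proj_surjective y := by
    obtain ⟨x, rfl⟩ := 𝒯.proj_surjective y
    exact ⟨unitSection c (𝒰.indexAt x) x, congrArg 𝒯.proj (base_point _ _ _)⟩
  proj_submersion := 𝒯.proj_submersion.comp (isSubmersion_base c)
  real := conj c
  real_antiholomorphic := antiHolomorphic_conj
  real_real := conj_conj
  proj_real z := by rw [base_conj, 𝒯.proj_real]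

/-! ### The action -/

open Classical in
variable (c) in
/-- The action of `𝒢` on the total space by left multiplication on the fibres. (The value is
irrelevant if `g` and `z` lie over different points of `ℂP¹`.) -/
noncomputable def smul (g : G) (z : CocycleSpace c) : CocycleSpace c :=
  if h : 𝒢.proj g = 𝒯.proj z.base then
    ⟨z.base, 𝒢.mul g z.fibre, by rw [𝒢.proj_mul _ _ (h.trans z.proj_fibre.symm), h]⟩
  else z

omit [FiniteDimensional ℂ E] [FiniteDimensional ℂ F] [IsManifold 𝓘(ℂ, F) ω T] in
@[simp] theorem base_smul (g : G) (z : CocycleSpace c) : (smul c g z).base = z.base := by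
  unfold smul; split_ifs <;> rfl

omit [FiniteDimensional ℂ E] [FiniteDimensional ℂ F] [IsManifold 𝓘(ℂ, F) ω T] in
theorem fibre_smul {g : G} {z : CocycleSpace c} (h : 𝒢.proj g = 𝒯.proj z.base) :
    (smul c g z).fibre = 𝒢.mul g z.fibre := by
  rw [smul, dif_pos h]

omit [FiniteDimensional ℂ E] [FiniteDimensional ℂ F] [IsManifold 𝓘(ℂ, F) ω T] in
theorem coord_smul {g : G} {z : CocycleSpace c} {i : 𝒰.ι} (h : 𝒢.proj g = 𝒯.proj z.base)
    (hz : z.base ∈ 𝒰.U i) : coord i (smul c g z) = 𝒢.mul g (coord i z) := by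
  have h1 := z.proj_fibre.trans (c.proj_φ (𝒰.mem_indexAt z.base) hz).symm
  rw [coord, fibre_smul h, base_smul, 𝒢.mul_assoc _ _ _ (h.trans z.proj_fibre.symm) h1, coord]

variable (c) in
/-- The action of `𝒢` on the total space of a cocycle. -/
noncomputable def action : TwistorAction 𝒢 (realSpace c) where
  act := smul c
  act_holomorphic := by
    rintro ⟨g, z⟩ h
    have hz := 𝒰.mem_indexAt z.base
    have hb : ContMDiffAt (𝓘(ℂ, E).prod 𝓘(ℂ, 𝒢.BundleModel F)) 𝓘(ℂ, F) ω
        (fun q : G × CocycleSpace c => q.2.base) (g, z) :=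
      contMDiff_base.contMDiffAt.comp (g, z) contMDiffAt_snd
    have hc : ContMDiffAt (𝓘(ℂ, E).prod 𝓘(ℂ, 𝒢.BundleModel F)) 𝓘(ℂ, E) ω
        (fun q : G × CocycleSpace c => coord (𝒰.indexAt z.base) q.2) (g, z) :=
      ContMDiffAt.comp (f := Prod.snd) (g, z) (contMDiffAt_coord hz) contMDiffAt_snd
    refine contMDiffWithinAt_of_components (i := 𝒰.indexAt z.base) (by simpa using hz) ?_ ?_
    · simpa using hb.contMDiffWithinAt
    -- The multiplication is only defined where the base point lies in the member of the covering.
    · have hS : {q : G × CocycleSpace c | q.2.base ∈ 𝒰.U (𝒰.indexAt z.base)} ∈ 𝓝 (g, z) :=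
        hb.continuousAt ((𝒰.isOpen _).mem_nhds hz)
      rw [← contMDiffWithinAt_inter hS]
      have hm : ∀ q ∈ {q : G × CocycleSpace c | 𝒢.proj q.1 = (realSpace c).proj q.2} ∩
          {q | q.2.base ∈ 𝒰.U (𝒰.indexAt z.base)},
          𝒢.proj q.1 = 𝒢.proj (coord (𝒰.indexAt z.base) q.2) := fun q hq => by
        rw [proj_coord hq.2]; exact hq.1
      refine (𝒢.contMDiffWithinAt_mul contMDiffAt_fst.contMDiffWithinAt hc.contMDiffWithinAt hm
        (hm (g, z) ⟨h, hz⟩)).congr (fun q hq => coord_smul hq.1 hq.2) (coord_smul h hz)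
  proj_act g z _ := congrArg 𝒯.proj (base_smul g z)
  one_act z := by
    refine CocycleSpace.ext (base_smul _ _) ?_
    change (smul c (𝒢.one (𝒯.proj z.base)) z).fibre = _
    rw [fibre_smul (𝒢.proj_one _), ← z.proj_fibre, 𝒢.one_mul]
  mul_act g h z hg hh := by
    have e1 : 𝒢.proj (𝒢.mul g h) = 𝒯.proj z.base := (𝒢.proj_mul _ _ (hg.trans hh.symm)).trans hg
    refine CocycleSpace.ext (by simp) ?_
    rw [fibre_smul e1, fibre_smul (by rw [base_smul]; exact hg), fibre_smul hh,
      𝒢.mul_assoc _ _ _ (hg.trans hh.symm) (hh.trans z.proj_fibre.symm)]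
  real_act g z hg := by
    have hz := 𝒰.mem_indexAt z.base
    have hg' : 𝒢.proj (𝒢.real g) = 𝒯.proj (conj c z).base := by
      rw [𝒢.proj_real, base_conj, 𝒯.proj_real]; exact congrArg _ hg
    have hz' : (conj c z).base ∈ 𝒰.U (𝒰.bar (𝒰.indexAt z.base)) := by
      rw [base_conj]; exact 𝒰.real_mem hz
    change conj c (smul c g z) = smul c (𝒢.real g) (conj c z)
    refine ext_coord (i := 𝒰.bar (𝒰.indexAt z.base)) (by simpa using 𝒰.real_mem hz) (by simp) ?_
    rw [coord_conj (by rwa [base_smul]), coord_smul hg hz, coord_smul hg' hz', coord_conj hz,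
      𝒢.real_mul _ _ (by rw [proj_coord hz]; exact hg)]

variable (c) in
theorem isFree_action : (action c).IsFree := by
  intro g z hg h
  have hg' : 𝒢.proj g = 𝒢.proj z.fibre := hg.trans z.proj_fibre.symm
  have h1 : 𝒢.mul g z.fibre = z.fibre := by
    have := congrArg fibre h
    rwa [show ((action c).act g z).fibre = 𝒢.mul g z.fibre from fibre_smul hg] at this
  have h2 := 𝒢.eq_one_of_mul_eq_self hg' h1
  rwa [z.proj_fibre] at h2

variable (c) in
theorem isRegularQuotient_base : (action c).IsRegularQuotient 𝒯 base where
  eq_iff z z' := by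
    constructor
    · intro h
      have hp : 𝒢.proj z'.fibre = 𝒢.proj (𝒢.inv z.fibre) := by
        rw [𝒢.proj_inv, z.proj_fibre, z'.proj_fibre, h]
      have hg : 𝒢.proj (𝒢.mul z'.fibre (𝒢.inv z.fibre)) = 𝒯.proj z.base := by
        rw [𝒢.proj_mul _ _ hp, z'.proj_fibre, h]
      refine ⟨𝒢.mul z'.fibre (𝒢.inv z.fibre), hg, ?_⟩
      refine CocycleSpace.ext ((base_smul _ _).trans h) ((fibre_smul hg).trans ?_)
      rw [𝒢.inv_mul_cancel_right (hp.trans (𝒢.proj_inv _))]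
    · rintro ⟨g, -, rfl⟩
      exact (base_smul g z).symm
  isQuotientMap := by
    refine (Topology.isQuotientMap_iff _).2 ⟨Topology.isCoinducing_iff.2 fun s =>
      ⟨fun hs => ?_, fun hs => hs.preimage continuous_base⟩,
      fun x => ⟨unitSection c (𝒰.indexAt x) x, base_point _ _ _⟩⟩
    rw [isOpen_iff_mem_nhds]
    intro x hx
    have h1 := (contMDiffAt_unitSection (c := c) (𝒰.mem_indexAt x)).continuousAt
      (hs.mem_nhds (show (unitSection c (𝒰.indexAt x) x).base ∈ s by
        rwa [unitSection, base_point]))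
    filter_upwards [h1] with y hy
    have : (unitSection c (𝒰.indexAt x) y).base ∈ s := hy
    rwa [unitSection, base_point] at this
  holomorphic_iff V f hV := by
    refine ⟨fun hf => hf.comp contMDiff_base.contMDiffOn fun z hz => hz, fun hf x hx => ?_⟩
    refine ContMDiffAt.contMDiffWithinAt ?_
    have hb : ∀ y, (unitSection c (𝒰.indexAt x) y).base = y := fun y => base_point _ _ _
    have h1 : ContMDiffAt 𝓘(ℂ, 𝒢.BundleModel F) 𝓘(ℂ, ℂ) ω (f ∘ base)
        (unitSection c (𝒰.indexAt x) x) :=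
      hf.contMDiffAt ((hV.preimage continuous_base).mem_nhds
        (show (unitSection c (𝒰.indexAt x) x).base ∈ V by rwa [hb]))
    refine (h1.comp x (contMDiffAt_unitSection (𝒰.mem_indexAt x))).congr_of_eventuallyEq ?_
    exact Filter.Eventually.of_forall fun y => (congrArg f (hb y)).symm
  submersion := isSubmersion_base c
  proj_eq _ := rfl
  real_eq z := (base_conj z).symm

end CocycleSpace

variable (c) in
/-- The principal bundle of a real cocycle. -/
noncomputable def RealCocycle.bundle [T2Space G] [T2Space T] : PrincipalBundle 𝒢 𝒯 where
  carrier := CocycleSpace c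
  dim := 𝒢.bundleDim F
  space := CocycleSpace.realSpace c
  action := CocycleSpace.action c
  free := CocycleSpace.isFree_action c
  π := CocycleSpace.base
  regular := CocycleSpace.isRegularQuotient_base c

/-- The bundle of a cocycle has this cocycle as a transition cocycle. -/
theorem RealCocycle.hasTransitionCocycle_bundle [T2Space G] [T2Space T] :
    (RealCocycle.bundle c).HasTransitionCocycle c := by
  refine ⟨CocycleSpace.unitSection c,
    fun i x hx => (CocycleSpace.contMDiffAt_unitSection hx).contMDiffWithinAt,
    fun i x _ => CocycleSpace.base_point _ _ _, fun i x hx => ?_, fun i j x hx => ?_⟩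
  · have hb : (CocycleSpace.unitSection c i x).base ∈ 𝒰.U i := by
      rwa [CocycleSpace.unitSection, CocycleSpace.base_point]
    refine CocycleSpace.ext_coord (i := 𝒰.bar i) ?_ ?_ ?_
    · rw [CocycleSpace.unitSection, CocycleSpace.base_point]; exact 𝒰.real_mem hx
    · change _ = (CocycleSpace.conj c _).base
      rw [CocycleSpace.base_conj, CocycleSpace.unitSection, CocycleSpace.unitSection,
        CocycleSpace.base_point, CocycleSpace.base_point]
    · change _ = CocycleSpace.coord _ (CocycleSpace.conj c _)
      rw [CocycleSpace.coord_conj hb, CocycleSpace.coord_unitSection hx,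
        CocycleSpace.coord_unitSection (𝒰.real_mem hx), 𝒢.real_one, 𝒯.proj_real]
  · have hg : 𝒢.proj (c.φ i j x) = 𝒯.proj (CocycleSpace.unitSection c j x).base := by
      rw [CocycleSpace.unitSection, CocycleSpace.base_point, c.proj_φ hx.1 hx.2]
    change _ = CocycleSpace.smul c (c.φ i j x) (CocycleSpace.unitSection c j x)
    refine CocycleSpace.ext_coord (i := j) ?_ ?_ ?_
    · rw [CocycleSpace.unitSection, CocycleSpace.base_point]; exact hx.2
    · rw [CocycleSpace.base_smul, CocycleSpace.unitSection, CocycleSpace.unitSection,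
        CocycleSpace.base_point, CocycleSpace.base_point]
    · rw [CocycleSpace.coord_smul hg (by
        rw [CocycleSpace.unitSection, CocycleSpace.base_point]; exact hx.2),
        CocycleSpace.coord_unitSection hx.2, CocycleSpace.unitSection,
        CocycleSpace.coord_point_of_mem hx.1 hx.2 (𝒢.proj_one _), ← c.proj_φ hx.1 hx.2,
        𝒢.one_mul, 𝒢.mul_one]

end CocycleBundle

/-! ### The classification -/

theorem mainTheorem4
    {E : Type v} [NormedAddCommGroup E] [NormedSpace ℂ E] [FiniteDimensional ℂ E]
    {G : Type u} [TopologicalSpace G] [T2Space G] [SecondCountableTopology G]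
    [ChartedSpace E G] [IsManifold 𝓘(ℂ, E) ω G]
    {F : Type w} [NormedAddCommGroup F] [NormedSpace ℂ F] [FiniteDimensional ℂ F]
    {T : Type u} [TopologicalSpace T] [T2Space T]
    [ChartedSpace F T] [IsManifold 𝓘(ℂ, F) ω T]
    (𝒢 : TwistorGroup E G) (𝒯 : RealSpace F T) :
    ∃ Θ : PrincipalBundle.IsoClass 𝒢 𝒯 ≃ H1R 𝒢 𝒯,
      ∀ (P : PrincipalBundle 𝒢 𝒯) (𝒰 : RealCover 𝒯) (c : RealCocycle 𝒢 𝒰),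
        Θ P.isoClass = H1R.mk c ↔ P.HasTransitionCocycle c := by
  choose 𝒱 d hd using
    PrincipalBundle.exists_hasTransitionCocycle (𝒢 := 𝒢) (𝒯 := 𝒯)
  have key : ∀ (P : PrincipalBundle 𝒢 𝒯) (𝒰 : RealCover 𝒯) (c : RealCocycle 𝒢 𝒰),
      H1R.mk (d P) = H1R.mk c ↔ P.HasTransitionCocycle c := fun P 𝒰 c =>
    ⟨fun h => (PrincipalBundle.hasTransitionCocycle_congr h).1 (hd P),
      fun h => Quot.sound ((hd P).h1RRel h)⟩
  let Θ : PrincipalBundle.IsoClass 𝒢 𝒯 → H1R 𝒢 𝒯 :=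
    Quotient.lift (fun P => H1R.mk (d P)) fun P Q (h : PrincipalBundle.Isomorphic P Q) =>
      ((key Q _ _).2 (h.hasTransitionCocycle (hd P))).symm
  have hΘ : Function.Bijective Θ := by
    constructor
    · rintro ⟨P⟩ ⟨Q⟩ h
      exact Quotient.sound (((key P _ _).1 h).isomorphic (hd Q))
    · rintro ⟨𝒰, c⟩
      exact ⟨(RealCocycle.bundle c).isoClass,
        (key _ _ c).2 RealCocycle.hasTransitionCocycle_bundle⟩
  exact ⟨Equiv.ofBijective Θ hΘ, key⟩
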